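/- **Theorem 1.2.** Let $\kappa>0$, let $p(\kappa)=\Pr[|Z|\le\kappa]$ for a standard Gaussian random variable $Z$, and put $\alpha_c=\alpha_c(\kappa)=-\log 2/\log p(\kappa)$ (natural logarithms). For $N\ge 1$ let $X_1,X_2,\dots$ be i.i.d. standard Gaussian vectors in $\mathbb R^N$, and for $\alpha>0$ let $$S=S_\alpha(N)=\bigcap_{i=1}^{\lfloor \alpha N\rfloor}\bigl\{\sigma\in\{\pm1\}^N : |\langle X_i,\sigma\rangle|\le \kappa\sqrt N\bigr\}.$$ Let $H(\beta)=-\beta\log\beta-(1-\beta)\log(1-\beta)$, let $q_\kappa(\beta)=\Pr[|Z_1|\le\kappa,\ |Z_2|\le\kappa]$ where $(Z_1,Z_2)$ is jointly Gaussian with means $0$, variances $1$ and covariance $2\beta-1$, and let $F_\alpha(\beta)=H(\beta)+\alpha\log q_\kappa(\beta)$. (a) Let $0<\alpha<\alpha_c$ and assume (Assumption 1) that if $F_\alpha''(1/2)<0$, then $F_\alpha$ has exactly one critical point in $(0,1/2)$. Then, as $N\to\infty$, $$\frac1N\log|S|=\log 2+\alpha\log p(\kappa)+O_{\mathbb P}\Bigl(\frac{\log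 N}{N}\Bigr),$$ that is, for every $\varepsilon>0$ there is $M$ such that for all sufficiently large $N$, with probability at least $1-\varepsilon$, $S\neq\emptyset$ and $\bigl|\frac1N\log|S|-\log 2-\alpha\log p(\kappa)\bigr|\le M\frac{\log N}{N}$. In particular, $\Pr[S_\alpha(N)\ne\emptyset]\to1$. (b) For every $\alpha>\alpha_c$, $\Pr[S_\alpha(N)=\emptyset]\to 1$. Thus, if the assumption in (a) holds for every $\alpha\in(0,\alpha_c)$, there is a sharp satisfiability threshold at $\alpha_c$. -/

import Mathlib

open MeasureTheory ProbabilityTheory Filter Topology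

noncomputable section

namespace SymmetricPerceptron

/-- `p(κ) = ℙ(|Z| ≤ κ)` for a standard Gaussian random variable `Z`. -/
def p (κ : ℝ) : ℝ := (gaussianReal 0 1).real {z | |z| ≤ κ}

/-- The critical capacity density `α_c(κ) = - log 2 / log p(κ)`. For `κ > 0` one has
`0 < p(κ) < 1`, so the denominator is negative and `α_c(κ) > 0`. -/
def alphaC (κ : ℝ) : ℝ := -Real.log 2 / Real.log (p κ)

/-- `q_κ(β) = ℙ(|Z₁| ≤ κ, |Z₂| ≤ κ)` where `(Z₁, Z₂)` is jointly Gaussian with means `0`,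
variances `1` and covariance `2β - 1`. It is only meaningful for `0 ≤ β ≤ 1`, where the
covariance matrix is positive semidefinite. -/
def q (κ β : ℝ) : ℝ :=
  (multivariateGaussian (0 : EuclideanSpace ℝ (Fin 2))
    !![1, 2 * β - 1; 2 * β - 1, 1]).real {z | |z 0| ≤ κ ∧ |z 1| ≤ κ}

/-- `F_α(β) = H(β) + α log q_κ(β)`, where
`H(β) = - β log β - (1 - β) log (1 - β)` is the Shannon entropy in natural units
(`Real.binEntropy`). -/
def F (κ α β : ℝ) : ℝ := Real.binEntropy β + α * Real.log (q κ β)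

/-- The assumption on `F_α`: if `F_α''(1/2) < 0`, then `F_α` has a single critical point
in the open interval `(0, 1/2)`. -/
def CriticalPointAssumption (κ α : ℝ) : Prop :=
  deriv (deriv (F κ α)) (1 / 2) < 0 →
    ∃! β : ℝ, β ∈ Set.Ioo (0 : ℝ) (1 / 2) ∧ HasDerivAt (F κ α) 0 β

/-- The Hamming cube `Σ_N = {±1}^N`; the units of `ℤ` are exactly `1` and `-1`. -/
abbrev Cube (N : ℕ) : Type := Fin N → ℤˣ

/-- The inner product `⟨x, σ⟩ = ∑ j, x_j σ_j` of a real vector with a point of the cube. -/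
def dot {N : ℕ} (x : EuclideanSpace ℝ (Fin N)) (σ : Cube N) : ℝ :=
  ∑ j, x j * ((σ j : ℤ) : ℝ)

/-- `H_κ(x) = {σ ∈ Σ_N : |⟨x, σ⟩| ≤ κ √N}`. -/
def slab (κ : ℝ) {N : ℕ} (x : EuclideanSpace ℝ (Fin N)) : Set (Cube N) :=
  {σ | |dot x σ| ≤ κ * √(N : ℝ)}

/-- The solution space with constraint vectors `x 0, …, x (m - 1)`:
`S = H_κ(x 0) ∩ ⋯ ∩ H_κ(x (m - 1))`, a subset of the cube (the whole cube if `m = 0`). -/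
def solutions (κ : ℝ) {N : ℕ} (m : ℕ) (x : ℕ → EuclideanSpace ℝ (Fin N)) : Set (Cube N) :=
  ⋂ i ∈ Finset.range m, slab κ (x i)

end SymmetricPerceptron

end

/-!
Write `S_t` for the set of solutions of the first `t` constraints and `W_t` for the ratio of `|S_t|`
to its mean `2^N p(κ)^t`. The upper bounds on `|S_t|` come from the first moment: the mean number
of solutions decays exponentially above `α_c`, and Markov's inequality bounds `W_t` from above.

For the lower bound below `α_c`, the function `F_α` is shown to stay below its value at `1/2` by a
quadratic gap, `F_α(β) ≤ F_α(1/2) - c (2β - 1)²` (`exists_quadratic_gap`). The assumption on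
critical points only applies once `F_α''(1/2) < 0`. By Plackett's identity (`hasDerivAt_pairProb`),
to have this for all `α < α_c` amounts to `log 2 · (κ p'(κ) / p(κ))² ≤ -log p(κ)`, which holds for every `κ > 0` but is nearly
an equality around `κ = 1.36` (`levelTwoGap_nonneg`). The gap turns the second-moment computation
into a bound on the mean of `∑ exp (c N R²)` over pairs of solutions with overlap `R`, which is at
most `N + 1` after division by `(𝔼|S_t|)²` (`sum_pair_le`). So, unless `W_t` is polynomially small,
typical overlaps in `S_t` are of order `N^{-1/2}` up to logarithms.

The second moment by itself does not show that `W_t` is rarely small. Instead, constraints are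
revealed one at a time, and the potential `log B - 2 log W_t`, with `B = (N + 1)³`, is followed until
it exceeds a cap `A` of order `log N` or the overlap sum exceeds `B`. Given `S_t`, the fraction of
points that survive a new constraint has mean `p(κ)` and a variance of the order of the mean of
`R²`, because the slab is even and the pair probability has no linear term in `R`. The exponential
moment bounds the mean of `R²` by the potential divided by `c N`, so the potential grows by a factor
`1 + O(1/N)` per step and, over `O(N)` steps, its mean stays `O(log N)`
(`measureReal_sparse_mul_le`).

The logarithm also requires that a new constraint rarely kills most of `S_t`, with an error summable
over `O(N)` steps, which the variance alone does not give. The indicator of the slab is compared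
with a Gaussian bump, an average of cosines. The fourth moment of the centred sum of cosines is
controlled by cubed overlaps: the terms of first order in the overlaps cancel in an alternating sum
over subsets of four replicas, and those of second order cancel upon averaging over the signs of the
replicas (`abs_integral_prod_cos_le`). This gives probability `N^{-3/2}` up to logarithms for a small
slice (`measureReal_card_slice_lt_le`).
-/

open scoped RealInnerProductSpace

namespace SymmetricPerceptron

/-! ### The one-dimensional Gaussian slab and comparison with odd series -/

/-- The unnormalized error function `∫₀^κ e^{-t²/2} dt`. -/
noncomputable def gaussInt (κ : ℝ) : ℝ := ∫ t in (0 : ℝ)..κ, Real.exp (-t ^ 2 / 2)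

lemma hasDerivAt_gaussInt (κ : ℝ) : HasDerivAt gaussInt (Real.exp (-κ ^ 2 / 2)) κ := by
  have hc : Continuous fun t : ℝ => Real.exp (-t ^ 2 / 2) := by fun_prop
  exact intervalIntegral.integral_hasDerivAt_right (hc.intervalIntegrable _ _)
    (hc.stronglyMeasurableAtFilter _ _) hc.continuousAt

lemma gaussInt_pos {κ : ℝ} (hκ : 0 < κ) : 0 < gaussInt κ :=
  intervalIntegral.intervalIntegral_pos_of_pos
    ((by fun_prop : Continuous fun t : ℝ => Real.exp (-t ^ 2 / 2)).intervalIntegrable _ _)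
    (fun _ => Real.exp_pos _) hκ

lemma gaussInt_neg (κ : ℝ) : gaussInt (-κ) = -gaussInt κ := by
  have h := intervalIntegral.integral_comp_neg (a := 0) (b := κ)
    (fun t : ℝ => Real.exp (-t ^ 2 / 2))
  simp only [neg_sq, neg_zero] at h
  rw [gaussInt, gaussInt, h, intervalIntegral.integral_symm]

lemma integral_exp_neg_sq_symm (κ : ℝ) :
    ∫ t in (-κ)..κ, Real.exp (-t ^ 2 / 2) = 2 * gaussInt κ := by
  have hc : Continuous fun t : ℝ => Real.exp (-t ^ 2 / 2) := by fun_prop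
  have h3 := intervalIntegral.integral_add_adjacent_intervals (hc.intervalIntegrable (-κ) 0)
    (hc.intervalIntegrable (μ := volume) 0 κ)
  have h4 := gaussInt_neg κ
  rw [gaussInt, intervalIntegral.integral_symm] at h4
  rw [← h3, neg_injective h4, gaussInt]
  ring

lemma gaussianReal_real_Icc {a b : ℝ} (hab : a ≤ b) :
    (gaussianReal 0 1).real (Set.Icc a b) =
      (√(2 * Real.pi))⁻¹ * ∫ t in a..b, Real.exp (-t ^ 2 / 2) := by
  rw [measureReal_def, gaussianReal_apply_eq_integral _ one_ne_zero,
    ENNReal.toReal_ofReal (setIntegral_nonneg measurableSet_Icc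
      fun _ _ => gaussianPDFReal_nonneg _ _ _), integral_Icc_eq_integral_Ioc,
    ← intervalIntegral.integral_of_le hab, ← intervalIntegral.integral_const_mul]
  simp [gaussianPDFReal_def]

lemma p_eq {κ : ℝ} (hκ : 0 ≤ κ) : p κ = √(2 / Real.pi) * gaussInt κ := by
  have h1 : {z : ℝ | |z| ≤ κ} = Set.Icc (-κ) κ := by ext; simp [abs_le]
  have h5 : (√(2 * Real.pi))⁻¹ * 2 = √(2 / Real.pi) := by
    rw [Real.sqrt_mul (by norm_num), Real.sqrt_div (by norm_num)]
    have : √(2 : ℝ) * √2 = 2 := Real.mul_self_sqrt (by norm_num)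
    field_simp
    nlinarith
  rw [p, h1, gaussianReal_real_Icc (by linarith), integral_exp_neg_sq_symm, ← h5]
  ring

lemma p_pos {κ : ℝ} (hκ : 0 < κ) : 0 < p κ := by
  rw [p_eq hκ.le]
  have := gaussInt_pos hκ
  positivity

lemma p_lt_one (κ : ℝ) : p κ < 1 := by
  have h1 : (gaussianReal 0 1).real {z : ℝ | |z| ≤ κ}ᶜ ≠ 0 := by
    rw [measureReal_ne_zero_iff]
    intro h
    have h2 := gaussianReal_absolutelyContinuous' 0 (v := 1) one_ne_zero h
    have h3 : Set.Ioi κ ⊆ {z : ℝ | |z| ≤ κ}ᶜ := fun z hz => by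
      simp only [Set.mem_compl_iff, Set.mem_ofPred_eq, not_le]
      exact lt_of_lt_of_le hz (le_abs_self z)
    simpa using measure_mono_null h3 h2
  have h2 : 0 ≤ (gaussianReal 0 1).real {z : ℝ | |z| ≤ κ}ᶜ := measureReal_nonneg
  have h3 := probReal_compl_eq_one_sub (μ := gaussianReal 0 1) (s := {z : ℝ | |z| ≤ κ})
    (measurableSet_le (by fun_prop) (by fun_prop))
  rw [p]
  have := lt_of_le_of_ne h2 h1.symm
  linarith

lemma log_p_neg {κ : ℝ} (hκ : 0 < κ) : Real.log (p κ) < 0 :=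
  Real.log_neg (p_pos hκ) (p_lt_one κ)

lemma tendsto_p_atTop : Tendsto p atTop (𝓝 1) := by
  have h := tendsto_measure_iUnion_atTop (μ := gaussianReal 0 1)
    (s := fun κ : ℝ => {z : ℝ | |z| ≤ κ}) (fun a b hab z hz => le_trans hz hab)
  have h2 : (⋃ κ : ℝ, {z : ℝ | |z| ≤ κ}) = Set.univ :=
    Set.eq_univ_of_forall fun z => Set.mem_iUnion.2 ⟨|z|, by simp⟩
  rw [h2, measure_univ] at h
  have h3 := (ENNReal.tendsto_toReal ENNReal.one_ne_top).comp h
  rwa [ENNReal.toReal_one] at h3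

/-! ### The level-two Gaussian weight of a symmetric interval -/

/-- Powers lie above their tangents on the nonnegative half-line. -/
lemma le_pow_tangent (k : ℕ) {x y : ℝ} (hx : 0 ≤ x) (hy : 0 ≤ y) :
    x ^ (k + 1) + (k + 1) * x ^ k * (y - x) ≤ y ^ (k + 1) := by
  induction k with
  | zero => simp
  | succ k ih =>
    have h1 := mul_le_mul_of_nonneg_left ih hy
    have h2 : 0 ≤ (k + 1) * x ^ k * (y - x) ^ 2 := by positivity
    push_cast
    calc x ^ (k + 1 + 1) + (k + 1 + 1) * x ^ (k + 1) * (y - x)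
        = y * (x ^ (k + 1) + (k + 1) * x ^ k * (y - x)) - (k + 1) * x ^ k * (y - x) ^ 2 := by ring
      _ ≤ y ^ (k + 1 + 1) := by rw [pow_succ y (k + 1), mul_comm _ y]; linarith

/-- Powers lie below their chords on the nonnegative half-line. -/
lemma pow_le_chord (k : ℕ) {l r y : ℝ} (hl : 0 ≤ l) (hlr : l < r) (hy : l ≤ y) (hy' : y ≤ r) :
    y ^ k ≤ l ^ k + (r ^ k - l ^ k) / (r - l) * (y - l) := by
  have h0 : 0 < r - l := by linarith
  have h := (convexOn_pow (𝕜 := ℝ) k).2 (Set.mem_Ici.2 hl)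
    (Set.mem_Ici.2 (by linarith : (0 : ℝ) ≤ r))
    (div_nonneg (by linarith : 0 ≤ r - y) h0.le)
    (div_nonneg (by linarith : 0 ≤ y - l) h0.le) (by field_simp; ring)
  simp only [smul_eq_mul] at h
  have e1 : (r - y) / (r - l) * l + (y - l) / (r - l) * r = y := by field_simp; ring
  rw [e1] at h
  refine h.trans (le_of_eq ?_)
  field_simp
  ring

/-- The partial sum `∑_{k ≤ 6} y^k / (2k+1)!!`. -/
noncomputable def oddSeries (y : ℝ) : ℝ :=
  1 + y / 3 + y ^ 2 / 15 + y ^ 3 / 105 + y ^ 4 / 945 + y ^ 5 / 10395 + y ^ 6 / 135135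

/-- An upper bound for the full series `∑ y^k / (2k+1)!!` on `0 ≤ y ≤ 43/10`. There the tail from
the power `y^7` on is at most a geometric series of ratio `y / 15`, and `15 - 43/10 = 107/10`. -/
noncomputable def oddSeriesUpper (y : ℝ) : ℝ := oddSeries y + y ^ 7 / (135135 * (107 / 10))

/-- The ratio of the error function to `κ e^{-κ²/2}`; it equals `∑ κ^{2k} / (2k+1)!!`. -/
noncomputable def invMills (κ : ℝ) : ℝ := gaussInt κ / (κ * Real.exp (-κ ^ 2 / 2))

lemma hasDerivAt_expSq (κ : ℝ) :
    HasDerivAt (fun x : ℝ => Real.exp (-x ^ 2 / 2)) (-κ * Real.exp (-κ ^ 2 / 2)) κ := by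
  have h := ((hasDerivAt_pow 2 κ).neg.div_const 2).exp
  have e : -κ * Real.exp (-κ ^ 2 / 2) =
      Real.exp (-κ ^ 2 / 2) * (-(((2 : ℕ) : ℝ) * κ ^ (2 - 1)) / 2) := by
    push_cast; ring
  rw [e]
  exact h

/-- The difference of the two sides, multiplied by `κ e^{-κ²/2}`, has the derivative
`e^{-κ²/2} κ^14 / 135135`, as all lower powers telescope. -/
lemma oddSeries_le_invMills {κ : ℝ} (hκ : 0 < κ) : oddSeries (κ ^ 2) ≤ invMills κ := by
  have hd : ∀ x : ℝ, HasDerivAt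
      (fun x => gaussInt x - x * Real.exp (-x ^ 2 / 2) * oddSeries (x ^ 2))
      (Real.exp (-x ^ 2 / 2) * (x ^ 14 / 135135)) x := by
    intro x
    have h1 : HasDerivAt (fun x : ℝ => oddSeries (x ^ 2))
        (2 * x / 3 + 4 * x ^ 3 / 15 + 6 * x ^ 5 / 105 + 8 * x ^ 7 / 945 + 10 * x ^ 9 / 10395
          + 12 * x ^ 11 / 135135) x := by
      have e : (fun x : ℝ => oddSeries (x ^ 2)) = fun x => 1 + x ^ 2 / 3 + x ^ 4 / 15 + x ^ 6 / 105
          + x ^ 8 / 945 + x ^ 10 / 10395 + x ^ 12 / 135135 := by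
        funext x; simp only [oddSeries]; ring
      rw [e]
      refine HasDerivAt.congr_deriv ((((((((hasDerivAt_pow 2 x).div_const 3).const_add 1).add
        ((hasDerivAt_pow 4 x).div_const 15)).add ((hasDerivAt_pow 6 x).div_const 105)).add
        ((hasDerivAt_pow 8 x).div_const 945)).add ((hasDerivAt_pow 10 x).div_const 10395)).add
        ((hasDerivAt_pow 12 x).div_const 135135)) ?_
      push_cast; ring
    have h2 := (hasDerivAt_gaussInt x).sub
      ((((hasDerivAt_id x).mul (hasDerivAt_expSq x))).mul h1)
    refine h2.congr_deriv ?_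
    simp only [id, oddSeries, Pi.mul_apply]
    ring
  have hm : Monotone (fun x => gaussInt x - x * Real.exp (-x ^ 2 / 2) * oddSeries (x ^ 2)) :=
    monotone_of_hasDerivAt_nonneg hd fun x => by simp only [Pi.zero_apply]; positivity
  have h0 := hm hκ.le
  have hg0 : gaussInt 0 = 0 := by simp [gaussInt]
  simp only [hg0, zero_mul, sub_zero, sub_nonneg] at h0
  rw [invMills, le_div_iff₀ (by positivity), mul_comm]
  exact h0

lemma invMills_le {κ : ℝ} (hκ : 0 < κ) (hκ' : κ ^ 2 ≤ 43 / 10) :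
    invMills κ ≤ oddSeriesUpper (κ ^ 2) := by
  have hd : ∀ x : ℝ, HasDerivAt
      (fun x => x * Real.exp (-x ^ 2 / 2) * oddSeriesUpper (x ^ 2) - gaussInt x)
      (Real.exp (-x ^ 2 / 2) * (x ^ 14 / 135135 * (1 / (107 / 10) * (15 - x ^ 2) - 1))) x := by
    intro x
    have h1 : HasDerivAt (fun x : ℝ => oddSeriesUpper (x ^ 2))
        (2 * x / 3 + 4 * x ^ 3 / 15 + 6 * x ^ 5 / 105 + 8 * x ^ 7 / 945 + 10 * x ^ 9 / 10395
          + 12 * x ^ 11 / 135135 + 14 * x ^ 13 / (135135 * (107 / 10))) x := by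
      have e : (fun x : ℝ => oddSeriesUpper (x ^ 2)) = fun x => 1 + x ^ 2 / 3 + x ^ 4 / 15
          + x ^ 6 / 105 + x ^ 8 / 945 + x ^ 10 / 10395 + x ^ 12 / 135135
          + x ^ 14 / (135135 * (107 / 10)) := by
        funext x; simp only [oddSeriesUpper, oddSeries]; ring
      rw [e]
      refine HasDerivAt.congr_deriv (((((((((hasDerivAt_pow 2 x).div_const 3).const_add 1).add
        ((hasDerivAt_pow 4 x).div_const 15)).add ((hasDerivAt_pow 6 x).div_const 105)).add
        ((hasDerivAt_pow 8 x).div_const 945)).add ((hasDerivAt_pow 10 x).div_const 10395)).add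
        ((hasDerivAt_pow 12 x).div_const 135135)).add
        ((hasDerivAt_pow 14 x).div_const (135135 * (107 / 10)))) ?_
      push_cast; ring
    have h2 := ((((hasDerivAt_id x).mul (hasDerivAt_expSq x))).mul h1).sub (hasDerivAt_gaussInt x)
    refine h2.congr_deriv ?_
    simp only [id, oddSeriesUpper, oddSeries, Pi.mul_apply]
    ring
  have hm : MonotoneOn (fun x => x * Real.exp (-x ^ 2 / 2) * oddSeriesUpper (x ^ 2) - gaussInt x)
      (Set.Icc 0 κ) := by
    refine monotoneOn_of_hasDerivWithinAt_nonneg (convex_Icc 0 κ)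
      (fun x _ => (hd x).continuousAt.continuousWithinAt) (fun x _ => (hd x).hasDerivWithinAt) ?_
    intro x hx
    rw [interior_Icc] at hx
    have h2 : x ^ 2 ≤ 43 / 10 := le_trans (pow_le_pow_left₀ hx.1.le hx.2.le 2) hκ'
    have h3 : 0 ≤ 1 / (107 / 10) * (15 - x ^ 2) - 1 := by linarith
    positivity
  have h0 := hm (Set.left_mem_Icc.2 hκ.le) (Set.right_mem_Icc.2 hκ.le) hκ.le
  have hg0 : gaussInt 0 = 0 := by simp [gaussInt]
  simp only [hg0, zero_mul, sub_zero, sub_nonneg] at h0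
  rw [invMills, div_le_iff₀ (by positivity), mul_comm]
  exact h0

/-! ### Numerical bound on the level-two coefficient -/

lemma oddSeriesUpper_le_chord {l r y : ℝ} (hl : 0 ≤ l) (hlr : l < r) (hy : l ≤ y) (hy' : y ≤ r) :
    oddSeriesUpper y ≤
      oddSeriesUpper l + (oddSeriesUpper r - oddSeriesUpper l) / (r - l) * (y - l) := by
  have h (k : ℕ) := pow_le_chord k hl hlr hy hy'
  have h1 : y ≤ l + (r - l) / (r - l) * (y - l) := by simpa only [pow_one] using h 1
  have h2 := h 2
  have h3 := h 3
  have h4 := h 4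
  have h5 := h 5
  have h6 := h 6
  have h7 := h 7
  have e : oddSeriesUpper l + (oddSeriesUpper r - oddSeriesUpper l) / (r - l) * (y - l) =
      1 + (l + (r - l) / (r - l) * (y - l)) / 3
      + (l ^ 2 + (r ^ 2 - l ^ 2) / (r - l) * (y - l)) / 15
      + (l ^ 3 + (r ^ 3 - l ^ 3) / (r - l) * (y - l)) / 105
      + (l ^ 4 + (r ^ 4 - l ^ 4) / (r - l) * (y - l)) / 945
      + (l ^ 5 + (r ^ 5 - l ^ 5) / (r - l) * (y - l)) / 10395
      + (l ^ 6 + (r ^ 6 - l ^ 6) / (r - l) * (y - l)) / 135135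
      + (l ^ 7 + (r ^ 7 - l ^ 7) / (r - l) * (y - l)) / (135135 * (107 / 10)) := by
    simp only [oddSeriesUpper, oddSeries]
    ring
  rw [e]
  simp only [oddSeriesUpper, oddSeries]
  gcongr

lemma oddSeries_tangent_le {x y : ℝ} (hx : 0 ≤ x) (hy : 0 ≤ y) :
    oddSeries x + (1 / 3 + 2 * x / 15 + 3 * x ^ 2 / 105 + 4 * x ^ 3 / 945 + 5 * x ^ 4 / 10395
      + 6 * x ^ 5 / 135135) * (y - x) ≤ oddSeries y := by
  have h (k : ℕ) := le_pow_tangent k hx hy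
  have h2 := h 1
  have h3 := h 2
  have h4 := h 3
  have h5 := h 4
  have h6 := h 5
  norm_num at h2 h3 h4 h5 h6
  simp only [oddSeries]
  linarith

lemma oddSeries_ge {y : ℝ} (hy : 0 ≤ y) : 1 + y / 3 + y ^ 2 / 15 ≤ oddSeries y := by
  rw [oddSeries]
  have : 0 ≤ y ^ 3 / 105 + y ^ 4 / 945 + y ^ 5 / 10395 + y ^ 6 / 135135 := by positivity
  linarith

lemma invMills_ge {κ : ℝ} (hκ : 0 < κ) : 1 + κ ^ 2 / 3 + (κ ^ 2) ^ 2 / 15 ≤ invMills κ :=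
  (oddSeries_ge (sq_nonneg κ)).trans (oddSeries_le_invMills hκ)

lemma invMills_pos {κ : ℝ} (hκ : 0 < κ) : 0 < invMills κ := by
  have := gaussInt_pos hκ
  rw [invMills]
  positivity

/-- The quadratic form whose sign, at `a = invMills κ` and `y = κ²`, is opposite to that of the
derivative of `levelTwoGap`. -/
noncomputable def gapQuad (a y : ℝ) : ℝ := a ^ 2 - 2 * Real.log 2 * (y - 1) * a - 2 * Real.log 2

/-- The difference `-log p(κ) - log 2 · (κ p'(κ) / p(κ))²`. -/
noncomputable def levelTwoGap (κ : ℝ) : ℝ := -Real.log (p κ) - Real.log 2 / invMills κ ^ 2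

lemma hasDerivAt_levelTwoGap {κ : ℝ} (hκ : 0 < κ) :
    HasDerivAt levelTwoGap (-gapQuad (invMills κ) (κ ^ 2) / (κ * invMills κ ^ 3)) κ := by
  have hg := gaussInt_pos hκ
  have hc : (√(2 / Real.pi)) ≠ 0 := by positivity
  have h1 : HasDerivAt (fun x => -Real.log (√(2 / Real.pi) * gaussInt x)
      - Real.log 2 * (x * Real.exp (-x ^ 2 / 2) / gaussInt x) ^ 2)
      (-(√(2 / Real.pi) * Real.exp (-κ ^ 2 / 2) / (√(2 / Real.pi) * gaussInt κ)) -
        Real.log 2 * (2 * (κ * Real.exp (-κ ^ 2 / 2) / gaussInt κ) *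
          (((1 * Real.exp (-κ ^ 2 / 2) + κ * (-κ * Real.exp (-κ ^ 2 / 2))) * gaussInt κ -
            κ * Real.exp (-κ ^ 2 / 2) * Real.exp (-κ ^ 2 / 2)) / gaussInt κ ^ 2))) κ := by
    have a1 := (((hasDerivAt_gaussInt κ).const_mul (√(2 / Real.pi))).log
      (by positivity)).neg
    have a2 := (((((hasDerivAt_id κ).mul (hasDerivAt_expSq κ)).div (hasDerivAt_gaussInt κ)
      hg.ne').pow 2).const_mul (Real.log 2))
    refine (a1.sub a2).congr_deriv ?_
    simp
  have h2 : levelTwoGap =ᶠ[𝓝 κ] (fun x => -Real.log (√(2 / Real.pi) * gaussInt x)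
      - Real.log 2 * (x * Real.exp (-x ^ 2 / 2) / gaussInt x) ^ 2) := by
    filter_upwards [eventually_gt_nhds hκ] with x hx
    have := gaussInt_pos hx
    rw [levelTwoGap, p_eq hx.le, invMills]
    field_simp
  refine (h1.congr_of_eventuallyEq h2).congr_deriv ?_
  rw [gapQuad, invMills]
  have he := Real.exp_pos (-κ ^ 2 / 2)
  generalize Real.exp (-κ ^ 2 / 2) = e at *
  field_simp
  ring

/-- If the derivative of the gap is at least `-m` on an interval, the gap drops at most at rate `m`
there. -/
lemma levelTwoGap_ge {l r m : ℝ} (hl : 0 < l)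
    (h : ∀ x, l ≤ x → x ≤ r → gapQuad (invMills x) (x ^ 2) ≤ m * (x * invMills x ^ 3))
    {x : ℝ} (hx : l ≤ x) (hx' : x ≤ r) : levelTwoGap l - m * (x - l) ≤ levelTwoGap x := by
  have hd : ∀ z ∈ Set.Icc l r, HasDerivAt (fun z => levelTwoGap z + m * z)
      (-gapQuad (invMills z) (z ^ 2) / (z * invMills z ^ 3) + m) z := fun z hz =>
    ((hasDerivAt_levelTwoGap (hl.trans_le hz.1)).add
      ((hasDerivAt_id z).const_mul m)).congr_deriv (by simp)
  have hm : MonotoneOn (fun z => levelTwoGap z + m * z) (Set.Icc l r) := by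
    refine monotoneOn_of_hasDerivWithinAt_nonneg (convex_Icc l r)
      (fun z hz => (hd z hz).continuousAt.continuousWithinAt)
      (fun z hz => (hd z (interior_subset hz)).hasDerivWithinAt) fun z hz => ?_
    have hz := interior_subset hz
    have hz0 := hl.trans_le hz.1
    have h1 := h z hz.1 hz.2
    have h2 : 0 < z * invMills z ^ 3 := by have := invMills_pos hz0; positivity
    have h3 : gapQuad (invMills z) (z ^ 2) / (z * invMills z ^ 3) ≤ m := by
      rwa [div_le_iff₀ h2]
    rw [neg_div]
    linarith
  have := hm ⟨le_refl l, hx.trans hx'⟩ ⟨hx, hx'⟩ hx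
  simp only at this
  linarith

lemma levelTwoGap_antitone {l r : ℝ} (hl : 0 < l)
    (h : ∀ x, l ≤ x → x ≤ r → 0 ≤ gapQuad (invMills x) (x ^ 2)) (hlr : l ≤ r) :
    levelTwoGap r ≤ levelTwoGap l := by
  have hm : AntitoneOn levelTwoGap (Set.Icc l r) := by
    refine antitoneOn_of_hasDerivWithinAt_nonpos (convex_Icc l r)
      (fun z hz => (hasDerivAt_levelTwoGap (hl.trans_le hz.1)).continuousAt.continuousWithinAt)
      (fun z hz => (hasDerivAt_levelTwoGap
        (hl.trans_le (interior_subset hz).1)).hasDerivWithinAt) fun z hz => ?_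
    have hz := interior_subset hz
    have hz0 := hl.trans_le hz.1
    have h1 := h z hz.1 hz.2
    have h2 : 0 < z * invMills z ^ 3 := by have := invMills_pos hz0; positivity
    rw [neg_div]
    have := div_nonneg h1 h2.le
    linarith
  exact hm ⟨le_refl l, hlr⟩ ⟨hlr, le_refl r⟩ hlr

/-- The quadratic form is increasing in its first argument beyond its vertex. -/
lemma gapQuad_mono {a b y : ℝ} (hab : a ≤ b) (h : 2 * Real.log 2 * (y - 1) ≤ a + b) :
    gapQuad a y ≤ gapQuad b y := by
  rw [gapQuad, gapQuad]
  nlinarith [mul_nonneg (sub_nonneg.2 hab) (sub_nonneg.2 h)]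

/-- For small `κ`, `invMills` is replaced by `1 + y/3` if `y = κ² ≤ 1`, and by a rounded tangent of
`oddSeries` at `y = 1.36²` otherwise. -/
lemma gapQuad_nonneg_of_le {κ : ℝ} (hκ : 0 < κ) (hκ' : κ ≤ 34 / 25) :
    0 ≤ gapQuad (invMills κ) (κ ^ 2) := by
  have hc1 := Real.log_two_gt_d9
  have hc2 := Real.log_two_lt_d9
  have hy : κ ^ 2 ≤ 1156 / 625 := by nlinarith
  have hy0 : 0 < κ ^ 2 := by positivity
  have ha := oddSeries_le_invMills hκ
  generalize κ ^ 2 = y at *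
  generalize invMills κ = a at *
  have h1 : 1 + y / 3 ≤ oddSeries y :=
    le_trans (by linarith [sq_nonneg y]) (oddSeries_ge hy0.le)
  rcases le_total y 1 with h | h
  · refine le_trans ?_ (gapQuad_mono (h1.trans ha) (by nlinarith))
    rw [gapQuad]
    generalize Real.log 2 = c at *
    nlinarith [mul_nonneg hy0.le (sub_nonneg.2 h)]
  · have h2 := oddSeries_tangent_le (x := 1156 / 625) (by norm_num) hy0.le
    have h3 : 1919 / 1000 + 7115 / 10000 * (y - 1156 / 625) ≤ a := by
      refine le_trans ?_ (h2.trans ha)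
      norm_num [oddSeries]
      linarith
    refine le_trans ?_ (gapQuad_mono h3 (by nlinarith))
    rw [gapQuad]
    generalize Real.log 2 = c at *
    have h4 : 0 ≤ (y - 1) * (1919 / 1000 + 7115 / 10000 * (y - 1156 / 625)) + 1 := by nlinarith
    nlinarith [mul_nonneg (sub_nonneg.2 h) (sub_nonneg.2 hy),
      mul_nonneg h4 (sub_nonneg.2 hc2.le)]

/-- For large `κ`, `invMills` is replaced by a rounded tangent of `oddSeries` at `y = 2.05²`, which
is steep enough to dominate the term linear in `y`. -/
lemma gapQuad_nonneg_of_ge {κ : ℝ} (hκ : 41 / 20 ≤ κ) :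
    0 ≤ gapQuad (invMills κ) (κ ^ 2) := by
  have hc1 := Real.log_two_gt_d9
  have hc2 := Real.log_two_lt_d9
  have hy : 1681 / 400 ≤ κ ^ 2 := by nlinarith
  have ha := oddSeries_le_invMills (by linarith : 0 < κ)
  generalize κ ^ 2 = y at *
  generalize invMills κ = a at *
  have h2 := oddSeries_tangent_le (x := 1681 / 400) (y := y) (by norm_num) (by linarith)
  have h3 : 478 / 100 + 192 / 100 * (y - 1681 / 400) ≤ a := by
    refine le_trans ?_ (h2.trans ha)
    norm_num [oddSeries]
    nlinarith
  refine le_trans ?_ (gapQuad_mono h3 (by nlinarith))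
  rw [gapQuad]
  generalize Real.log 2 = c at *
  have h4 : 0 ≤ (y - 1) * (478 / 100 + 192 / 100 * (y - 1681 / 400)) + 1 := by nlinarith
  nlinarith [mul_nonneg h4 (sub_nonneg.2 hc2.le), sq_nonneg (y - 1681 / 400)]

lemma invMills_le_chord {k l r u v : ℝ} (hl : 0 < l) (hlr : l < r) (hr : r ^ 2 ≤ 43 / 10)
    (hu : oddSeriesUpper (l ^ 2) ≤ u) (hv : oddSeriesUpper (r ^ 2) ≤ v)
    (hk : l ≤ k) (hk' : k ≤ r) :
    invMills k ≤ u + (v - u) / (r ^ 2 - l ^ 2) * (k ^ 2 - l ^ 2) := by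
  have h1 : l ^ 2 ≤ k ^ 2 := by nlinarith
  have h2 : k ^ 2 ≤ r ^ 2 := by nlinarith
  have h3 : l ^ 2 < r ^ 2 := by nlinarith
  refine (invMills_le (hl.trans_le hk) (h2.trans hr)).trans
    ((oddSeriesUpper_le_chord (sq_nonneg l) h3 h1 h2).trans ?_)
  have h4 : 0 < r ^ 2 - l ^ 2 := by linarith
  have e (u v : ℝ) : u + (v - u) / (r ^ 2 - l ^ 2) * (k ^ 2 - l ^ 2) =
      (u * (r ^ 2 - k ^ 2) + v * (k ^ 2 - l ^ 2)) / (r ^ 2 - l ^ 2) := by field_simp; ring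
  rw [e, e]
  gcongr

/-- On a middle interval the quadratic form is bounded above by any bound for its values along
the chord of the convex majorant of `invMills`. -/
lemma gapQuad_le_of_chord {k l r u v e : ℝ} (hl : 1 ≤ l) (hlr : l < r) (hr : r ^ 2 ≤ 43 / 10)
    (hu : oddSeriesUpper (l ^ 2) ≤ u) (hv : oddSeriesUpper (r ^ 2) ≤ v)
    (hk : l ≤ k) (hk' : k ≤ r) (h0 : 1 ≤ u) (huv : u ≤ v)
    (he : ∀ y, l ^ 2 ≤ y → y ≤ r ^ 2 →
      (u + (v - u) / (r ^ 2 - l ^ 2) * (y - l ^ 2)) ^ 2 - 13862 / 10000 *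
        ((y - 1) * (u + (v - u) / (r ^ 2 - l ^ 2) * (y - l ^ 2)) + 1) ≤ e)
    (hm : ∀ y, l ^ 2 ≤ y → y ≤ r ^ 2 → 7 / 5 * (y - 1) ≤ 2 * (1 + y / 3 + y ^ 2 / 15)) :
    gapQuad (invMills k) (k ^ 2) ≤ e := by
  have hc1 := Real.log_two_gt_d9
  have hc2 := Real.log_two_lt_d9
  have h1 : l ^ 2 ≤ k ^ 2 := by nlinarith
  have h2 : k ^ 2 ≤ r ^ 2 := by nlinarith
  have h3 : l ^ 2 < r ^ 2 := by nlinarith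
  have h4 : 1 ≤ k ^ 2 := by nlinarith
  have ha := invMills_le_chord (by linarith) hlr hr hu hv hk hk'
  have hb := invMills_ge (by linarith : 0 < k)
  have hmk := hm _ h1 h2
  have hek := he _ h1 h2
  have hL : 0 ≤ (v - u) / (r ^ 2 - l ^ 2) * (k ^ 2 - l ^ 2) :=
    mul_nonneg (div_nonneg (by linarith) (by linarith)) (by linarith)
  generalize (v - u) / (r ^ 2 - l ^ 2) * (k ^ 2 - l ^ 2) = L at *
  generalize k ^ 2 = y at *
  generalize invMills k = a at *
  refine (gapQuad_mono ha (by nlinarith)).trans ?_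
  rw [gapQuad]
  have h5 : 0 ≤ (y - 1) * (u + L) + 1 := by nlinarith
  nlinarith [mul_nonneg h5 (sub_nonneg.2 hc1.le)]

/-- The value at `1.36`: `-log p ≈ 0.191` against `log 2 / invMills² ≈ 0.188`. Since
`p = √(2/π) · κ e^{-κ²/2} · invMills`, only a logarithm near `log 4.34` is needed. -/
lemma levelTwoGap_base : 1 / 400 ≤ levelTwoGap (34 / 25) := by
  have hc1 := Real.log_two_gt_d9
  have hc2 := Real.log_two_lt_d9
  have hk : (0 : ℝ) < 34 / 25 := by norm_num
  have ha1 : 1919 / 1000 ≤ invMills (34 / 25) :=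
    le_trans (by norm_num [oddSeries]) (oddSeries_le_invMills hk)
  have ha2 : invMills (34 / 25) ≤ 19197 / 10000 :=
    (invMills_le hk (by norm_num)).trans (by norm_num [oddSeriesUpper, oddSeries])
  have hg : gaussInt (34 / 25) = invMills (34 / 25) * (34 / 25 * Real.exp (-(34 / 25) ^ 2 / 2)) := by
    rw [invMills]; field_simp
  have hpi := Real.pi_gt_d6
  have h1 : (√(2 / Real.pi) * (invMills (34 / 25) * (34 / 25))) ≤ √(4.3394) := by
    apply Real.le_sqrt_of_sq_le
    rw [mul_pow, Real.sq_sqrt (by positivity)]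
    have : 2 / Real.pi ≤ 2 / 3.141592 := by gcongr
    calc 2 / Real.pi * (invMills (34 / 25) * (34 / 25)) ^ 2
        ≤ 2 / 3.141592 * (19197 / 10000 * (34 / 25)) ^ 2 := by gcongr
      _ ≤ 4.3394 := by norm_num
  have h2 : Real.log (p (34 / 25)) ≤ Real.log 4.3394 / 2 - (34 / 25) ^ 2 / 2 := by
    rw [p_eq hk.le, hg, ← mul_assoc, ← mul_assoc, Real.log_mul _ (Real.exp_pos _).ne', Real.log_exp,
      ← Real.log_sqrt (by norm_num), mul_assoc]
    · have := Real.log_le_log (by have := invMills_pos hk; positivity) h1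
      linarith
    · have := invMills_pos hk
      positivity
  have h3 : Real.log 4.3394 ≤ 2 * Real.log 2 + 0.0816 := by
    have e : (4.3394 : ℝ) = 2 ^ 2 * 1.08485 := by norm_num
    rw [e, Real.log_mul (by norm_num) (by norm_num), Real.log_pow]
    have h4 : Real.log 1.08485 ≤ 0.0816 := by
      rw [Real.log_le_iff_le_exp (by norm_num)]
      refine le_trans ?_ (Real.quadratic_le_exp_of_nonneg (by norm_num))
      norm_num
    push_cast
    linarith
  have h4 : Real.log 2 / invMills (34 / 25) ^ 2 ≤ 0.6931471808 / (1919 / 1000) ^ 2 := by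
    gcongr
  have h5 : (0.6931471808 : ℝ) / (1919 / 1000) ^ 2 ≤ 0.18823 := by norm_num
  rw [levelTwoGap]
  norm_num at h2 h3 ⊢
  linarith

/-- From `1.36` to `2.05` the gap starts at `1/400` and loses at most `0.09 · 9/1000 + 0.05 · 1/100`.
It does not decrease on the two middle subintervals; the numbers `u`, `v` are rounded upper bounds
of `oddSeriesUpper` at the squared endpoints. -/
lemma levelTwoGap_pos_mid {κ : ℝ} (h1 : 34 / 25 ≤ κ) (h2 : κ ≤ 41 / 20) :
    0 < levelTwoGap κ := by
  have hb := levelTwoGap_base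
  have s1 : ∀ x : ℝ, 34 / 25 ≤ x → x ≤ 29 / 20 →
      levelTwoGap (34 / 25) - 9 / 1000 * (x - 34 / 25) ≤ levelTwoGap x := by
    intro x hx hx'
    refine levelTwoGap_ge (by norm_num) (r := 29 / 20) (fun z hz hz' => ?_) hx hx'
    have hq : gapQuad (invMills z) (z ^ 2) ≤ 5 / 100 :=
      gapQuad_le_of_chord (l := 34 / 25) (r := 29 / 20) (u := 19197 / 10000) (v := 21095 / 10000)
        (by norm_num) (by norm_num) (by norm_num) (by norm_num [oddSeriesUpper, oddSeries])
        (by norm_num [oddSeriesUpper, oddSeries]) hz hz' (by norm_num) (by norm_num)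
        (fun y hy hy' => by norm_num at hy hy' ⊢; nlinarith)
        (fun y hy hy' => by norm_num at hy hy' ⊢; nlinarith)
    have h5 := invMills_ge (by linarith : 0 < z)
    have h6 : (1156 / 625 : ℝ) ≤ z ^ 2 := by nlinarith
    have h7 : 184 / 100 ≤ invMills z := by nlinarith
    have h8 : (34 / 25 : ℝ) * (184 / 100) ^ 3 ≤ z * invMills z ^ 3 := by gcongr
    norm_num at h8
    linarith
  have s2 : ∀ x : ℝ, 29 / 20 ≤ x → x ≤ 173 / 100 →
      levelTwoGap (29 / 20) - 0 * (x - 29 / 20) ≤ levelTwoGap x := by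
    intro x hx hx'
    refine levelTwoGap_ge (by norm_num) (r := 173 / 100) (fun z hz hz' => ?_) hx hx'
    rw [zero_mul]
    exact gapQuad_le_of_chord (l := 29 / 20) (r := 173 / 100) (u := 21095 / 10000)
        (v := 2965 / 1000)
        (by norm_num) (by norm_num) (by norm_num) (by norm_num [oddSeriesUpper, oddSeries])
        (by norm_num [oddSeriesUpper, oddSeries]) hz hz' (by norm_num) (by norm_num)
        (fun y hy hy' => by norm_num at hy hy' ⊢; nlinarith)
        (fun y hy hy' => by norm_num at hy hy' ⊢; nlinarith)
  have s3 : ∀ x : ℝ, 173 / 100 ≤ x → x ≤ 2 →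
      levelTwoGap (173 / 100) - 0 * (x - 173 / 100) ≤ levelTwoGap x := by
    intro x hx hx'
    refine levelTwoGap_ge (by norm_num) (r := 2) (fun z hz hz' => ?_) hx hx'
    rw [zero_mul]
    exact gapQuad_le_of_chord (l := 173 / 100) (r := 2) (u := 2965 / 1000)
        (v := 44206 / 10000)
        (by norm_num) (by norm_num) (by norm_num) (by norm_num [oddSeriesUpper, oddSeries])
        (by norm_num [oddSeriesUpper, oddSeries]) hz hz' (by norm_num) (by norm_num)
        (fun y hy hy' => by norm_num at hy hy' ⊢; nlinarith)
        (fun y hy hy' => by norm_num at hy hy' ⊢; nlinarith)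
  have s4 : ∀ x : ℝ, 2 ≤ x → x ≤ 41 / 20 →
      levelTwoGap 2 - 1 / 100 * (x - 2) ≤ levelTwoGap x := by
    intro x hx hx'
    refine levelTwoGap_ge (by norm_num) (r := 41 / 20) (fun z hz hz' => ?_) hx hx'
    have hq : gapQuad (invMills z) (z ^ 2) ≤ 4 / 10 :=
      gapQuad_le_of_chord (l := 2) (r := 41 / 20) (u := 44206 / 10000) (v := 4799 / 1000)
        (by norm_num) (by norm_num) (by norm_num) (by norm_num [oddSeriesUpper, oddSeries])
        (by norm_num [oddSeriesUpper, oddSeries]) hz hz' (by norm_num) (by norm_num)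
        (fun y hy hy' => by norm_num at hy hy' ⊢; nlinarith)
        (fun y hy hy' => by norm_num at hy hy' ⊢; nlinarith)
    have h5 := invMills_ge (by linarith : 0 < z)
    have h6 : (4 : ℝ) ≤ z ^ 2 := by nlinarith
    have h7 : 3 ≤ invMills z := by nlinarith
    have h8 : (2 : ℝ) * 3 ^ 3 ≤ z * invMills z ^ 3 := by gcongr
    norm_num at h8
    linarith
  have t1 := s1 (29 / 20) (by norm_num) (by norm_num)
  have t2 := s2 (173 / 100) (by norm_num) (by norm_num)
  have t3 := s3 2 (by norm_num) (by norm_num)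
  rcases le_total κ (29 / 20) with h | h
  · have := s1 κ h1 h; linarith
  rcases le_total κ (173 / 100) with h' | h'
  · have := s2 κ h h'; linarith
  rcases le_total κ 2 with h'' | h''
  · have := s3 κ h' h''; linarith
  · have := s4 κ h'' h2; linarith

lemma tendsto_levelTwoGap : Tendsto levelTwoGap atTop (𝓝 0) := by
  have h1 : Tendsto (fun κ => -Real.log (p κ)) atTop (𝓝 0) := by
    simpa using ((Real.continuousAt_log one_ne_zero).tendsto.comp tendsto_p_atTop).neg
  have h2 : Tendsto (fun κ => Real.log 2 / invMills κ ^ 2) atTop (𝓝 0) := by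
    apply Tendsto.div_atTop tendsto_const_nhds
    refine tendsto_atTop_mono' (f₁ := id) _ ?_ tendsto_id
    filter_upwards [eventually_ge_atTop 3] with x hx
    have h3 := invMills_ge (by linarith : 0 < x)
    have h4 : x ≤ invMills x := by nlinarith [sq_nonneg (x ^ 2)]
    simp only [id]
    nlinarith
  have h3 := h1.sub h2
  rwa [sub_zero] at h3

/-- The relative level-two weight of `[-κ, κ]` is small enough that `F_α''(1/2) < 0` holds up to
the first-moment threshold. The gap decreases up to `κ = 1.36` and from `κ = 2.05` on, where it tends
to zero, so only the value at `1.36` and the interval in between need explicit bounds. -/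
theorem levelTwoGap_nonneg {κ : ℝ} (hκ : 0 < κ) : 0 ≤ levelTwoGap κ := by
  rcases le_total κ (34 / 25) with h | h
  · have := levelTwoGap_antitone hκ
      (fun x hx hx' => gapQuad_nonneg_of_le (hκ.trans_le hx) hx') h
    have := levelTwoGap_base
    linarith
  rcases le_total κ (41 / 20) with h' | h'
  · exact (levelTwoGap_pos_mid h h').le
  · refine le_of_tendsto tendsto_levelTwoGap ?_
    filter_upwards [eventually_ge_atTop κ] with x hx
    exact levelTwoGap_antitone hκ (fun z hz _ => gapQuad_nonneg_of_ge (h'.trans hz)) hx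

/-! ### Gaussian pair probabilities and Plackett's identity -/

/-- The probability that both coordinates of a centred Gaussian pair with unit variances and
covariance `ρ` lie in `[-κ, κ]`, for `|ρ| < 1`, as the integral over the first coordinate of the
conditional probability. -/
noncomputable def pairProb (κ ρ : ℝ) : ℝ :=
  Real.pi⁻¹ * ∫ z in (-κ)..κ, Real.exp (-z ^ 2 / 2) * gaussInt ((κ - ρ * z) / √(1 - ρ ^ 2))

/-- The derivative of `pairProb κ` in the correlation (Plackett's identity). -/
noncomputable def pairDensity (κ ρ : ℝ) : ℝ :=
  (Real.pi * √(1 - ρ ^ 2))⁻¹ * (Real.exp (-κ ^ 2 / (1 + ρ)) - Real.exp (-κ ^ 2 / (1 - ρ)))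

lemma continuous_gaussInt : Continuous gaussInt :=
  continuous_iff_continuousAt.2 fun κ => (hasDerivAt_gaussInt κ).continuousAt

lemma one_sub_sq_pos {ρ : ℝ} (h : |ρ| < 1) : 0 < 1 - ρ ^ 2 := by
  have := (sq_lt_one_iff_abs_lt_one ρ).2 h
  linarith

lemma hasDerivAt_condBound (κ z : ℝ) {ρ : ℝ} (h : |ρ| < 1) :
    HasDerivAt (fun ρ => (κ - ρ * z) / √(1 - ρ ^ 2)) ((ρ * κ - z) / √(1 - ρ ^ 2) ^ 3) ρ := by
  have h0 := one_sub_sq_pos h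
  have hs : 0 < √(1 - ρ ^ 2) := Real.sqrt_pos.2 h0
  have h1 : HasDerivAt (fun ρ : ℝ => 1 - ρ ^ 2) (-(2 * ρ)) ρ :=
    ((hasDerivAt_pow 2 ρ).const_sub 1).congr_deriv (by simp)
  have h2 := (((hasDerivAt_id ρ).mul_const z).const_sub κ).div (h1.sqrt h0.ne') hs.ne'
  refine h2.congr_deriv ?_
  have h3 : √(1 - ρ ^ 2) ^ 2 = 1 - ρ ^ 2 := Real.sq_sqrt h0.le
  simp only [id]
  field_simp
  rw [h3]
  ring

/-- The correlation derivative of the integrand of `pairProb` is an exact derivative in the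
integration variable: up to constants, it is the `z`-derivative of the joint density at `(z, κ)`. -/
lemma hasDerivAt_pairExponent (κ ρ : ℝ) (hρ : |ρ| < 1) (z : ℝ) :
    HasDerivAt (fun z => (√(1 - ρ ^ 2))⁻¹ *
      Real.exp (-(z ^ 2 - 2 * ρ * κ * z + κ ^ 2) / (2 * (1 - ρ ^ 2))))
      (Real.exp (-z ^ 2 / 2) * (Real.exp (-((κ - ρ * z) / √(1 - ρ ^ 2)) ^ 2 / 2) *
        ((ρ * κ - z) / √(1 - ρ ^ 2) ^ 3))) z := by
  have h0 := one_sub_sq_pos hρ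
  have hs : 0 < √(1 - ρ ^ 2) := Real.sqrt_pos.2 h0
  have h3 : √(1 - ρ ^ 2) ^ 2 = 1 - ρ ^ 2 := Real.sq_sqrt h0.le
  have h1 : HasDerivAt (fun z : ℝ => -(z ^ 2 - 2 * ρ * κ * z + κ ^ 2) / (2 * (1 - ρ ^ 2)))
      ((ρ * κ - z) / (1 - ρ ^ 2)) z := by
    have := ((((hasDerivAt_pow 2 z).sub ((hasDerivAt_id z).const_mul (2 * ρ * κ))).add_const
      (κ ^ 2)).neg).div_const (2 * (1 - ρ ^ 2))
    refine this.congr_deriv ?_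
    field_simp
    push_cast
    ring
  refine (h1.exp.const_mul _).congr_deriv ?_
  rw [← mul_assoc (Real.exp (-z ^ 2 / 2)), ← Real.exp_add]
  have e : -z ^ 2 / 2 + -((κ - ρ * z) / √(1 - ρ ^ 2)) ^ 2 / 2 =
      -(z ^ 2 - 2 * ρ * κ * z + κ ^ 2) / (2 * (1 - ρ ^ 2)) := by
    rw [div_pow, h3]
    field_simp
    ring
  rw [e, pow_succ √(1 - ρ ^ 2), h3]
  field_simp

/-- Plackett's identity for the symmetric square: differentiate under the integral sign and integrate
the resulting exact derivative over `[-κ, κ]`. -/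
theorem hasDerivAt_pairProb {κ : ℝ} (hκ : 0 < κ) {ρ : ℝ} (hρ : |ρ| < 1) :
    HasDerivAt (pairProb κ) (pairDensity κ ρ) ρ := by
  -- a ball of radius `r < 1` around `0` keeps the conditional variance away from zero
  obtain ⟨r, hr1, hr2⟩ := exists_between hρ
  have hr0 : 0 ≤ r := (abs_nonneg ρ).trans hr1.le
  have hd : 0 < 1 - r ^ 2 := one_sub_sq_pos (by rwa [abs_of_nonneg hr0])
  have hball : ∀ x ∈ Metric.ball (0 : ℝ) r, |x| < r := fun x hx => by
    simpa using hx
  have hcont (x : ℝ) : Continuous fun z : ℝ =>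
      Real.exp (-z ^ 2 / 2) * gaussInt ((κ - x * z) / √(1 - x ^ 2)) := by
    have := continuous_gaussInt
    fun_prop
  have hcont' : Continuous fun z : ℝ => Real.exp (-z ^ 2 / 2) *
      (Real.exp (-((κ - ρ * z) / √(1 - ρ ^ 2)) ^ 2 / 2) * ((ρ * κ - z) / √(1 - ρ ^ 2) ^ 3)) := by
    fun_prop
  have key := intervalIntegral.hasDerivAt_integral_of_dominated_loc_of_deriv_le
    (μ := volume) (a := -κ) (b := κ) (x₀ := ρ) (s := Metric.ball 0 r)
    (F := fun x z => Real.exp (-z ^ 2 / 2) * gaussInt ((κ - x * z) / √(1 - x ^ 2)))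
    (F' := fun x z => Real.exp (-z ^ 2 / 2) *
      (Real.exp (-((κ - x * z) / √(1 - x ^ 2)) ^ 2 / 2) * ((x * κ - z) / √(1 - x ^ 2) ^ 3)))
    (bound := fun _ => 2 * κ / √(1 - r ^ 2) ^ 3)
    (Metric.isOpen_ball.mem_nhds (by simpa using hr1))
    (Eventually.of_forall fun x => (hcont x).aestronglyMeasurable)
    ((hcont ρ).intervalIntegrable _ _) hcont'.aestronglyMeasurable
    (Eventually.of_forall fun z hz x hx => ?_) (intervalIntegrable_const)
    (Eventually.of_forall fun z hz x hx => ?_)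
  · have h1 : ∫ z in (-κ)..κ, Real.exp (-z ^ 2 / 2) *
        (Real.exp (-((κ - ρ * z) / √(1 - ρ ^ 2)) ^ 2 / 2) * ((ρ * κ - z) / √(1 - ρ ^ 2) ^ 3)) =
        (√(1 - ρ ^ 2))⁻¹ * (Real.exp (-κ ^ 2 / (1 + ρ)) - Real.exp (-κ ^ 2 / (1 - ρ))) := by
      rw [intervalIntegral.integral_eq_sub_of_hasDerivAt
        (fun z _ => hasDerivAt_pairExponent κ ρ hρ z) (hcont'.intervalIntegrable _ _)]
      have h2 : 0 < 1 + ρ := by linarith [(abs_lt.1 hρ).1]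
      have h3 : 0 < 1 - ρ := by linarith [(abs_lt.1 hρ).2]
      have h4 : 1 - ρ ^ 2 = (1 + ρ) * (1 - ρ) := by ring
      have e1 : -(κ ^ 2 - 2 * ρ * κ * κ + κ ^ 2) / (2 * (1 - ρ ^ 2)) = -κ ^ 2 / (1 + ρ) := by
        rw [h4]; field_simp; ring
      have e2 : -((-κ) ^ 2 - 2 * ρ * κ * (-κ) + κ ^ 2) / (2 * (1 - ρ ^ 2)) =
          -κ ^ 2 / (1 - ρ) := by
        rw [h4]; field_simp; ring
      rw [e1, e2, mul_sub]
    have h5 := key.2.const_mul Real.pi⁻¹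
    rw [h1] at h5
    refine h5.congr_deriv ?_
    rw [pairDensity, mul_inv]
    ring
  · have hx := hball x hx
    have hz' : |z| ≤ κ := by
      rw [Set.uIoc_of_le (by linarith)] at hz
      exact abs_le.2 ⟨hz.1.le, hz.2⟩
    have hx2 : x ^ 2 ≤ r ^ 2 := sq_le_sq.2 (by rw [abs_of_nonneg hr0]; exact hx.le)
    have h1 : √(1 - r ^ 2) ≤ √(1 - x ^ 2) := Real.sqrt_le_sqrt (by linarith)
    have h2 : 0 < √(1 - r ^ 2) := Real.sqrt_pos.2 hd
    have h3 : |x * κ - z| ≤ 2 * κ := by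
      have : |x * κ| ≤ κ := by
        rw [abs_mul, abs_of_pos hκ]
        nlinarith
      linarith [abs_sub (x * κ) z]
    rw [norm_mul, norm_mul, Real.norm_eq_abs, Real.norm_eq_abs, Real.norm_eq_abs, Real.abs_exp,
      Real.abs_exp, abs_div, abs_of_pos (pow_pos (h2.trans_le h1) 3)]
    have h4 : Real.exp (-z ^ 2 / 2) ≤ 1 := Real.exp_le_one_iff.2 (by nlinarith [sq_nonneg z])
    have h5 : Real.exp (-((κ - x * z) / √(1 - x ^ 2)) ^ 2 / 2) ≤ 1 :=
      Real.exp_le_one_iff.2 (by nlinarith [sq_nonneg ((κ - x * z) / √(1 - x ^ 2))])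
    calc _ ≤ 1 * (1 * (2 * κ / √(1 - r ^ 2) ^ 3)) := by gcongr
      _ = _ := by ring
  · have hx := hball x hx
    exact ((hasDerivAt_gaussInt _).comp x (hasDerivAt_condBound κ z (hx.trans hr2))).const_mul _

lemma pairProb_neg (κ ρ : ℝ) : pairProb κ (-ρ) = pairProb κ ρ := by
  have h := intervalIntegral.integral_comp_neg (a := -κ) (b := κ)
    (fun z => Real.exp (-z ^ 2 / 2) * gaussInt ((κ - ρ * z) / √(1 - ρ ^ 2)))
  simp only [neg_sq, neg_neg] at h
  rw [pairProb, pairProb, ← h]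
  simp

lemma pairProb_zero {κ : ℝ} (hκ : 0 ≤ κ) : pairProb κ 0 = p κ ^ 2 := by
  rw [pairProb, p_eq hκ, mul_pow, Real.sq_sqrt (by positivity)]
  simp only [zero_mul, sub_zero, ne_eq, OfNat.ofNat_ne_zero, not_false_eq_true, zero_pow,
    Real.sqrt_one, div_one]
  rw [intervalIntegral.integral_mul_const, integral_exp_neg_sq_symm]
  ring

lemma pairDensity_nonneg {κ ρ : ℝ} (hρ0 : 0 ≤ ρ) (hρ : ρ < 1) :
    0 ≤ pairDensity κ ρ := by
  have h : Real.exp (-κ ^ 2 / (1 - ρ)) ≤ Real.exp (-κ ^ 2 / (1 + ρ)) := by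
    rw [neg_div, neg_div]
    have : κ ^ 2 / (1 + ρ) ≤ κ ^ 2 / (1 - ρ) := by
      apply div_le_div_of_nonneg_left (sq_nonneg κ) <;> linarith
    exact Real.exp_le_exp.2 (by linarith)
  rw [pairDensity]
  have := sub_nonneg.2 h
  have := Real.pi_pos
  positivity

lemma pairDensity_le {κ ρ : ℝ} (hρ0 : 0 ≤ ρ) (hρ : ρ ≤ 1 / 2) :
    pairDensity κ ρ ≤ 4 * κ ^ 2 * ρ := by
  have h1 : Real.exp (-κ ^ 2 / (1 + ρ)) - Real.exp (-κ ^ 2 / (1 - ρ)) ≤ 4 * κ ^ 2 * ρ := by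
    have h2 : Real.exp (-κ ^ 2 / (1 + ρ)) ≤ 1 :=
      Real.exp_le_one_iff.2 (div_nonpos_of_nonpos_of_nonneg (by nlinarith [sq_nonneg κ])
        (by linarith))
    have h3 : Real.exp (-κ ^ 2 / (1 - ρ)) = Real.exp (-κ ^ 2 / (1 + ρ)) *
        Real.exp (-(2 * κ ^ 2 * ρ / (1 - ρ ^ 2))) := by
      have h4 : 1 - ρ ^ 2 = (1 + ρ) * (1 - ρ) := by ring
      have h5 : 1 - ρ ≠ 0 := by linarith
      have h6 : 1 + ρ ≠ 0 := by linarith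
      rw [← Real.exp_add, h4]
      congr 1
      field_simp
      ring
    have h4 := Real.add_one_le_exp (-(2 * κ ^ 2 * ρ / (1 - ρ ^ 2)))
    have h5 : 2 * κ ^ 2 * ρ / (1 - ρ ^ 2) ≤ 4 * κ ^ 2 * ρ := by
      rw [div_le_iff₀ (by nlinarith)]
      have : 0 ≤ κ ^ 2 * ρ := by positivity
      nlinarith [mul_nonneg this (by nlinarith : 0 ≤ 1 - 2 * ρ ^ 2)]
    have h6 : 0 ≤ 2 * κ ^ 2 * ρ / (1 - ρ ^ 2) := div_nonneg (by positivity) (by nlinarith)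
    rw [h3]
    nlinarith [Real.exp_pos (-κ ^ 2 / (1 + ρ))]
  have h2 : 1 ≤ Real.pi * √(1 - ρ ^ 2) := by
    have h3 : 1 / 2 ≤ √(1 - ρ ^ 2) := Real.le_sqrt_of_sq_le (by nlinarith)
    nlinarith [Real.pi_gt_three]
  have h3 : 0 ≤ 4 * κ ^ 2 * ρ := by positivity
  rw [pairDensity]
  calc _ ≤ (Real.pi * √(1 - ρ ^ 2))⁻¹ * (4 * κ ^ 2 * ρ) := by gcongr
    _ ≤ 1 * (4 * κ ^ 2 * ρ) := by
        gcongr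
        exact inv_le_one_of_one_le₀ h2
    _ = _ := one_mul _

lemma sq_p_le_pairProb {κ ρ : ℝ} (hκ : 0 < κ) (hρ : |ρ| < 1) : p κ ^ 2 ≤ pairProb κ ρ := by
  wlog h0 : 0 ≤ ρ generalizing ρ
  · rw [← pairProb_neg]
    exact this (by rwa [abs_neg]) (by linarith)
  rw [abs_of_nonneg h0] at hρ
  rw [← pairProb_zero hκ.le]
  have habs : ∀ x ∈ Set.Icc 0 ρ, |x| < 1 := fun x hx => by
    rw [abs_of_nonneg hx.1]; exact hx.2.trans_lt hρ
  exact monotoneOn_of_hasDerivWithinAt_nonneg (convex_Icc 0 ρ)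
    (fun x hx => (hasDerivAt_pairProb hκ (habs x hx)).continuousAt.continuousWithinAt)
    (fun x hx => (hasDerivAt_pairProb hκ (habs x (interior_subset hx))).hasDerivWithinAt)
    (fun x hx => pairDensity_nonneg (interior_subset hx).1 ((interior_subset hx).2.trans_lt hρ))
    ⟨le_refl 0, h0⟩ ⟨h0, le_refl ρ⟩ h0

lemma pairProb_le_of_small {κ ρ : ℝ} (hκ : 0 < κ) (hρ : |ρ| ≤ 1 / 2) :
    pairProb κ ρ ≤ p κ ^ 2 + 2 * κ ^ 2 * ρ ^ 2 := by
  wlog h0 : 0 ≤ ρ generalizing ρ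
  · rw [← pairProb_neg, ← neg_sq ρ]
    exact this (by rwa [abs_neg]) (by linarith)
  rw [abs_of_nonneg h0] at hρ
  rw [← pairProb_zero hκ.le]
  have habs : ∀ x ∈ Set.Icc 0 ρ, |x| < 1 := fun x hx => by
    rw [abs_of_nonneg hx.1]; linarith [hx.2]
  have hd : ∀ x ∈ Set.Icc 0 ρ, HasDerivAt (fun x => 2 * κ ^ 2 * x ^ 2 - pairProb κ x)
      (4 * κ ^ 2 * x - pairDensity κ x) x := fun x hx =>
    (((hasDerivAt_pow 2 x).const_mul (2 * κ ^ 2)).sub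
      (hasDerivAt_pairProb hκ (habs x hx))).congr_deriv (by push_cast; ring)
  have := monotoneOn_of_hasDerivWithinAt_nonneg (convex_Icc 0 ρ)
    (fun x hx => (hd x hx).continuousAt.continuousWithinAt)
    (fun x hx => (hd x (interior_subset hx)).hasDerivWithinAt)
    (fun x hx => sub_nonneg.2 (pairDensity_le (interior_subset hx).1
      ((interior_subset hx).2.trans hρ)))
    ⟨le_refl 0, h0⟩ ⟨h0, le_refl ρ⟩ h0
  simp only at this
  linarith

/-- The second derivative of the pair probability at correlation zero, in terms of `invMills`. -/
lemma hasDerivAt_pairDensity_zero {κ : ℝ} (hκ : 0 < κ) :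
    HasDerivAt (pairDensity κ) (p κ ^ 2 / invMills κ ^ 2) 0 := by
  have h1 : HasDerivAt (fun ρ : ℝ => 1 - ρ ^ 2) 0 0 :=
    ((hasDerivAt_pow 2 (0 : ℝ)).const_sub 1).congr_deriv (by simp)
  have h2 := ((h1.sqrt (by norm_num)).const_mul Real.pi).inv (by simp [Real.pi_ne_zero])
  have h3 : HasDerivAt (fun ρ : ℝ => -κ ^ 2 / (1 + ρ)) (κ ^ 2) 0 :=
    ((hasDerivAt_const (0 : ℝ) (-κ ^ 2)).div ((hasDerivAt_id (0 : ℝ)).const_add 1)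
      (by simp)).congr_deriv (by simp)
  have h4 : HasDerivAt (fun ρ : ℝ => -κ ^ 2 / (1 - ρ)) (-κ ^ 2) 0 :=
    ((hasDerivAt_const (0 : ℝ) (-κ ^ 2)).div ((hasDerivAt_id (0 : ℝ)).const_sub 1)
      (by simp)).congr_deriv (by simp)
  have h5 := h2.mul (h3.exp.sub h4.exp)
  refine h5.congr_deriv ?_
  have hg := gaussInt_pos hκ
  have e : Real.exp (-κ ^ 2) = Real.exp (-κ ^ 2 / 2) ^ 2 := by
    rw [← Real.exp_nat_mul]; congr 1; push_cast; ring
  have hp : p κ ^ 2 = 2 / Real.pi * gaussInt κ ^ 2 := by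
    rw [p_eq hκ.le, mul_pow, Real.sq_sqrt (by positivity)]
  rw [hp, invMills]
  have := Real.exp_pos (-κ ^ 2 / 2)
  have := Real.pi_pos
  simp only [add_zero, sub_zero, ne_eq, OfNat.ofNat_ne_zero, not_false_eq_true, zero_pow,
    Real.sqrt_one, div_one, mul_one, sub_self, mul_zero, Pi.sub_apply, Pi.inv_apply, zero_add, e]
  field_simp
  ring

/-! ### Standard Gaussian vectors and the function `q` -/

lemma measurableSet_and {α : Type*} [MeasurableSpace α] {r s : α → Prop}
    (hr : MeasurableSet {a | r a}) (hs : MeasurableSet {a | s a}) :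
    MeasurableSet {a | r a ∧ s a} := hr.inter hs

section StdGaussian

variable {E : Type*} [NormedAddCommGroup E] [InnerProductSpace ℝ E] [FiniteDimensional ℝ E]
  [MeasurableSpace E] [BorelSpace E]

lemma integral_exp_inner_stdGaussian (w : E) :
    ∫ x, Complex.exp (⟪w, x⟫ * Complex.I) ∂(stdGaussian E) = Complex.exp (-‖w‖ ^ 2 / 2) := by
  rw [← charFun_stdGaussian, charFun_apply]
  simp_rw [real_inner_comm]

lemma integral_cos_inner_stdGaussian (w : E) :
    ∫ x, Real.cos ⟪w, x⟫ ∂(stdGaussian E) = Real.exp (-‖w‖ ^ 2 / 2) := by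
  have h := congrArg Complex.re (integral_exp_inner_stdGaussian w)
  have hi : Integrable (fun x => Complex.exp (⟪w, x⟫ * Complex.I)) (stdGaussian E) :=
    Integrable.of_bound (by fun_prop) 1 (by simp [Complex.norm_exp_ofReal_mul_I])
  have h2 := integral_re (𝕜 := ℂ) hi
  simp only [RCLike.re_to_complex, Complex.exp_ofReal_mul_I_re] at h2
  rw [h2, h]
  have e : (-(‖w‖ : ℂ) ^ 2 / 2) = ((-‖w‖ ^ 2 / 2 : ℝ) : ℂ) := by push_cast; ring
  rw [e, Complex.exp_ofReal_re]

lemma map_inner_stdGaussian {u : E} (hu : ‖u‖ = 1) :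
    (stdGaussian E).map (fun x => ⟪u, x⟫) = gaussianReal 0 1 := by
  have : IsProbabilityMeasure ((stdGaussian E).map (fun x => ⟪u, x⟫)) :=
    Measure.isProbabilityMeasure_map (by fun_prop)
  refine Measure.ext_of_charFun (funext fun t => ?_)
  rw [charFun_gaussianReal, charFun_apply_real, integral_map (by fun_prop) (by fun_prop)]
  have h := integral_exp_inner_stdGaussian (t • u)
  simp only [inner_smul_left, norm_smul, hu, RCLike.conj_to_real] at h
  push_cast at h
  rw [h]
  congr 1
  rw [mul_one, ← Complex.ofReal_pow, Real.norm_eq_abs, sq_abs]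
  push_cast
  ring

lemma stdGaussian_slab {u : E} (hu : ‖u‖ = 1) (κ : ℝ) :
    (stdGaussian E).real {x | |⟪u, x⟫| ≤ κ} = p κ := by
  rw [p, ← map_inner_stdGaussian hu, map_measureReal_apply (by fun_prop)
    (measurableSet_le (by fun_prop) (by fun_prop))]
  rfl

lemma map_pair_stdGaussian {u v : E} (hu : ‖u‖ = 1) (hv : ‖v‖ = 1) :
    (stdGaussian E).map (fun x => (!₂[⟪u, x⟫, ⟪v, x⟫] : EuclideanSpace ℝ (Fin 2))) =
      multivariateGaussian 0 !![1, ⟪u, v⟫; ⟪u, v⟫, 1] := by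
  have hm : Measurable (fun x => (!₂[⟪u, x⟫, ⟪v, x⟫] : EuclideanSpace ℝ (Fin 2))) := by
    fun_prop
  have : IsProbabilityMeasure
      ((stdGaussian E).map (fun x => (!₂[⟪u, x⟫, ⟪v, x⟫] : EuclideanSpace ℝ (Fin 2)))) :=
    Measure.isProbabilityMeasure_map hm.aemeasurable
  have hS : (!![1, ⟪u, v⟫; ⟪u, v⟫, 1] : Matrix (Fin 2) (Fin 2) ℝ).PosSemidef := by
    have h := Matrix.posSemidef_gram ℝ ![u, v]
    have e : (!![1, ⟪u, v⟫; ⟪u, v⟫, 1] : Matrix (Fin 2) (Fin 2) ℝ) = Matrix.gram ℝ ![u, v] := by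
      ext i j
      fin_cases i <;> fin_cases j <;>
        simp [Matrix.gram_apply, hu, hv, real_inner_comm]
    rwa [e]
  refine Measure.ext_of_charFun (funext fun t => ?_)
  rw [charFun_multivariateGaussian hS, charFun_apply, integral_map hm.aemeasurable (by fun_prop)]
  have h := integral_exp_inner_stdGaussian (t 0 • u + t 1 • v)
  have e1 : ∀ x : E, ⟪(!₂[⟪u, x⟫, ⟪v, x⟫] : EuclideanSpace ℝ (Fin 2)), t⟫ =
      ⟪t 0 • u + t 1 • v, x⟫ := fun x => by
    simp [PiLp.inner_apply, Fin.sum_univ_two, inner_add_left, inner_smul_left]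
  simp_rw [e1]
  rw [h]
  congr 1
  have e2 : ‖t 0 • u + t 1 • v‖ ^ 2 = t 0 ^ 2 + 2 * (t 0 * t 1 * ⟪u, v⟫) + t 1 ^ 2 := by
    rw [norm_add_sq_real, norm_smul, norm_smul, hu, hv, inner_smul_left, inner_smul_right]
    simp
    ring
  rw [← Complex.ofReal_pow, e2]
  simp [Matrix.mulVec, dotProduct, Fin.sum_univ_two]
  ring

lemma q_eq_stdGaussian {u v : E} (hu : ‖u‖ = 1) (hv : ‖v‖ = 1) (κ : ℝ) {β : ℝ}
    (h : ⟪u, v⟫ = 2 * β - 1) :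
    q κ β = (stdGaussian E).real {x | |⟪u, x⟫| ≤ κ ∧ |⟪v, x⟫| ≤ κ} := by
  rw [q, ← h, ← map_pair_stdGaussian hu hv, map_measureReal_apply (by fun_prop)]
  · congr 1
  · exact measurableSet_and (measurableSet_le (by fun_prop) (by fun_prop))
      (measurableSet_le (by fun_prop) (by fun_prop))

end StdGaussian

lemma exists_unit_pair {ρ : ℝ} (hρ : |ρ| ≤ 1) :
    ‖(!₂[1, 0] : EuclideanSpace ℝ (Fin 2))‖ = 1 ∧
    ‖(!₂[ρ, √(1 - ρ ^ 2)] : EuclideanSpace ℝ (Fin 2))‖ = 1 ∧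
    ⟪(!₂[1, 0] : EuclideanSpace ℝ (Fin 2)), !₂[ρ, √(1 - ρ ^ 2)]⟫ = ρ := by
  have h0 : 0 ≤ 1 - ρ ^ 2 := by
    have := (sq_le_one_iff_abs_le_one ρ).2 hρ
    linarith
  refine ⟨?_, ?_, ?_⟩
  · simp [EuclideanSpace.norm_eq, Fin.sum_univ_two]
  · simp [EuclideanSpace.norm_eq, Fin.sum_univ_two, Real.sq_sqrt h0]
  · simp [PiLp.inner_apply, Fin.sum_univ_two]

lemma abs_two_mul_sub_one_le {β : ℝ} (h : β ∈ Set.Icc (0 : ℝ) 1) : |2 * β - 1| ≤ 1 :=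
  abs_le.2 ⟨by linarith [h.1], by linarith [h.2]⟩

lemma q_le_p {κ β : ℝ} (h : β ∈ Set.Icc (0 : ℝ) 1) : q κ β ≤ p κ := by
  obtain ⟨hu, hv, huv⟩ := exists_unit_pair (abs_two_mul_sub_one_le h)
  rw [q_eq_stdGaussian hu hv κ huv, ← stdGaussian_slab hu κ]
  exact measureReal_mono fun x hx => hx.1

lemma q_one_sub {κ β : ℝ} (h : β ∈ Set.Icc (0 : ℝ) 1) : q κ (1 - β) = q κ β := by
  obtain ⟨hu, hv, huv⟩ := exists_unit_pair (abs_two_mul_sub_one_le h)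
  rw [q_eq_stdGaussian hu hv κ huv, q_eq_stdGaussian hu (v := -!₂[2 * β - 1, √(1 - (2 * β - 1) ^ 2)])
    (by rw [norm_neg, hv]) κ (by rw [inner_neg_right, huv]; ring)]
  simp only [inner_neg_left, abs_neg]

lemma q_one (κ : ℝ) : q κ 1 = p κ := by
  obtain ⟨hu, hv, huv⟩ := exists_unit_pair (ρ := 1) (by simp)
  rw [q_eq_stdGaussian hu hu κ (by rw [real_inner_self_eq_norm_sq, hu]; norm_num),
    ← stdGaussian_slab hu κ]
  simp only [and_self]

lemma q_zero (κ : ℝ) : q κ 0 = p κ := by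
  rw [← q_one_sub (by simp), sub_zero, q_one]

lemma stdGaussian_two_eq_prod (S : Set (ℝ × ℝ)) (hS : MeasurableSet S) :
    (stdGaussian (EuclideanSpace ℝ (Fin 2))).real {x | (x 0, x 1) ∈ S} =
      ((gaussianReal 0 1).prod (gaussianReal 0 1)).real S := by
  have h := (measurePreserving_finTwoArrow (gaussianReal 0 1)).map_eq
  have hS' : MeasurableSet {x : EuclideanSpace ℝ (Fin 2) | (x 0, x 1) ∈ S} :=
    hS.preimage (f := fun x : EuclideanSpace ℝ (Fin 2) => (x 0, x 1)) (by fun_prop)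
  rw [← map_pi_eq_stdGaussian, map_measureReal_apply (by fun_prop) hS', ← h,
    map_measureReal_apply (by fun_prop) hS]
  rfl

/-- The conditional probability, given the first coordinate, that the second coordinate of a
correlated pair lies in `[-κ, κ]`. -/
lemma gaussianReal_slab_affine (κ z : ℝ) (hκ : 0 ≤ κ) {ρ s : ℝ} (hs : 0 < s) :
    (gaussianReal 0 1).real {w | |ρ * z + s * w| ≤ κ} =
      (√(2 * Real.pi))⁻¹ * (gaussInt ((κ - ρ * z) / s) + gaussInt ((κ + ρ * z) / s)) := by
  have h1 : {w : ℝ | |ρ * z + s * w| ≤ κ} = Set.Icc ((-κ - ρ * z) / s) ((κ - ρ * z) / s) := by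
    ext w
    simp only [Set.mem_ofPred_eq, abs_le, Set.mem_Icc, div_le_iff₀ hs, le_div_iff₀ hs]
    constructor <;> rintro ⟨h1, h2⟩ <;> constructor <;> linarith
  have hc : Continuous fun t : ℝ => Real.exp (-t ^ 2 / 2) := by fun_prop
  rw [h1, gaussianReal_real_Icc (by gcongr; linarith),
    ← intervalIntegral.integral_interval_sub_left (hc.intervalIntegrable 0 _)
      (hc.intervalIntegrable 0 _)]
  have h2 : (-κ - ρ * z) / s = -((κ + ρ * z) / s) := by ring
  have h3 := gaussInt_neg ((κ + ρ * z) / s)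
  rw [h2]
  rw [gaussInt] at h3
  rw [h3]
  change (√(2 * Real.pi))⁻¹ * (gaussInt _ - _) = _
  ring

theorem q_eq_pairProb {κ β : ℝ} (hκ : 0 < κ) (h : β ∈ Set.Ioo (0 : ℝ) 1) :
    q κ β = pairProb κ (2 * β - 1) := by
  have hρ : |2 * β - 1| < 1 := abs_lt.2 ⟨by linarith [h.1], by linarith [h.2]⟩
  obtain ⟨hu, hv, huv⟩ := exists_unit_pair hρ.le
  rw [q_eq_stdGaussian hu hv κ huv]
  have hs : 0 < √(1 - (2 * β - 1) ^ 2) := Real.sqrt_pos.2 (one_sub_sq_pos hρ)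
  rw [pairProb]
  generalize 2 * β - 1 = ρ at *
  generalize √(1 - ρ ^ 2) = s at *
  have hmS : MeasurableSet {zw : ℝ × ℝ | |zw.1| ≤ κ ∧ |ρ * zw.1 + s * zw.2| ≤ κ} :=
    measurableSet_and (measurableSet_le (by fun_prop) (by fun_prop))
      (measurableSet_le (by fun_prop) (by fun_prop))
  have e1 : {x : EuclideanSpace ℝ (Fin 2) | |⟪(!₂[1, 0] : EuclideanSpace ℝ (Fin 2)), x⟫| ≤ κ ∧
      |⟪(!₂[ρ, s] : EuclideanSpace ℝ (Fin 2)), x⟫| ≤ κ} =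
      {x | (x 0, x 1) ∈ {zw : ℝ × ℝ | |zw.1| ≤ κ ∧ |ρ * zw.1 + s * zw.2| ≤ κ}} := by
    ext x
    simp [PiLp.inner_apply, Fin.sum_univ_two, mul_comm]
  rw [e1, stdGaussian_two_eq_prod _ hmS, ← integral_indicator_one hmS, integral_prod]
  swap
  · exact (integrable_const (1 : ℝ)).indicator hmS
  have e2 : ∀ z : ℝ, ∫ w, Set.indicator {zw : ℝ × ℝ | |zw.1| ≤ κ ∧ |ρ * zw.1 + s * zw.2| ≤ κ}
      (1 : ℝ × ℝ → ℝ) (z, w) ∂(gaussianReal 0 1) = (Set.Icc (-κ) κ).indicator (fun z =>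
        (√(2 * Real.pi))⁻¹ * (gaussInt ((κ - ρ * z) / s) + gaussInt ((κ + ρ * z) / s))) z := by
    intro z
    have hm1 : MeasurableSet {w : ℝ | |ρ * z + s * w| ≤ κ} :=
      measurableSet_le (by fun_prop) (by fun_prop)
    by_cases hz : z ∈ Set.Icc (-κ) κ
    · rw [Set.indicator_of_mem hz, ← gaussianReal_slab_affine κ z hκ.le hs,
        ← integral_indicator_one hm1]
      congr 1
      funext w
      have hz' : |z| ≤ κ := abs_le.2 hz
      simp [Set.indicator_apply, hz']
    · rw [Set.indicator_of_notMem hz]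
      have hz' : ¬ |z| ≤ κ := fun h => hz (abs_le.1 h)
      simp [hz']
  simp_rw [e2]
  have hc1 : Continuous fun z : ℝ => Real.exp (-z ^ 2 / 2) * gaussInt ((κ - ρ * z) / s) := by
    have := continuous_gaussInt
    fun_prop
  have hc2 : Continuous fun z : ℝ => Real.exp (-z ^ 2 / 2) * gaussInt ((κ + ρ * z) / s) := by
    have := continuous_gaussInt
    fun_prop
  have hsym := intervalIntegral.integral_comp_neg (a := -κ) (b := κ)
    (fun z => Real.exp (-z ^ 2 / 2) * gaussInt ((κ - ρ * z) / s))
  simp only [neg_sq, neg_neg, mul_neg, sub_neg_eq_add] at hsym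
  rw [integral_gaussianReal_eq_integral_smul one_ne_zero]
  have e3 : (fun x => gaussianPDFReal 0 1 x • (Set.Icc (-κ) κ).indicator (fun z =>
        (√(2 * Real.pi))⁻¹ * (gaussInt ((κ - ρ * z) / s) + gaussInt ((κ + ρ * z) / s))) x) =
      (Set.Icc (-κ) κ).indicator (fun z => (2 * Real.pi)⁻¹ *
        (Real.exp (-z ^ 2 / 2) * gaussInt ((κ - ρ * z) / s) +
          Real.exp (-z ^ 2 / 2) * gaussInt ((κ + ρ * z) / s))) := by
    funext z
    by_cases hz : z ∈ Set.Icc (-κ) κ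
    · rw [Set.indicator_of_mem hz, Set.indicator_of_mem hz]
      have h3 : (√(2 * Real.pi))⁻¹ * (√(2 * Real.pi))⁻¹ = (2 * Real.pi)⁻¹ := by
        rw [← mul_inv, Real.mul_self_sqrt (by positivity)]
      simp only [gaussianPDFReal_def, NNReal.coe_one, mul_one, sub_zero, smul_eq_mul]
      rw [← h3]
      ring
    · rw [Set.indicator_of_notMem hz, Set.indicator_of_notMem hz, smul_zero]
  rw [e3, integral_indicator measurableSet_Icc, integral_Icc_eq_integral_Ioc,
    ← intervalIntegral.integral_of_le (by linarith), intervalIntegral.integral_const_mul,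
    intervalIntegral.integral_add (hc1.intervalIntegrable _ _) (hc2.intervalIntegrable _ _), hsym,
    mul_inv]
  ring

lemma sq_p_le_q {κ β : ℝ} (hκ : 0 < κ) (h : β ∈ Set.Icc (0 : ℝ) 1) : p κ ^ 2 ≤ q κ β := by
  have h1 : p κ ^ 2 ≤ p κ := by nlinarith [p_pos hκ, p_lt_one κ]
  rcases eq_or_lt_of_le h.1 with rfl | h0
  · rwa [q_zero]
  rcases eq_or_lt_of_le h.2 with rfl | h0'
  · rwa [q_one]
  rw [q_eq_pairProb hκ ⟨h0, h0'⟩]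
  exact sq_p_le_pairProb hκ (abs_lt.2 ⟨by linarith, by linarith⟩)

lemma q_pos {κ β : ℝ} (hκ : 0 < κ) (h : β ∈ Set.Icc (0 : ℝ) 1) : 0 < q κ β :=
  lt_of_lt_of_le (pow_pos (p_pos hκ) 2) (sq_p_le_q hκ h)

/-- The pair probability exceeds its value under independence by at most a multiple of the
squared correlation: the linear term vanishes because the slab is symmetric. -/
lemma q_le_sq {κ β : ℝ} (hκ : 0 < κ) (h : β ∈ Set.Icc (0 : ℝ) 1) :
    q κ β ≤ p κ ^ 2 + (2 * κ ^ 2 + 4) * (2 * β - 1) ^ 2 := by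
  by_cases h1 : |2 * β - 1| ≤ 1 / 2
  · rw [q_eq_pairProb hκ ⟨by linarith [(abs_le.1 h1).1], by linarith [(abs_le.1 h1).2]⟩]
    have := pairProb_le_of_small hκ h1
    nlinarith [sq_nonneg (2 * β - 1)]
  · have h2 : 1 / 4 ≤ (2 * β - 1) ^ 2 := by
      rw [← sq_abs]
      nlinarith [not_le.1 h1]
    have h3 := q_le_p (κ := κ) h
    have h4 := p_lt_one κ
    have : 0 ≤ κ ^ 2 * (2 * β - 1) ^ 2 := by positivity
    nlinarith [sq_nonneg (p κ)]

lemma q_half {κ : ℝ} (hκ : 0 < κ) : q κ (1 / 2) = p κ ^ 2 := by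
  rw [q_eq_pairProb hκ (by norm_num), ← pairProb_zero hκ.le]
  norm_num

/-! ### The quadratic gap of `F` at `1/2` -/

/-- The derivative of `F κ α` on `(0, 1)`. -/
noncomputable def derivF (κ α β : ℝ) : ℝ :=
  (Real.log (1 - β) - Real.log β) +
    α * (pairDensity κ (2 * β - 1) * 2 / pairProb κ (2 * β - 1))

lemma hasDerivAt_F {κ : ℝ} (hκ : 0 < κ) (α : ℝ) {β : ℝ} (h : β ∈ Set.Ioo (0 : ℝ) 1) :
    HasDerivAt (F κ α) (derivF κ α β) β := by
  have hρ : |2 * β - 1| < 1 := abs_lt.2 ⟨by linarith [h.1], by linarith [h.2]⟩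
  have hpos : 0 < pairProb κ (2 * β - 1) := by
    rw [← q_eq_pairProb hκ h]
    exact q_pos hκ ⟨h.1.le, h.2.le⟩
  have h1 : HasDerivAt (fun β => pairProb κ (2 * β - 1)) (pairDensity κ (2 * β - 1) * 2) β := by
    have h2 : HasDerivAt (fun β : ℝ => 2 * β - 1) 2 β :=
      (((hasDerivAt_id β).const_mul 2).sub_const 1).congr_deriv (by simp)
    exact HasDerivAt.comp (h₂ := pairProb κ) β (hasDerivAt_pairProb hκ hρ) h2
  have h3 := (Real.hasDerivAt_binEntropy h.1.ne' h.2.ne).add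
    ((h1.log hpos.ne').const_mul α)
  refine h3.congr_of_eventuallyEq ?_
  filter_upwards [isOpen_Ioo.mem_nhds h] with x hx
  simp only [F, Pi.add_apply, q_eq_pairProb hκ hx]

lemma pairDensity_zero (κ : ℝ) : pairDensity κ 0 = 0 := by simp [pairDensity]

lemma derivF_half (κ α : ℝ) : derivF κ α (1 / 2) = 0 := by
  norm_num [derivF, pairDensity_zero]

/-- The second derivative at `1/2`; there `pairDensity` vanishes, so that only the derivatives of the
entropy and of `pairDensity` contribute. -/
lemma hasDerivAt_derivF_half {κ : ℝ} (hκ : 0 < κ) (α : ℝ) :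
    HasDerivAt (derivF κ α) (-4 * (1 - α / invMills κ ^ 2)) (1 / 2) := by
  have hp := p_pos hκ
  have h0 : (2 : ℝ) * (1 / 2) - 1 = 0 := by norm_num
  have h2 : HasDerivAt (fun β : ℝ => 2 * β - 1) 2 (1 / 2) :=
    (((hasDerivAt_id (1 / 2 : ℝ)).const_mul 2).sub_const 1).congr_deriv (by simp)
  have h3 : HasDerivAt (fun β => pairDensity κ (2 * β - 1))
      (p κ ^ 2 / invMills κ ^ 2 * 2) (1 / 2) := by
    refine HasDerivAt.comp (h₂ := pairDensity κ) (1 / 2 : ℝ) ?_ h2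
    rw [h0]
    exact hasDerivAt_pairDensity_zero hκ
  have h4 : HasDerivAt (fun β => pairProb κ (2 * β - 1)) (0 * 2) (1 / 2) := by
    refine HasDerivAt.comp (h₂ := pairProb κ) (1 / 2 : ℝ) ?_ h2
    have h := hasDerivAt_pairProb hκ (ρ := 0) (by simp)
    rw [pairDensity_zero] at h
    rwa [h0]
  have h5 : HasDerivAt (fun β : ℝ => Real.log (1 - β) - Real.log β) (-4) (1 / 2) := by
    have a1 := (((hasDerivAt_id (1 / 2 : ℝ)).const_sub 1).log (by norm_num)).sub
      (Real.hasDerivAt_log (by norm_num : (1 / 2 : ℝ) ≠ 0))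
    exact a1.congr_deriv (by norm_num)
  have hq0 : pairProb κ (2 * (1 / 2) - 1) = p κ ^ 2 := by rw [h0, pairProb_zero hκ.le]
  have h6 := h5.add (((h3.mul_const 2).div h4 (by rw [hq0]; positivity)).const_mul α)
  refine h6.congr_deriv ?_
  rw [hq0, h0, pairDensity_zero]
  have := invMills_pos hκ
  field_simp
  ring

/-- Below the first-moment threshold `F_α` is strictly concave at `1/2`. -/
lemma div_invMills_sq_lt_one {κ α : ℝ} (hκ : 0 < κ) (hα : α < alphaC κ) :
    α / invMills κ ^ 2 < 1 := by
  have h1 := levelTwoGap_nonneg hκ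
  have h2 := log_p_neg hκ
  have h3 := invMills_pos hκ
  rw [alphaC, ← neg_div_neg_eq, neg_neg, lt_div_iff₀ (by linarith)] at hα
  rw [levelTwoGap, sub_nonneg, div_le_iff₀ (by positivity)] at h1
  rw [div_lt_one (by positivity)]
  nlinarith

lemma deriv_deriv_F_half {κ α : ℝ} (hκ : 0 < κ) :
    deriv (deriv (F κ α)) (1 / 2) = -4 * (1 - α / invMills κ ^ 2) := by
  have h : deriv (F κ α) =ᶠ[𝓝 (1 / 2)] derivF κ α := by
    filter_upwards [isOpen_Ioo.mem_nhds (by norm_num : (1 / 2 : ℝ) ∈ Set.Ioo (0 : ℝ) 1)] with x hx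
    exact (hasDerivAt_F hκ α hx).deriv
  rw [h.deriv_eq]
  exact (hasDerivAt_derivF_half hκ α).deriv

lemma F_half {κ : ℝ} (hκ : 0 < κ) (α : ℝ) :
    F κ α (1 / 2) = Real.log 2 + 2 * α * Real.log (p κ) := by
  rw [F, q_half hκ, Real.log_pow, one_div, Real.binEntropy_two_inv]
  push_cast
  ring

lemma F_one_sub {κ α β : ℝ} (h : β ∈ Set.Icc (0 : ℝ) 1) : F κ α (1 - β) = F κ α β := by
  rw [F, F, q_one_sub h, Real.binEntropy_one_sub]

/-- Near `1/2` the second-order behaviour gives a quadratic gap. -/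
lemma exists_quadratic_gap_near_half {κ α : ℝ} (hκ : 0 < κ) (hα : α < alphaC κ) :
    ∃ m > 0, ∃ η > 0, η < 1 / 2 ∧ (∀ β ∈ Set.Ioo (1 / 2 - η) (1 / 2), 0 < derivF κ α β) ∧
      ∀ β ∈ Set.Ioc (1 / 2 - η) (1 / 2), F κ α β ≤ F κ α (1 / 2) - m * (β - 1 / 2) ^ 2 := by
  have hd := hasDerivAt_derivF_half hκ α
  have hlt := div_invMills_sq_lt_one hκ hα
  set k := 1 - α / invMills κ ^ 2 with hk
  have hk0 : 0 < k := by linarith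
  have h1 := hd.isLittleO.def (c := 2 * k) (by linarith)
  obtain ⟨η₀, hη₀, hball⟩ := Metric.eventually_nhds_iff.1 h1
  have hη := lt_min hη₀ (by norm_num : (0 : ℝ) < 1 / 4)
  have hη1 := min_le_left η₀ (1 / 4)
  have hη2 := min_le_right η₀ (1 / 4)
  generalize min η₀ (1 / 4) = η at *
  have hder : ∀ β ∈ Set.Ioo (1 / 2 - η) (1 / 2), 2 * k * (1 / 2 - β) ≤ derivF κ α β := by
    intro β hβ
    have h2 := hball (y := β) (by
      rw [Real.dist_eq, abs_of_neg (by linarith [hβ.2])]; linarith [hβ.1])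
    rw [derivF_half, smul_eq_mul, Real.norm_eq_abs, Real.norm_eq_abs,
      abs_of_neg (by linarith [hβ.2] : β - 1 / 2 < 0)] at h2
    have := (abs_le.1 h2).1
    nlinarith
  refine ⟨k, hk0, η, hη, by linarith, fun β hβ => lt_of_lt_of_le
    (mul_pos (by linarith) (by linarith [hβ.2])) (hder β hβ), fun β hβ => ?_⟩
  have hd2 : ∀ x ∈ Set.Icc β (1 / 2), HasDerivAt (fun x => F κ α x + k * (x - 1 / 2) ^ 2)
      (derivF κ α x + 2 * k * (x - 1 / 2)) x := fun x hx => by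
    have h3 := hasDerivAt_F hκ α (β := x) ⟨by linarith [hx.1, hβ.1], by linarith [hx.2]⟩
    refine (h3.add ((((hasDerivAt_id x).sub_const (1 / 2)).pow 2).const_mul k)).congr_deriv ?_
    simp
    ring
  have hm := monotoneOn_of_hasDerivWithinAt_nonneg (convex_Icc β (1 / 2))
    (fun x hx => (hd2 x hx).continuousAt.continuousWithinAt)
    (fun x hx => (hd2 x (interior_subset hx)).hasDerivWithinAt)
    (fun x hx => by
      rw [interior_Icc] at hx
      have := hder x ⟨by linarith [hx.1, hβ.1], hx.2⟩
      linarith) ⟨le_refl β, hβ.2⟩ ⟨hβ.2, le_refl _⟩ hβ.2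
  simp only [sub_self] at hm
  linarith

/-- Near `0` the bound `q ≤ p` and `α < α_c` give a uniform gap. -/
lemma exists_gap_near_zero {κ α : ℝ} (hκ : 0 < κ) (hα0 : 0 < α) (hα : α < alphaC κ) :
    ∃ m > 0, ∃ β₀ > 0, β₀ < 1 / 2 ∧ ∀ β ∈ Set.Icc 0 β₀, F κ α β ≤ F κ α (1 / 2) - m := by
  have h2 := log_p_neg hκ
  rw [alphaC, ← neg_div_neg_eq, neg_neg, lt_div_iff₀ (by linarith)] at hα
  set m := (Real.log 2 + α * Real.log (p κ)) / 2 with hm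
  have hm0 : 0 < m := by rw [hm]; linarith
  have h3 := Real.binEntropy_continuous.tendsto 0
  rw [Real.binEntropy_zero] at h3
  obtain ⟨δ, hδ, hball⟩ := Metric.eventually_nhds_iff.1 (h3.eventually (gt_mem_nhds hm0))
  have hδ' := lt_min (half_pos hδ) (by norm_num : (0 : ℝ) < 1 / 4)
  have hδ1 := min_le_left (δ / 2) (1 / 4)
  have hδ2 := min_le_right (δ / 2) (1 / 4)
  generalize min (δ / 2) (1 / 4) = β₀ at *
  refine ⟨m, hm0, β₀, hδ', by linarith, fun β hβ => ?_⟩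
  have h4 := hball (y := β) (by
    rw [Real.dist_eq, sub_zero, abs_of_nonneg hβ.1]; linarith [hβ.2])
  have hβ' : β ∈ Set.Icc (0 : ℝ) 1 := ⟨hβ.1, by linarith [hβ.2]⟩
  have h5 := Real.log_le_log (q_pos hκ hβ') (q_le_p (κ := κ) hβ')
  rw [F_half hκ, F]
  nlinarith

/-- Under the assumption on critical points, `F_α` is strictly below its value at `1/2` on
`(0, 1/2)`: it increases from the critical point `b` to `1/2`, and it is monotone on `(0, b)`, so its
values there are below the one at `b` or below those near `0`. -/
lemma F_lt_half {κ α : ℝ} (hκ : 0 < κ) (hα0 : 0 < α) (hα : α < alphaC κ)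
    (hass : CriticalPointAssumption κ α) {β : ℝ} (hβ : β ∈ Set.Ioo (0 : ℝ) (1 / 2)) :
    F κ α β < F κ α (1 / 2) := by
  obtain ⟨b, ⟨hb, -⟩, huniq⟩ := hass (by
    rw [deriv_deriv_F_half hκ]
    linarith [div_invMills_sq_lt_one hκ hα])
  have hd : ∀ x ∈ Set.Ioo (0 : ℝ) 1, HasDerivAt (F κ α) (derivF κ α x) x := fun x hx =>
    hasDerivAt_F hκ α hx
  have hne : ∀ x ∈ Set.Ioo (0 : ℝ) (1 / 2), x ≠ b → derivF κ α x ≠ 0 := fun x hx hxb h0 =>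
    hxb (huniq x ⟨hx, h0 ▸ hd x ⟨hx.1, by linarith [hx.2]⟩⟩)
  obtain ⟨m, hm, η, hη, hη2, hpos, -⟩ := exists_quadratic_gap_near_half hκ hα
  obtain ⟨m', hm', β₀, hβ₀, hβ₀2, hzero⟩ := exists_gap_near_zero hκ hα0 hα
  have hright : ∀ x ∈ Set.Ioo b (1 / 2), 0 < derivF κ α x := by
    rcases hasDerivWithinAt_forall_lt_or_forall_gt_of_forall_ne (convex_Ioo b (1 / 2))
      (f := F κ α) (f' := derivF κ α)
      (fun x hx => (hd x ⟨hb.1.trans hx.1, by linarith [hx.2]⟩).hasDerivWithinAt)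
      (m := 0) (fun x hx => hne x ⟨hb.1.trans hx.1, hx.2⟩ hx.1.ne') with h | h
    · exfalso
      obtain ⟨y, hy1, hy2⟩ := exists_between (max_lt hb.2 (by linarith : 1 / 2 - η < 1 / 2))
      have h1 := hpos y ⟨(le_max_right _ _).trans_lt hy1, hy2⟩
      have h2 := h y ⟨(le_max_left _ _).trans_lt hy1, hy2⟩
      linarith
    · exact h
  have hmono : StrictMonoOn (F κ α) (Set.Icc b (1 / 2)) := by
    refine strictMonoOn_of_hasDerivWithinAt_pos (convex_Icc b (1 / 2))
      (f' := derivF κ α)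
      (fun x hx => (hd x ⟨hb.1.trans_le hx.1, by linarith [hx.2]⟩).continuousAt.continuousWithinAt)
      (fun x hx => ?_) (fun x hx => ?_)
    · rw [interior_Icc] at hx
      exact (hd x ⟨hb.1.trans hx.1, by linarith [hx.2]⟩).hasDerivWithinAt
    · rw [interior_Icc] at hx
      exact hright x hx
  have hhalf : (1 / 2 : ℝ) ∈ Set.Icc b (1 / 2) := ⟨hb.2.le, le_refl _⟩
  rcases le_or_gt b β with hbβ | hbβ
  · exact hmono ⟨hbβ, hβ.2.le⟩ hhalf hβ.2
  have hcont : ∀ y, 0 < y → ContinuousOn (F κ α) (Set.Icc y b) := fun y hy x hx =>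
    (hd x ⟨hy.trans_le hx.1, by linarith [hx.2, hb.2]⟩).continuousAt.continuousWithinAt
  rcases hasDerivWithinAt_forall_lt_or_forall_gt_of_forall_ne (convex_Ioo 0 b)
      (f := F κ α) (f' := derivF κ α)
      (fun x hx => (hd x ⟨hx.1, by linarith [hx.2, hb.2]⟩).hasDerivWithinAt)
      (m := 0) (fun x hx => hne x ⟨hx.1, hx.2.trans hb.2⟩ hx.2.ne) with h | h
  · set y := min β₀ β with hy
    have hy0 : 0 < y := lt_min hβ₀ hβ.1
    have hanti : AntitoneOn (F κ α) (Set.Icc y b) := by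
      refine antitoneOn_of_hasDerivWithinAt_nonpos (convex_Icc y b) (f' := derivF κ α)
        (hcont y hy0) (fun x hx => ?_) (fun x hx => ?_)
      · rw [interior_Icc] at hx
        exact (hd x ⟨hy0.trans hx.1, by linarith [hx.2, hb.2]⟩).hasDerivWithinAt
      · rw [interior_Icc] at hx
        exact (h x ⟨hy0.trans hx.1, hx.2⟩).le
    have h1 := hanti ⟨le_refl y, (min_le_right _ _).trans hbβ.le⟩
      ⟨min_le_right _ _, hbβ.le⟩ (min_le_right _ _)
    have h2 := hzero y ⟨hy0.le, min_le_left _ _⟩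
    linarith
  · have hmono' : MonotoneOn (F κ α) (Set.Icc β b) := by
      refine monotoneOn_of_hasDerivWithinAt_nonneg (convex_Icc β b) (f' := derivF κ α)
        (hcont β hβ.1) (fun x hx => ?_) (fun x hx => ?_)
      · rw [interior_Icc] at hx
        exact (hd x ⟨hβ.1.trans hx.1, by linarith [hx.2, hb.2]⟩).hasDerivWithinAt
      · rw [interior_Icc] at hx
        exact (h x ⟨hβ.1.trans hx.1, hx.2⟩).le
    exact (hmono' ⟨le_refl β, hbβ.le⟩ ⟨hbβ.le, le_refl b⟩ hbβ.le).trans_lt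
      (hmono ⟨le_refl b, hb.2.le⟩ hhalf hb.2)

/-- The quadratic gap of `F_α` at `1/2`, uniformly over `[0, 1]`. -/
theorem exists_quadratic_gap {κ α : ℝ} (hκ : 0 < κ) (hα0 : 0 < α) (hα : α < alphaC κ)
    (hass : CriticalPointAssumption κ α) :
    ∃ c > 0, ∀ β ∈ Set.Icc (0 : ℝ) 1, F κ α β ≤ F κ α (1 / 2) - c * (2 * β - 1) ^ 2 := by
  obtain ⟨m, hm, η, hη, hη2, -, hnear⟩ := exists_quadratic_gap_near_half hκ hα
  obtain ⟨m', hm', β₀, hβ₀, hβ₀2, hzero⟩ := exists_gap_near_zero hκ hα0 hα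
  obtain ⟨m'', hm'', hmid⟩ : ∃ m > 0, ∀ β ∈ Set.Icc β₀ (1 / 2 - η),
      F κ α β ≤ F κ α (1 / 2) - m := by
    rcases (Set.Icc β₀ (1 / 2 - η)).eq_empty_or_nonempty with he | hne
    · exact ⟨1, one_pos, fun β hβ => by rw [he] at hβ; exact hβ.elim⟩
    obtain ⟨x, hx, hmax⟩ := isCompact_Icc.exists_isMaxOn hne (f := F κ α) fun x hx =>
      (hasDerivAt_F hκ α ⟨hβ₀.trans_le hx.1, by linarith [hx.2]⟩).continuousAt.continuousWithinAt
    refine ⟨F κ α (1 / 2) - F κ α x, sub_pos.2 (F_lt_half hκ hα0 hα hass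
      ⟨hβ₀.trans_le hx.1, by linarith [hx.2]⟩), fun β hβ => ?_⟩
    have : F κ α β ≤ F κ α x := hmax hβ
    linarith
  have hc : 0 < min (m / 4) (min m' m'') := by positivity
  have hc1 : min (m / 4) (min m' m'') ≤ m / 4 := min_le_left _ _
  have hc2 : min (m / 4) (min m' m'') ≤ m' := (min_le_right _ _).trans (min_le_left _ _)
  have hc3 : min (m / 4) (min m' m'') ≤ m'' := (min_le_right _ _).trans (min_le_right _ _)
  generalize min (m / 4) (min m' m'') = c at *
  have hhalf : ∀ β ∈ Set.Icc (0 : ℝ) (1 / 2),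
      F κ α β ≤ F κ α (1 / 2) - c * (2 * β - 1) ^ 2 := by
    intro β hβ
    have h1 : (2 * β - 1) ^ 2 ≤ 1 := by nlinarith [hβ.1, hβ.2]
    have h0 : 0 ≤ (2 * β - 1) ^ 2 := sq_nonneg _
    rcases le_or_gt β β₀ with h | h
    · have := hzero β ⟨hβ.1, h⟩
      nlinarith
    rcases le_or_gt β (1 / 2 - η) with h' | h'
    · have := hmid β ⟨h.le, h'⟩
      nlinarith
    · have := hnear β ⟨h', hβ.2⟩
      nlinarith
  refine ⟨c, hc, fun β hβ => ?_⟩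
  rcases le_total β (1 / 2) with h | h
  · exact hhalf β ⟨hβ.1, h⟩
  · have := hhalf (1 - β) ⟨by linarith [hβ.2], by linarith⟩
    rw [F_one_sub hβ] at this
    have e : (2 * (1 - β) - 1) ^ 2 = (2 * β - 1) ^ 2 := by ring
    rwa [e] at this

/-! ### Taylor expansion of alternating exponential sums -/

lemma exp_neg_le_quadratic {y : ℝ} (hy : 0 ≤ y) : Real.exp (-y) ≤ 1 - y + y ^ 2 / 2 := by
  have h1 := Real.quadratic_le_exp_of_nonneg hy
  have h2 : 0 < 1 - y + y ^ 2 / 2 := by nlinarith [sq_nonneg (y - 1)]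
  rw [Real.exp_neg, inv_le_comm₀ (Real.exp_pos y) h2]
  refine le_trans ?_ h1
  rw [inv_le_iff_one_le_mul₀ h2]
  nlinarith [sq_nonneg (y ^ 2)]

lemma cubic_le_exp_neg {y : ℝ} (hy : 0 ≤ y) :
    1 - y + y ^ 2 / 2 - y ^ 3 / 6 ≤ Real.exp (-y) := by
  have hd : ∀ x : ℝ, HasDerivAt (fun x => Real.exp (-x) - (1 - x + x ^ 2 / 2 - x ^ 3 / 6))
      (-Real.exp (-x) + 1 - x + x ^ 2 / 2) x := fun x => by
    have := (hasDerivAt_neg x).exp.sub (((((hasDerivAt_id x).const_sub 1).add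
      ((hasDerivAt_pow 2 x).div_const 2))).sub ((hasDerivAt_pow 3 x).div_const 6))
    refine this.congr_deriv ?_
    push_cast
    ring
  have hm := monotoneOn_of_hasDerivWithinAt_nonneg (convex_Icc 0 y)
    (fun x _ => (hd x).continuousAt.continuousWithinAt) (fun x _ => (hd x).hasDerivWithinAt)
    (fun x hx => by have := exp_neg_le_quadratic (interior_subset hx).1; linarith)
    ⟨le_refl 0, hy⟩ ⟨hy, le_refl y⟩ hy
  norm_num at hm
  linarith

/-- Third-order Taylor bound for the exponential, with a constant that does not grow on the
negative half-line. -/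
lemma abs_exp_neg_sub_quadratic_le (b : ℝ) :
    |Real.exp (-b) - (1 - b + b ^ 2 / 2)| ≤ |b| ^ 3 * max 1 (Real.exp (-b)) := by
  rcases le_total 0 b with h | h
  · have h1 := exp_neg_le_quadratic h
    have h2 := cubic_le_exp_neg h
    have h3 : 0 ≤ b ^ 3 := by positivity
    rw [abs_of_nonpos (by linarith), abs_of_nonneg h]
    nlinarith [le_max_left 1 (Real.exp (-b))]
  · have h1 := Complex.norm_exp_sub_sum_le_norm_mul_exp ((-b : ℝ) : ℂ) 3
    have h2 : Complex.exp ((-b : ℝ) : ℂ) -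
        ∑ m ∈ Finset.range 3, ((-b : ℝ) : ℂ) ^ m / (m.factorial : ℂ) =
        ((Real.exp (-b) - (1 - b + b ^ 2 / 2) : ℝ) : ℂ) := by
      simp only [Finset.sum_range_succ, Finset.sum_range_zero, Nat.factorial]
      push_cast
      ring
    rw [h2, Complex.norm_real, Complex.norm_real, Real.norm_eq_abs, Real.norm_eq_abs, abs_neg,
      abs_of_nonpos h] at h1
    rw [abs_of_nonpos h]
    refine h1.trans ?_
    have : 0 ≤ (-b) ^ 3 := by have : 0 ≤ -b := by linarith
                              positivity
    exact mul_le_mul_of_nonneg_left (le_max_right _ _) this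

/-- The real part of `∏ i, (exp (I * aᵢ) - m)` over four factors. -/
noncomputable def quadCos (m a b c d : ℝ) : ℝ :=
  Real.cos (a + b + c + d)
  - m * (Real.cos (a + b + c) + Real.cos (a + b + d) + Real.cos (a + c + d) + Real.cos (b + c + d))
  + m ^ 2 * (Real.cos (a + b) + Real.cos (a + c) + Real.cos (a + d) + Real.cos (b + c)
    + Real.cos (b + d) + Real.cos (c + d))
  - m ^ 3 * (Real.cos a + Real.cos b + Real.cos c + Real.cos d) + m ^ 4

lemma prod_cos_sub_eq (m a b c d : ℝ) :
    (Real.cos a - m) * (Real.cos b - m) * (Real.cos c - m) * (Real.cos d - m) =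
      (quadCos m a b c d + quadCos m a b c (-d) + quadCos m a b (-c) d + quadCos m a b (-c) (-d)
      + quadCos m a (-b) c d + quadCos m a (-b) c (-d) + quadCos m a (-b) (-c) d
      + quadCos m a (-b) (-c) (-d)) / 8 := by
  simp only [quadCos, Real.cos_add, Real.sin_add, Real.cos_neg, Real.sin_neg]
  ring

/-- The alternating sum of `exp (-b_A)` over the subsets `A` of four indices, where `b_A` is the
sum of the pair weights inside `A`. -/
noncomputable def altExp (ab ac ad bc bd cd : ℝ) : ℝ :=
  Real.exp (-(ab + ac + ad + bc + bd + cd))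
  - (Real.exp (-(ab + ac + bc)) + Real.exp (-(ab + ad + bd)) + Real.exp (-(ac + ad + cd))
    + Real.exp (-(bc + bd + cd)))
  + (Real.exp (-ab) + Real.exp (-ac) + Real.exp (-ad) + Real.exp (-bc) + Real.exp (-bd)
    + Real.exp (-cd)) - 3

section Replicas

variable {E : Type*} [NormedAddCommGroup E] [InnerProductSpace ℝ E] [FiniteDimensional ℝ E]
  [MeasurableSpace E] [BorelSpace E]

/-- Gaussian mean of `quadCos` when `m` is the mean of each single cosine: every cosine of a sum over
a subset contributes the pair weights inside that subset, and the prefactors `m ^ k` combine to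
`m ^ 4`. -/
lemma integral_quadCos {u v w z : E} (hu : ‖u‖ = 1) (hv : ‖v‖ = 1) (hw : ‖w‖ = 1) (hz : ‖z‖ = 1)
    (ξ : ℝ) :
    ∫ x, quadCos (Real.exp (-ξ ^ 2 / 2)) (ξ * ⟪u, x⟫) (ξ * ⟪v, x⟫) (ξ * ⟪w, x⟫) (ξ * ⟪z, x⟫)
      ∂(stdGaussian E) = Real.exp (-ξ ^ 2 / 2) ^ 4 *
        altExp (ξ ^ 2 * ⟪u, v⟫) (ξ ^ 2 * ⟪u, w⟫) (ξ ^ 2 * ⟪u, z⟫) (ξ ^ 2 * ⟪v, w⟫)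
          (ξ ^ 2 * ⟪v, z⟫) (ξ ^ 2 * ⟪w, z⟫) := by
  have key (y : E) : Integrable (fun x => Real.cos (ξ * ⟪y, x⟫)) (stdGaussian E) ∧
      ∫ x, Real.cos (ξ * ⟪y, x⟫) ∂(stdGaussian E) = Real.exp (-(ξ ^ 2 * ‖y‖ ^ 2) / 2) := by
    refine ⟨Integrable.of_bound (by fun_prop) 1 (Eventually.of_forall fun x => by
      rw [Real.norm_eq_abs]; exact Real.abs_cos_le_one _), ?_⟩
    have h := integral_cos_inner_stdGaussian (ξ • y)
    simp only [inner_smul_left, RCLike.conj_to_real, norm_smul, mul_pow, Real.norm_eq_abs,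
      sq_abs] at h
    exact h
  have add {f g : E → ℝ} {I J : ℝ}
      (hf : Integrable f (stdGaussian E) ∧ ∫ x, f x ∂(stdGaussian E) = I)
      (hg : Integrable g (stdGaussian E) ∧ ∫ x, g x ∂(stdGaussian E) = J) :
      Integrable (fun x => f x + g x) (stdGaussian E) ∧
        ∫ x, (f x + g x) ∂(stdGaussian E) = I + J :=
    ⟨hf.1.add hg.1, by rw [integral_add hf.1 hg.1, hf.2, hg.2]⟩
  have smul (c : ℝ) {f : E → ℝ} {I : ℝ}
      (hf : Integrable f (stdGaussian E) ∧ ∫ x, f x ∂(stdGaussian E) = I) :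
      Integrable (fun x => c * f x) (stdGaussian E) ∧ ∫ x, c * f x ∂(stdGaussian E) = c * I :=
    ⟨hf.1.const_mul c, by rw [integral_const_mul, hf.2]⟩
  have const (c : ℝ) : Integrable (fun _ : E => c) (stdGaussian E) ∧
      ∫ _, c ∂(stdGaussian E) = c := ⟨integrable_const c, by simp⟩
  generalize hm : Real.exp (-ξ ^ 2 / 2) = m
  have e (x : E) : quadCos m (ξ * ⟪u, x⟫) (ξ * ⟪v, x⟫) (ξ * ⟪w, x⟫)
      (ξ * ⟪z, x⟫) = Real.cos (ξ * ⟪u + v + w + z, x⟫)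
      + (-m) * (Real.cos (ξ * ⟪u + v + w, x⟫) + Real.cos (ξ * ⟪u + v + z, x⟫)
        + Real.cos (ξ * ⟪u + w + z, x⟫) + Real.cos (ξ * ⟪v + w + z, x⟫))
      + m ^ 2 * (Real.cos (ξ * ⟪u + v, x⟫) + Real.cos (ξ * ⟪u + w, x⟫)
        + Real.cos (ξ * ⟪u + z, x⟫) + Real.cos (ξ * ⟪v + w, x⟫) + Real.cos (ξ * ⟪v + z, x⟫)
        + Real.cos (ξ * ⟪w + z, x⟫))
      + (-m ^ 3) * (Real.cos (ξ * ⟪u, x⟫) + Real.cos (ξ * ⟪v, x⟫)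
        + Real.cos (ξ * ⟪w, x⟫) + Real.cos (ξ * ⟪z, x⟫)) + m ^ 4 := by
    simp only [quadCos, inner_add_left, mul_add]
    ring
  simp_rw [e]
  rw [(add (add (add (add (key (u + v + w + z)) (smul (-m) (add (add (add (key (u + v + w))
    (key (u + v + z))) (key (u + w + z))) (key (v + w + z))))) (smul (m ^ 2) (add (add (add (add
    (add (key (u + v)) (key (u + w))) (key (u + z))) (key (v + w))) (key (v + z)))
    (key (w + z))))) (smul (-m ^ 3) (add (add (add (key u) (key v)) (key w)) (key z))))
    (const (m ^ 4))).2]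
  have n1 {a : E} (ha : ‖a‖ = 1) : Real.exp (-(ξ ^ 2 * ‖a‖ ^ 2) / 2) = m := by
    rw [ha, ← hm]; simp
  have n2 {a b : E} (ha : ‖a‖ = 1) (hb : ‖b‖ = 1) :
      Real.exp (-(ξ ^ 2 * ‖a + b‖ ^ 2) / 2) = m ^ 2 * Real.exp (-(ξ ^ 2 * ⟪a, b⟫)) := by
    rw [← hm, ← Real.exp_nat_mul, ← Real.exp_add, norm_add_sq_real, ha, hb]
    congr 1
    push_cast
    ring
  have n3 {a b c : E} (ha : ‖a‖ = 1) (hb : ‖b‖ = 1) (hc : ‖c‖ = 1) :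
      Real.exp (-(ξ ^ 2 * ‖a + b + c‖ ^ 2) / 2) =
        m ^ 3 * Real.exp (-(ξ ^ 2 * ⟪a, b⟫ + ξ ^ 2 * ⟪a, c⟫ + ξ ^ 2 * ⟪b, c⟫)) := by
    rw [← hm, ← Real.exp_nat_mul, ← Real.exp_add, norm_add_sq_real, norm_add_sq_real, ha, hb, hc,
      inner_add_left]
    congr 1
    push_cast
    ring
  have n4 : Real.exp (-(ξ ^ 2 * ‖u + v + w + z‖ ^ 2) / 2) =
        m ^ 4 * Real.exp (-(ξ ^ 2 * ⟪u, v⟫ + ξ ^ 2 * ⟪u, w⟫ + ξ ^ 2 * ⟪u, z⟫ + ξ ^ 2 * ⟪v, w⟫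
          + ξ ^ 2 * ⟪v, z⟫ + ξ ^ 2 * ⟪w, z⟫)) := by
    rw [← hm, ← Real.exp_nat_mul, ← Real.exp_add, norm_add_sq_real, norm_add_sq_real,
      norm_add_sq_real, hu, hv, hw, hz, inner_add_left, inner_add_left, inner_add_left]
    congr 1
    push_cast
    ring
  rw [n4, n3 hu hv hw, n3 hu hv hz, n3 hu hw hz, n3 hv hw hz, n2 hu hv, n2 hu hw, n2 hu hz,
    n2 hv hw, n2 hv hz, n2 hw hz, n1 hu, n1 hv, n1 hw, n1 hz, altExp]
  ring

/-- The exponential weights of sums of unit vectors stay bounded once the Gaussian factor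
`exp (-ξ²/2) ^ 4` is included. -/
lemma mul_max_exp_le_one {b ξ : ℝ} (h : -b ≤ 2 * ξ ^ 2) :
    Real.exp (-ξ ^ 2 / 2) ^ 4 * max 1 (Real.exp (-b)) ≤ 1 := by
  rw [mul_max_of_nonneg _ _ (by positivity), mul_one, ← Real.exp_nat_mul, ← Real.exp_add]
  refine max_le (Real.exp_le_one_iff.2 ?_) (Real.exp_le_one_iff.2 ?_) <;> push_cast <;>
    nlinarith [sq_nonneg ξ]

lemma abs_weighted_taylor_le {b ξ : ℝ} (h : -b ≤ 2 * ξ ^ 2) :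
    |Real.exp (-ξ ^ 2 / 2) ^ 4 * (Real.exp (-b) - (1 - b + b ^ 2 / 2))| ≤ |b| ^ 3 := by
  have h0 : 0 < Real.exp (-ξ ^ 2 / 2) ^ 4 := by positivity
  rw [abs_mul, abs_of_pos h0]
  calc _ ≤ Real.exp (-ξ ^ 2 / 2) ^ 4 * (|b| ^ 3 * max 1 (Real.exp (-b))) := by
        gcongr; exact abs_exp_neg_sub_quadratic_le b
    _ = |b| ^ 3 * (Real.exp (-ξ ^ 2 / 2) ^ 4 * max 1 (Real.exp (-b))) := by ring
    _ ≤ |b| ^ 3 * 1 := by gcongr; exact mul_max_exp_le_one h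
    _ = _ := mul_one _

end Replicas

/-! ### Fourth moments of centred cosine sums -/

/-- The sum of the cubed absolute values of six pair weights. -/
def cubeSum (ab ac ad bc bd cd : ℝ) : ℝ :=
  |ab| ^ 3 + |ac| ^ 3 + |ad| ^ 3 + |bc| ^ 3 + |bd| ^ 3 + |cd| ^ 3

/-- Second-order expansion of the weighted alternating sum. Constants and linear terms cancel, and of
the quadratic terms only products of complementary pairs survive. The constant is `11 · 6³`: eleven
exponentials, each with an exponent of size at most six times the cube root of `cubeSum`. -/
lemma abs_weighted_altExp_sub_le {ab ac ad bc bd cd ξ : ℝ}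
    (hab : -ab ≤ 2 * ξ ^ 2) (hac : -ac ≤ 2 * ξ ^ 2) (had : -ad ≤ 2 * ξ ^ 2)
    (hbc : -bc ≤ 2 * ξ ^ 2) (hbd : -bd ≤ 2 * ξ ^ 2) (hcd : -cd ≤ 2 * ξ ^ 2)
    (habc : -(ab + ac + bc) ≤ 2 * ξ ^ 2) (habd : -(ab + ad + bd) ≤ 2 * ξ ^ 2)
    (hacd : -(ac + ad + cd) ≤ 2 * ξ ^ 2) (hbcd : -(bc + bd + cd) ≤ 2 * ξ ^ 2)
    (hall : -(ab + ac + ad + bc + bd + cd) ≤ 2 * ξ ^ 2) :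
    |Real.exp (-ξ ^ 2 / 2) ^ 4 * altExp ab ac ad bc bd cd -
      Real.exp (-ξ ^ 2 / 2) ^ 4 * (ab * cd + ac * bd + ad * bc)| ≤
      2376 * cubeSum ab ac ad bc bd cd := by
  -- all six weights are bounded by the cube root `t` of `cubeSum`
  obtain ⟨t, ht0, ht⟩ : ∃ t : ℝ, 0 ≤ t ∧ t ^ 3 = cubeSum ab ac ad bc bd cd := by
    have h0 : 0 ≤ cubeSum ab ac ad bc bd cd := by unfold cubeSum; positivity
    refine ⟨cubeSum ab ac ad bc bd cd ^ ((3 : ℕ) : ℝ)⁻¹, by positivity, ?_⟩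
    exact Real.rpow_inv_natCast_pow h0 (by norm_num)
  have hle {s : ℝ} (hs : |s| ^ 3 ≤ cubeSum ab ac ad bc bd cd) : |s| ≤ t :=
    le_of_pow_le_pow_left₀ three_ne_zero ht0 (by rwa [ht])
  have p1 := pow_nonneg (abs_nonneg ab) 3
  have p2 := pow_nonneg (abs_nonneg ac) 3
  have p3 := pow_nonneg (abs_nonneg ad) 3
  have p4 := pow_nonneg (abs_nonneg bc) 3
  have p5 := pow_nonneg (abs_nonneg bd) 3
  have p6 := pow_nonneg (abs_nonneg cd) 3
  have b1 := abs_le.1 (hle (s := ab) (by unfold cubeSum; linarith))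
  have b2 := abs_le.1 (hle (s := ac) (by unfold cubeSum; linarith))
  have b3 := abs_le.1 (hle (s := ad) (by unfold cubeSum; linarith))
  have b4 := abs_le.1 (hle (s := bc) (by unfold cubeSum; linarith))
  have b5 := abs_le.1 (hle (s := bd) (by unfold cubeSum; linarith))
  have b6 := abs_le.1 (hle (s := cd) (by unfold cubeSum; linarith))
  have taylor {b : ℝ} (h : -b ≤ 2 * ξ ^ 2) (hb : -(6 * t) ≤ b) (hb' : b ≤ 6 * t) :
      |Real.exp (-ξ ^ 2 / 2) ^ 4 * (Real.exp (-b) - (1 - b + b ^ 2 / 2))| ≤ 216 * t ^ 3 := by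
    refine (abs_weighted_taylor_le h).trans ?_
    calc |b| ^ 3 ≤ (6 * t) ^ 3 := by gcongr; exact abs_le.2 ⟨hb, hb'⟩
      _ = 216 * t ^ 3 := by ring
  have t1 := abs_le.1 (taylor hab (by linarith) (by linarith))
  have t2 := abs_le.1 (taylor hac (by linarith) (by linarith))
  have t3 := abs_le.1 (taylor had (by linarith) (by linarith))
  have t4 := abs_le.1 (taylor hbc (by linarith) (by linarith))
  have t5 := abs_le.1 (taylor hbd (by linarith) (by linarith))
  have t6 := abs_le.1 (taylor hcd (by linarith) (by linarith))
  have t7 := abs_le.1 (taylor habc (by linarith) (by linarith))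
  have t8 := abs_le.1 (taylor habd (by linarith) (by linarith))
  have t9 := abs_le.1 (taylor hacd (by linarith) (by linarith))
  have t10 := abs_le.1 (taylor hbcd (by linarith) (by linarith))
  have t11 := abs_le.1 (taylor hall (by linarith) (by linarith))
  rw [← ht, altExp]
  generalize Real.exp (-ξ ^ 2 / 2) ^ 4 = m at *
  rw [abs_le]
  constructor <;> linarith

/-- For weights coming from unit vectors, the lower bounds on partial sums of weights are the
nonnegativity of `‖∑ uᵢ‖²`. -/
lemma abs_altExp_inner_sub_le {E : Type*} [NormedAddCommGroup E] [InnerProductSpace ℝ E]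
    {u v w z : E} (hu : ‖u‖ = 1) (hv : ‖v‖ = 1) (hw : ‖w‖ = 1)
    (hz : ‖z‖ = 1) (ξ : ℝ) :
    |Real.exp (-ξ ^ 2 / 2) ^ 4 * altExp (ξ ^ 2 * ⟪u, v⟫) (ξ ^ 2 * ⟪u, w⟫) (ξ ^ 2 * ⟪u, z⟫)
        (ξ ^ 2 * ⟪v, w⟫) (ξ ^ 2 * ⟪v, z⟫) (ξ ^ 2 * ⟪w, z⟫) -
      Real.exp (-ξ ^ 2 / 2) ^ 4 * (ξ ^ 4 * (⟪u, v⟫ * ⟪w, z⟫ + ⟪u, w⟫ * ⟪v, z⟫ +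
        ⟪u, z⟫ * ⟪v, w⟫))| ≤
      2376 * (ξ ^ 6 * cubeSum ⟪u, v⟫ ⟪u, w⟫ ⟪u, z⟫ ⟪v, w⟫ ⟪v, z⟫ ⟪w, z⟫) := by
  have hξ : 0 ≤ ξ ^ 2 := sq_nonneg ξ
  have n2 {a b : E} (ha : ‖a‖ = 1) (hb : ‖b‖ = 1) : 0 ≤ 2 + 2 * ⟪a, b⟫ := by
    have h := norm_add_sq_real a b
    rw [ha, hb] at h
    nlinarith [sq_nonneg ‖a + b‖]
  have n3 {a b c : E} (ha : ‖a‖ = 1) (hb : ‖b‖ = 1) (hc : ‖c‖ = 1) :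
      0 ≤ 3 + 2 * (⟪a, b⟫ + ⟪a, c⟫ + ⟪b, c⟫) := by
    have h := norm_add_sq_real (a + b) c
    rw [norm_add_sq_real a b, inner_add_left, ha, hb, hc] at h
    nlinarith [sq_nonneg ‖a + b + c‖]
  have n4 : 0 ≤ 4 + 2 * (⟪u, v⟫ + ⟪u, w⟫ + ⟪u, z⟫ + ⟪v, w⟫ + ⟪v, z⟫ + ⟪w, z⟫) := by
    have h := norm_add_sq_real (u + v + w) z
    rw [norm_add_sq_real (u + v) w, norm_add_sq_real u v, inner_add_left, inner_add_left,
      inner_add_left, hu, hv, hw, hz] at h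
    nlinarith [sq_nonneg ‖u + v + w + z‖]
  have h := abs_weighted_altExp_sub_le (ξ := ξ) (ab := ξ ^ 2 * ⟪u, v⟫) (ac := ξ ^ 2 * ⟪u, w⟫)
    (ad := ξ ^ 2 * ⟪u, z⟫) (bc := ξ ^ 2 * ⟪v, w⟫) (bd := ξ ^ 2 * ⟪v, z⟫) (cd := ξ ^ 2 * ⟪w, z⟫)
    (by nlinarith [mul_nonneg hξ (n2 hu hv)]) (by nlinarith [mul_nonneg hξ (n2 hu hw)])
    (by nlinarith [mul_nonneg hξ (n2 hu hz)]) (by nlinarith [mul_nonneg hξ (n2 hv hw)])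
    (by nlinarith [mul_nonneg hξ (n2 hv hz)]) (by nlinarith [mul_nonneg hξ (n2 hw hz)])
    (by nlinarith [mul_nonneg hξ (n3 hu hv hw)]) (by nlinarith [mul_nonneg hξ (n3 hu hv hz)])
    (by nlinarith [mul_nonneg hξ (n3 hu hw hz)]) (by nlinarith [mul_nonneg hξ (n3 hv hw hz)])
    (by nlinarith [mul_nonneg hξ n4])
  have e1 : ξ ^ 2 * ⟪u, v⟫ * (ξ ^ 2 * ⟪w, z⟫) + ξ ^ 2 * ⟪u, w⟫ * (ξ ^ 2 * ⟪v, z⟫) +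
      ξ ^ 2 * ⟪u, z⟫ * (ξ ^ 2 * ⟪v, w⟫) =
      ξ ^ 4 * (⟪u, v⟫ * ⟪w, z⟫ + ⟪u, w⟫ * ⟪v, z⟫ + ⟪u, z⟫ * ⟪v, w⟫) := by ring
  have e2 : cubeSum (ξ ^ 2 * ⟪u, v⟫) (ξ ^ 2 * ⟪u, w⟫) (ξ ^ 2 * ⟪u, z⟫) (ξ ^ 2 * ⟪v, w⟫)
      (ξ ^ 2 * ⟪v, z⟫) (ξ ^ 2 * ⟪w, z⟫) =
      ξ ^ 6 * cubeSum ⟪u, v⟫ ⟪u, w⟫ ⟪u, z⟫ ⟪v, w⟫ ⟪v, z⟫ ⟪w, z⟫ := by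
    simp only [cubeSum, abs_mul, abs_of_nonneg hξ]
    ring
  rwa [e1, e2] at h

section Replicas

variable {E : Type*} [NormedAddCommGroup E] [InnerProductSpace ℝ E] [FiniteDimensional ℝ E]
  [MeasurableSpace E] [BorelSpace E]

/-- Four-replica estimate: after centring, the joint moment of four cosines is of third order in
the overlaps. The terms of order at most one cancel in the alternating sum, and those of order two
cancel upon averaging over the signs of the replicas. -/
theorem abs_integral_prod_cos_le {u v w z : E} (hu : ‖u‖ = 1) (hv : ‖v‖ = 1) (hw : ‖w‖ = 1)
    (hz : ‖z‖ = 1) (ξ : ℝ) :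
    |∫ x, (Real.cos (ξ * ⟪u, x⟫) - Real.exp (-ξ ^ 2 / 2)) *
        (Real.cos (ξ * ⟪v, x⟫) - Real.exp (-ξ ^ 2 / 2)) *
        (Real.cos (ξ * ⟪w, x⟫) - Real.exp (-ξ ^ 2 / 2)) *
        (Real.cos (ξ * ⟪z, x⟫) - Real.exp (-ξ ^ 2 / 2)) ∂(stdGaussian E)| ≤
      2376 * (ξ ^ 6 * cubeSum ⟪u, v⟫ ⟪u, w⟫ ⟪u, z⟫ ⟪v, w⟫ ⟪v, z⟫ ⟪w, z⟫) := by
  set m := Real.exp (-ξ ^ 2 / 2) with hm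
  have hi (a b c d : E) : Integrable (fun x => quadCos m (ξ * ⟪a, x⟫) (ξ * ⟪b, x⟫) (ξ * ⟪c, x⟫)
      (ξ * ⟪d, x⟫)) (stdGaussian E) := by
    have hc (y : E) : Integrable (fun x => Real.cos (ξ * ⟪y, x⟫)) (stdGaussian E) :=
      Integrable.of_bound (by fun_prop) 1 (Eventually.of_forall fun x => by
        rw [Real.norm_eq_abs]; exact Real.abs_cos_le_one _)
    simp only [quadCos, ← mul_add, ← inner_add_left]
    exact ((((hc _).sub (((((hc _).add (hc _)).add (hc _)).add (hc _)).const_mul m)).add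
      (((((((hc _).add (hc _)).add (hc _)).add (hc _)).add (hc _)).add
        (hc _)).const_mul (m ^ 2))).sub
      (((((hc _).add (hc _)).add (hc _)).add (hc _)).const_mul (m ^ 3))).add (integrable_const _)
  have e (x : E) : (Real.cos (ξ * ⟪u, x⟫) - m) * (Real.cos (ξ * ⟪v, x⟫) - m) *
        (Real.cos (ξ * ⟪w, x⟫) - m) * (Real.cos (ξ * ⟪z, x⟫) - m) =
      (quadCos m (ξ * ⟪u, x⟫) (ξ * ⟪v, x⟫) (ξ * ⟪w, x⟫) (ξ * ⟪z, x⟫)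
      + quadCos m (ξ * ⟪u, x⟫) (ξ * ⟪v, x⟫) (ξ * ⟪w, x⟫) (ξ * ⟪-z, x⟫)
      + quadCos m (ξ * ⟪u, x⟫) (ξ * ⟪v, x⟫) (ξ * ⟪-w, x⟫) (ξ * ⟪z, x⟫)
      + quadCos m (ξ * ⟪u, x⟫) (ξ * ⟪v, x⟫) (ξ * ⟪-w, x⟫) (ξ * ⟪-z, x⟫)
      + quadCos m (ξ * ⟪u, x⟫) (ξ * ⟪-v, x⟫) (ξ * ⟪w, x⟫) (ξ * ⟪z, x⟫)
      + quadCos m (ξ * ⟪u, x⟫) (ξ * ⟪-v, x⟫) (ξ * ⟪w, x⟫) (ξ * ⟪-z, x⟫)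
      + quadCos m (ξ * ⟪u, x⟫) (ξ * ⟪-v, x⟫) (ξ * ⟪-w, x⟫) (ξ * ⟪z, x⟫)
      + quadCos m (ξ * ⟪u, x⟫) (ξ * ⟪-v, x⟫) (ξ * ⟪-w, x⟫) (ξ * ⟪-z, x⟫)) / 8 := by
    rw [prod_cos_sub_eq]
    simp only [inner_neg_left, mul_neg]
  have hv' : ‖-v‖ = 1 := by rw [norm_neg, hv]
  have hw' : ‖-w‖ = 1 := by rw [norm_neg, hw]
  have hz' : ‖-z‖ = 1 := by rw [norm_neg, hz]
  have add {f g : E → ℝ} {I J : ℝ}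
      (hf : Integrable f (stdGaussian E) ∧ ∫ x, f x ∂(stdGaussian E) = I)
      (hg : Integrable g (stdGaussian E) ∧ ∫ x, g x ∂(stdGaussian E) = J) :
      Integrable (fun x => f x + g x) (stdGaussian E) ∧
        ∫ x, (f x + g x) ∂(stdGaussian E) = I + J :=
    ⟨hf.1.add hg.1, by rw [integral_add hf.1 hg.1, hf.2, hg.2]⟩
  simp_rw [e]
  rw [integral_div, (add (add (add (add (add (add (add
    ⟨hi _ _ _ _, integral_quadCos hu hv hw hz ξ⟩ ⟨hi _ _ _ _, integral_quadCos hu hv hw hz' ξ⟩)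
    ⟨hi _ _ _ _, integral_quadCos hu hv hw' hz ξ⟩) ⟨hi _ _ _ _, integral_quadCos hu hv hw' hz' ξ⟩)
    ⟨hi _ _ _ _, integral_quadCos hu hv' hw hz ξ⟩) ⟨hi _ _ _ _, integral_quadCos hu hv' hw hz' ξ⟩)
    ⟨hi _ _ _ _, integral_quadCos hu hv' hw' hz ξ⟩)
    ⟨hi _ _ _ _, integral_quadCos hu hv' hw' hz' ξ⟩).2]
  have b1 := abs_le.1 (abs_altExp_inner_sub_le hu hv hw hz ξ)
  have b2 := abs_le.1 (abs_altExp_inner_sub_le hu hv hw hz' ξ)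
  have b3 := abs_le.1 (abs_altExp_inner_sub_le hu hv hw' hz ξ)
  have b4 := abs_le.1 (abs_altExp_inner_sub_le hu hv hw' hz' ξ)
  have b5 := abs_le.1 (abs_altExp_inner_sub_le hu hv' hw hz ξ)
  have b6 := abs_le.1 (abs_altExp_inner_sub_le hu hv' hw hz' ξ)
  have b7 := abs_le.1 (abs_altExp_inner_sub_le hu hv' hw' hz ξ)
  have b8 := abs_le.1 (abs_altExp_inner_sub_le hu hv' hw' hz' ξ)
  simp only [inner_neg_left, inner_neg_right, neg_neg, mul_neg, neg_mul, cubeSum, abs_neg]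
    at b1 b2 b3 b4 b5 b6 b7 b8 ⊢
  rw [← hm] at b1 b2 b3 b4 b5 b6 b7 b8
  rw [abs_le]
  constructor <;> linarith

lemma sum_pow_four {ι : Type*} (D : Finset ι) (f : ι → ℝ) :
    (∑ a ∈ D, f a) ^ 4 = ∑ a ∈ D, ∑ b ∈ D, ∑ c ∈ D, ∑ d ∈ D, f a * f b * f c * f d := by
  simp_rw [← Finset.mul_sum, ← Finset.sum_mul, ← Finset.mul_sum, ← Finset.sum_mul,
    ← Finset.mul_sum, ← Finset.sum_mul]
  ring

/-- The fourth moment of the centred sum of cosines. The constant is `6 · 2376`: each of the six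
pairs of replicas gives the same sum. -/
lemma integral_sum_cos_pow_four_le {ι : Type*} (D : Finset ι) (w : ι → E)
    (hw : ∀ i, ‖w i‖ = 1) (ξ : ℝ) :
    ∫ x, (∑ i ∈ D, (Real.cos (ξ * ⟪w i, x⟫) - Real.exp (-ξ ^ 2 / 2))) ^ 4 ∂(stdGaussian E) ≤
      14256 * ξ ^ 6 * (D.card : ℝ) ^ 2 * ∑ i ∈ D, ∑ j ∈ D, |⟪w i, w j⟫| ^ 3 := by
  have hc (y : E) (x : E) : ‖Real.cos (ξ * ⟪y, x⟫) - Real.exp (-ξ ^ 2 / 2)‖ ≤ 2 := by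
    rw [Real.norm_eq_abs]
    have h1 := Real.abs_cos_le_one (ξ * ⟪y, x⟫)
    have h2 : Real.exp (-ξ ^ 2 / 2) ≤ 1 := Real.exp_le_one_iff.2 (by nlinarith [sq_nonneg ξ])
    have h3 := Real.exp_pos (-ξ ^ 2 / 2)
    rw [abs_le] at h1 ⊢
    constructor <;> linarith
  have hi (a b c d : ι) : Integrable (fun x => (Real.cos (ξ * ⟪w a, x⟫) - Real.exp (-ξ ^ 2 / 2)) *
        (Real.cos (ξ * ⟪w b, x⟫) - Real.exp (-ξ ^ 2 / 2)) *
        (Real.cos (ξ * ⟪w c, x⟫) - Real.exp (-ξ ^ 2 / 2)) *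
        (Real.cos (ξ * ⟪w d, x⟫) - Real.exp (-ξ ^ 2 / 2))) (stdGaussian E) := by
    refine Integrable.of_bound (by fun_prop) (2 * 2 * 2 * 2) (Eventually.of_forall fun x => ?_)
    rw [norm_mul, norm_mul, norm_mul]
    gcongr <;> exact hc _ _
  simp_rw [sum_pow_four]
  rw [integral_finsetSum _ fun a _ => integrable_finsetSum _ fun b _ => integrable_finsetSum _
    fun c _ => integrable_finsetSum _ fun d _ => hi a b c d]
  have h1 : ∀ a ∈ D, ∫ x, ∑ b ∈ D, ∑ c ∈ D, ∑ d ∈ D,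
      (Real.cos (ξ * ⟪w a, x⟫) - Real.exp (-ξ ^ 2 / 2)) *
        (Real.cos (ξ * ⟪w b, x⟫) - Real.exp (-ξ ^ 2 / 2)) *
        (Real.cos (ξ * ⟪w c, x⟫) - Real.exp (-ξ ^ 2 / 2)) *
        (Real.cos (ξ * ⟪w d, x⟫) - Real.exp (-ξ ^ 2 / 2)) ∂(stdGaussian E) ≤
      ∑ b ∈ D, ∑ c ∈ D, ∑ d ∈ D, 2376 * (ξ ^ 6 * cubeSum ⟪w a, w b⟫ ⟪w a, w c⟫ ⟪w a, w d⟫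
        ⟪w b, w c⟫ ⟪w b, w d⟫ ⟪w c, w d⟫) := by
    intro a _
    rw [integral_finsetSum _ fun b _ => integrable_finsetSum _
      fun c _ => integrable_finsetSum _ fun d _ => hi a b c d]
    refine Finset.sum_le_sum fun b _ => ?_
    rw [integral_finsetSum _ fun c _ => integrable_finsetSum _ fun d _ => hi a b c d]
    refine Finset.sum_le_sum fun c _ => ?_
    rw [integral_finsetSum _ fun d _ => hi a b c d]
    exact Finset.sum_le_sum fun d _ => (le_abs_self _).trans
      (abs_integral_prod_cos_le (hw a) (hw b) (hw c) (hw d) ξ)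
  refine (Finset.sum_le_sum h1).trans (le_of_eq ?_)
  simp only [cubeSum, mul_add, Finset.sum_add_distrib, Finset.sum_const, nsmul_eq_mul,
    ← Finset.mul_sum]
  ring

end Replicas

/-! ### Slices by a random slab -/

lemma integral_cos_gaussianReal (t : ℝ) :
    ∫ η, Real.cos (t * η) ∂(gaussianReal 0 1) = Real.exp (-t ^ 2 / 2) := by
  obtain ⟨hu, -, -⟩ := exists_unit_pair (ρ := 0) (by simp)
  have h := integral_cos_inner_stdGaussian (t • (!₂[1, 0] : EuclideanSpace ℝ (Fin 2)))
  rw [← map_inner_stdGaussian hu, integral_map (by fun_prop) (by fun_prop)]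
  simpa only [inner_smul_left, RCLike.conj_to_real, norm_smul, hu, mul_one, Real.norm_eq_abs,
    sq_abs] using h

/-- The Laplace-type average `𝔼 exp (-(sη)²/2)` over a standard Gaussian `η`. -/
noncomputable def gaussAvg (s : ℝ) : ℝ := ∫ η, Real.exp (-(s * η) ^ 2 / 2) ∂(gaussianReal 0 1)

lemma integrable_exp_neg_sq (s : ℝ) :
    Integrable (fun η => Real.exp (-(s * η) ^ 2 / 2)) (gaussianReal 0 1) :=
  Integrable.of_bound (by fun_prop) 1 (Eventually.of_forall fun x => by
    rw [Real.norm_eq_abs, Real.abs_exp]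
    exact Real.exp_le_one_iff.2 (by nlinarith [sq_nonneg (s * x)]))

/-- The average is at least the contribution of `|η| ≤ δ`. -/
lemma exp_mul_p_le_gaussAvg (s δ : ℝ) :
    Real.exp (-(s ^ 2 * δ ^ 2) / 2) * p δ ≤ gaussAvg s := by
  have hm : MeasurableSet {z : ℝ | |z| ≤ δ} := measurableSet_le (by fun_prop) (by fun_prop)
  rw [p, ← integral_indicator_one hm, ← integral_const_mul, gaussAvg]
  refine integral_mono (((integrable_const (1 : ℝ)).indicator hm).const_mul _)
    (integrable_exp_neg_sq s) fun z => ?_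
  by_cases hz : |z| ≤ δ
  · have h1 : z ∈ {z : ℝ | |z| ≤ δ} := hz
    simp only [Set.indicator_of_mem h1, Pi.one_apply, mul_one]
    refine Real.exp_le_exp.2 ?_
    have : z ^ 2 ≤ δ ^ 2 := by rw [← sq_abs z]; gcongr
    nlinarith [mul_le_mul_of_nonneg_left this (sq_nonneg s)]
  · have h1 : z ∉ {z : ℝ | |z| ≤ δ} := hz
    simp only [Set.indicator_of_notMem h1, mul_zero]
    positivity

lemma gaussAvg_pos (s : ℝ) : 0 < gaussAvg s :=
  lt_of_lt_of_le (mul_pos (Real.exp_pos _) (p_pos one_pos)) (exp_mul_p_le_gaussAvg s 1)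

/-- A sharp enough Gaussian bump has more mass near the origin than height outside the slab. -/
lemma exists_bump {κ : ℝ} (hκ : 0 < κ) :
    ∃ s : ℝ, Real.exp (-(s ^ 2 * κ ^ 2) / 2) < gaussAvg s / 2 := by
  have hp := p_pos (half_pos hκ)
  have hp1 := p_lt_one (κ / 2)
  set t : ℝ := 1 - Real.log (p (κ / 2) / 2) with ht
  have ht0 : 0 < t := by
    have := Real.log_neg (by positivity : 0 < p (κ / 2) / 2) (by linarith)
    linarith
  refine ⟨√(8 * t / (3 * κ ^ 2)), ?_⟩
  have h1 := exp_mul_p_le_gaussAvg (√(8 * t / (3 * κ ^ 2))) (κ / 2)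
  rw [Real.sq_sqrt (by positivity)] at h1 ⊢
  have e1 : -(8 * t / (3 * κ ^ 2) * (κ / 2) ^ 2) / 2 = -(t / 3) := by field_simp; norm_num
  have e2 : -(8 * t / (3 * κ ^ 2) * κ ^ 2) / 2 = -(t / 3) + -t := by field_simp; norm_num
  rw [e1] at h1
  rw [e2, Real.exp_add]
  have h2 : Real.exp (-t) < p (κ / 2) / 2 := by
    rw [← Real.lt_log_iff_exp_lt (by positivity)]
    linarith
  have h3 := mul_lt_mul_of_pos_left h2 (Real.exp_pos (-(t / 3)))
  linarith

lemma integrable_pow_gaussianReal (n : ℕ) :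
    Integrable (fun η : ℝ => η ^ n) (gaussianReal 0 1) := by
  have h := (memLp_id_gaussianReal (μ := 0) (v := 1) (n : NNReal)).integrable_norm_pow'
  refine h.mono (by fun_prop) (Eventually.of_forall fun x => ?_)
  simp

/-- Finite sets of indices carry the discrete σ-algebra. -/
instance {ι : Type*} : MeasurableSpace (Finset ι) := ⊤

instance {ι : Type*} : DiscreteMeasurableSpace (Finset ι) := ⟨fun _ => trivial⟩

section Slice

variable {E : Type*} [NormedAddCommGroup E] [InnerProductSpace ℝ E] {ι : Type*}

/-- The indices in `D` whose vector satisfies the slab constraint given by `x`. -/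
noncomputable def slice (κ : ℝ) (w : ι → E) (D : Finset ι) (x : E) : Finset ι :=
  D.filter fun i => |⟪w i, x⟫| ≤ κ

lemma slice_subset (κ : ℝ) (w : ι → E) (D : Finset ι) (x : E) : slice κ w D x ⊆ D :=
  Finset.filter_subset _ _

lemma slice_empty (κ : ℝ) (w : ι → E) (x : E) : slice κ w ∅ x = ∅ := by simp [slice]

lemma card_slice_le (κ : ℝ) (w : ι → E) (D : Finset ι) (x : E) :
    ((slice κ w D x).card : ℝ) ≤ D.card :=
  Nat.cast_le.2 (Finset.card_le_card (slice_subset κ w D x))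

lemma card_slice (κ : ℝ) (w : ι → E) (D : Finset ι) (x : E) :
    ((slice κ w D x).card : ℝ) = ∑ i ∈ D, {y | |⟪w i, y⟫| ≤ κ}.indicator 1 x := by
  rw [slice, Finset.card_filter]
  push_cast
  simp [Set.indicator_apply]

variable [MeasurableSpace E] [BorelSpace E]

lemma measurableSet_slab_inner [SecondCountableTopology E] (κ : ℝ) (v : E) :
    MeasurableSet {y : E | |⟪v, y⟫| ≤ κ} := measurableSet_le (by fun_prop) (by fun_prop)

lemma measurable_card_slice [SecondCountableTopology E] (κ : ℝ) (w : ι → E) (D : Finset ι) :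
    Measurable fun x => ((slice κ w D x).card : ℝ) := by
  simp_rw [card_slice]
  exact Finset.measurable_fun_sum _ fun i _ =>
    measurable_one.indicator (measurableSet_slab_inner κ _)

lemma measurable_slice [SecondCountableTopology E] [Finite ι] (κ : ℝ) (w : ι → E)
    (D : Finset ι) : Measurable (slice κ w D) := by
  classical
  refine measurable_to_countable' fun S => ?_
  have e : slice κ w D ⁻¹' {S} = ⋂ i, {x | i ∈ S ↔ i ∈ D ∧ x ∈ {y | |⟪w i, y⟫| ≤ κ}} := by
    ext x
    simp [slice, Finset.ext_iff, iff_comm]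
  rw [e]
  refine MeasurableSet.iInter fun i => ?_
  exact (MeasurableSet.const _).iff ((MeasurableSet.const _).inter
    (measurableSet_slab_inner κ (w i)))

lemma integrable_comp_slice [SecondCountableTopology E] [Finite ι] (μ : Measure E)
    [IsFiniteMeasure μ] (κ : ℝ) (w : ι → E) (D : Finset ι) (g : Finset ι → ℝ) :
    Integrable (fun x => g (slice κ w D x)) μ :=
  Integrable.comp_measurable (g := g) Integrable.of_finite (measurable_slice κ w D)

variable [FiniteDimensional ℝ E]

/-- The fourth moment of the centred sum of Gaussian bumps: a bump is an average of cosines, so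
the four-replica estimate applies through Jensen's inequality. -/
lemma integral_bump_pow_four_le (D : Finset ι) (w : ι → E) (hw : ∀ i, ‖w i‖ = 1) (s : ℝ) :
    ∫ x, (∑ i ∈ D, (Real.exp (-(s * ⟪w i, x⟫) ^ 2 / 2) - gaussAvg s)) ^ 4 ∂(stdGaussian E) ≤
      14256 * s ^ 6 * (∫ η, η ^ 6 ∂(gaussianReal 0 1)) * (D.card : ℝ) ^ 2 *
        ∑ i ∈ D, ∑ j ∈ D, |⟪w i, w j⟫| ^ 3 := by
  let G : E → ℝ → ℝ := fun x η =>
    ∑ i ∈ D, (Real.cos ((s * η) * ⟪w i, x⟫) - Real.exp (-(s * η) ^ 2 / 2))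
  have hGm : Measurable (Function.uncurry G) := by
    refine Continuous.measurable ?_
    change Continuous fun z : E × ℝ => ∑ i ∈ D, (Real.cos ((s * z.2) * ⟪w i, z.1⟫) -
      Real.exp (-(s * z.2) ^ 2 / 2))
    fun_prop
  have hGb (x : E) (η : ℝ) : |G x η| ≤ D.card * 2 := by
    refine (Finset.abs_sum_le_sum_abs _ _).trans ?_
    rw [← nsmul_eq_mul]
    refine Finset.sum_le_card_nsmul _ _ _ fun i _ => ?_
    have h1 := abs_le.1 (Real.abs_cos_le_one ((s * η) * ⟪w i, x⟫))
    have h2 : Real.exp (-(s * η) ^ 2 / 2) ≤ 1 :=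
      Real.exp_le_one_iff.2 (by nlinarith [sq_nonneg (s * η)])
    have h3 := Real.exp_pos (-(s * η) ^ 2 / 2)
    rw [abs_le]
    constructor <;> linarith
  have hG4b (x : E) (η : ℝ) : ‖G x η ^ 4‖ ≤ (D.card * 2) ^ 4 := by
    rw [norm_pow, Real.norm_eq_abs]
    gcongr
    exact hGb x η
  have hGi (x : E) : Integrable (G x) (gaussianReal 0 1) :=
    Integrable.of_bound (hGm.of_uncurry_left (x := x)).aestronglyMeasurable _
      (Eventually.of_forall fun η => hGb x η)
  have hG4i (x : E) : Integrable (fun η => G x η ^ 4) (gaussianReal 0 1) :=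
    Integrable.of_bound ((hGm.of_uncurry_left (x := x)).pow_const 4).aestronglyMeasurable _
      (Eventually.of_forall fun η => hG4b x η)
  have hG4p : Integrable (Function.uncurry fun x η => G x η ^ 4)
      ((stdGaussian E).prod (gaussianReal 0 1)) :=
    Integrable.of_bound (hGm.pow_const 4).aestronglyMeasurable _
      (Eventually.of_forall fun z => hG4b z.1 z.2)
  have hrep (x : E) : ∑ i ∈ D, (Real.exp (-(s * ⟪w i, x⟫) ^ 2 / 2) - gaussAvg s) =
      ∫ η, G x η ∂(gaussianReal 0 1) := by
    have hcos (i : ι) : Integrable (fun η => Real.cos ((s * η) * ⟪w i, x⟫)) (gaussianReal 0 1) :=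
      Integrable.of_bound (by fun_prop) 1 (Eventually.of_forall fun η => by
        rw [Real.norm_eq_abs]; exact Real.abs_cos_le_one _)
    change _ = ∫ η, ∑ i ∈ D, (Real.cos ((s * η) * ⟪w i, x⟫) - Real.exp (-(s * η) ^ 2 / 2))
      ∂(gaussianReal 0 1)
    have hi (i : ι) : Integrable (fun η => Real.cos ((s * η) * ⟪w i, x⟫) -
      Real.exp (-(s * η) ^ 2 / 2)) (gaussianReal 0 1) := (hcos i).sub (integrable_exp_neg_sq s)
    rw [integral_finsetSum _ fun i _ => hi i]
    refine Finset.sum_congr rfl fun i _ => ?_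
    rw [integral_sub (hcos i) (integrable_exp_neg_sq s), ← integral_cos_gaussianReal, gaussAvg]
    congr 2
    funext η
    ring_nf
  have hjensen (x : E) :
      (∑ i ∈ D, (Real.exp (-(s * ⟪w i, x⟫) ^ 2 / 2) - gaussAvg s)) ^ 4 ≤
        ∫ η, G x η ^ 4 ∂(gaussianReal 0 1) := by
    rw [hrep]
    exact (Even.convexOn_pow (n := 4) (by decide)).map_integral_le (by fun_prop) isClosed_univ
      (Eventually.of_forall fun _ => Set.mem_univ _) (hGi x) (hG4i x)
  calc _ ≤ ∫ x, ∫ η, G x η ^ 4 ∂(gaussianReal 0 1) ∂(stdGaussian E) :=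
        integral_mono_of_nonneg (Eventually.of_forall fun x => by positivity)
          hG4p.integral_prod_left (Eventually.of_forall hjensen)
    _ = ∫ η, ∫ x, G x η ^ 4 ∂(stdGaussian E) ∂(gaussianReal 0 1) := integral_integral_swap hG4p
    _ ≤ ∫ η, η ^ 6 * (14256 * s ^ 6 * (D.card : ℝ) ^ 2 *
          ∑ i ∈ D, ∑ j ∈ D, |⟪w i, w j⟫| ^ 3) ∂(gaussianReal 0 1) := by
        refine integral_mono_of_nonneg (Eventually.of_forall fun η =>
          integral_nonneg fun x => by positivity)
          ((integrable_pow_gaussianReal 6).mul_const _) (Eventually.of_forall fun η => ?_)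
        refine (integral_sum_cos_pow_four_le D w hw (s * η)).trans (le_of_eq ?_)
        ring
    _ = _ := by
        rw [integral_mul_const]
        ring

/-- Small-ball estimate: a slab through a nearly orthogonal family of unit vectors is unlikely to
contain only a small fraction of them. -/
lemma measureReal_card_slice_lt_le {κ s c : ℝ} (hκ : 0 ≤ κ)
    (hc : c ≤ gaussAvg s / 2 - Real.exp (-(s ^ 2 * κ ^ 2) / 2)) (D : Finset ι)
    (hD : D.Nonempty) (w : ι → E) (hw : ∀ i, ‖w i‖ = 1) :
    (stdGaussian E).real {x | ((slice κ w D x).card : ℝ) < c * D.card} ≤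
      14256 * s ^ 6 * (∫ η, η ^ 6 ∂(gaussianReal 0 1)) / (gaussAvg s / 2) ^ 4 *
        ((∑ i ∈ D, ∑ j ∈ D, |⟪w i, w j⟫| ^ 3) / (D.card : ℝ) ^ 2) := by
  have hm := gaussAvg_pos s
  have hD0 : (0 : ℝ) < D.card := Nat.cast_pos.2 hD.card_pos
  set e := Real.exp (-(s ^ 2 * κ ^ 2) / 2) with he
  set h : E → ℝ := fun x => ∑ i ∈ D, (Real.exp (-(s * ⟪w i, x⟫) ^ 2 / 2) - gaussAvg s) with hh
  have hsub : {x | ((slice κ w D x).card : ℝ) < c * D.card} ⊆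
      {x | (gaussAvg s / 2 * D.card) ^ 4 ≤ h x ^ 4} := by
    intro x hx
    rw [Set.mem_ofPred_eq] at hx ⊢
    -- the bump is at most `1` on the slab and at most `e` off it
    have h1 : ∑ i ∈ D, Real.exp (-(s * ⟪w i, x⟫) ^ 2 / 2) ≤
        (slice κ w D x).card + e * D.card := by
      rw [card_slice, mul_comm e, ← nsmul_eq_mul, ← Finset.sum_const, ← Finset.sum_add_distrib]
      refine Finset.sum_le_sum fun i _ => ?_
      have h0 : 0 < e := Real.exp_pos _
      by_cases hi : |⟪w i, x⟫| ≤ κ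
      · have h2 : Real.exp (-(s * ⟪w i, x⟫) ^ 2 / 2) ≤ 1 :=
          Real.exp_le_one_iff.2 (by nlinarith [sq_nonneg (s * ⟪w i, x⟫)])
        rw [Set.indicator_of_mem (by exact hi)]
        simp only [Pi.one_apply]
        linarith
      · rw [Set.indicator_of_notMem (by exact hi), zero_add]
        refine Real.exp_le_exp.2 ?_
        have h3 : κ ^ 2 ≤ ⟪w i, x⟫ ^ 2 := by
          rw [← sq_abs ⟪w i, x⟫]
          have := (not_le.1 hi).le
          gcongr
        nlinarith [mul_le_mul_of_nonneg_left h3 (sq_nonneg s)]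
    have h2 : h x ≤ -(gaussAvg s / 2 * D.card) := by
      have h3 : h x = ∑ i ∈ D, Real.exp (-(s * ⟪w i, x⟫) ^ 2 / 2) - D.card * gaussAvg s := by
        simp [hh, Finset.sum_sub_distrib]
      have h4 := mul_le_mul_of_nonneg_right hc hD0.le
      linarith
    rw [← Even.neg_pow (n := 4) (by decide) (h x)]
    exact pow_le_pow_left₀ (by positivity) (by linarith) 4
  have hmark := mul_meas_ge_le_integral_of_nonneg (μ := stdGaussian E) (f := fun x => h x ^ 4)
    (Eventually.of_forall fun x => by positivity)
    (Integrable.of_bound (C := (D.card : ℝ) ^ 4 * (1 + gaussAvg s) ^ 4)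
      (by fun_prop) (Eventually.of_forall fun x => by
      rw [norm_pow, Real.norm_eq_abs, ← mul_pow]
      gcongr
      refine (Finset.abs_sum_le_sum_abs _ _).trans ?_
      rw [← nsmul_eq_mul]
      refine Finset.sum_le_card_nsmul _ _ _ fun i _ => ?_
      have h2 : Real.exp (-(s * ⟪w i, x⟫) ^ 2 / 2) ≤ 1 :=
        Real.exp_le_one_iff.2 (by nlinarith [sq_nonneg (s * ⟪w i, x⟫)])
      have h3 := Real.exp_pos (-(s * ⟪w i, x⟫) ^ 2 / 2)
      rw [abs_le]
      constructor <;> linarith)) ((gaussAvg s / 2 * D.card) ^ 4)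
  have h5 := hmark.trans (integral_bump_pow_four_le D w hw s)
  have h6 := measureReal_mono (μ := stdGaussian E) hsub
  refine h6.trans ?_
  rw [← le_div_iff₀' (by positivity)] at h5
  refine h5.trans (le_of_eq ?_)
  field_simp

/-- The variance of the fraction of vectors in a random slab is at most the mean square
overlap. -/
lemma integral_card_slice_sub_sq_le {κ : ℝ} (hκ : 0 < κ) (D : Finset ι) (w : ι → E)
    (hw : ∀ i, ‖w i‖ = 1) :
    ∫ x, ((D.card : ℝ) * p κ - (slice κ w D x).card) ^ 2 ∂(stdGaussian E) ≤
      (2 * κ ^ 2 + 4) * ∑ i ∈ D, ∑ j ∈ D, ⟪w i, w j⟫ ^ 2 := by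
  have hms := fun i => measurableSet_slab_inner (E := E) κ (w i)
  have e1 (x : E) : ((D.card : ℝ) * p κ - (slice κ w D x).card) ^ 2 =
      ∑ i ∈ D, ∑ j ∈ D, (p κ - {y | |⟪w i, y⟫| ≤ κ}.indicator 1 x) *
        (p κ - {y | |⟪w j, y⟫| ≤ κ}.indicator 1 x) := by
    rw [← Finset.sum_mul_sum, ← sq, card_slice, Finset.sum_sub_distrib, Finset.sum_const,
      nsmul_eq_mul]
  have hind (i : ι) : Integrable ({y | |⟪w i, y⟫| ≤ κ}.indicator (1 : E → ℝ)) (stdGaussian E) :=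
    (integrable_const (1 : ℝ)).indicator (hms i)
  have hindj (i j : ι) : Integrable (({y | |⟪w i, y⟫| ≤ κ} ∩ {y | |⟪w j, y⟫| ≤ κ}).indicator
      (1 : E → ℝ)) (stdGaussian E) :=
    (integrable_const (1 : ℝ)).indicator ((hms i).inter (hms j))
  have e2 (i j : ι) (x : E) : (p κ - {y | |⟪w i, y⟫| ≤ κ}.indicator 1 x) *
        (p κ - {y | |⟪w j, y⟫| ≤ κ}.indicator 1 x) =
      p κ ^ 2 - p κ * {y | |⟪w i, y⟫| ≤ κ}.indicator 1 x
        - p κ * {y | |⟪w j, y⟫| ≤ κ}.indicator 1 x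
        + ({y | |⟪w i, y⟫| ≤ κ} ∩ {y | |⟪w j, y⟫| ≤ κ}).indicator 1 x := by
    rw [Set.inter_indicator_one]
    simp only [Pi.mul_apply]
    ring
  have hi (i j : ι) : Integrable (fun x => (p κ - {y | |⟪w i, y⟫| ≤ κ}.indicator 1 x) *
        (p κ - {y | |⟪w j, y⟫| ≤ κ}.indicator 1 x)) (stdGaussian E) := by
    simp_rw [e2]
    exact (((integrable_const _).sub ((hind i).const_mul _)).sub ((hind j).const_mul _)).add
      (hindj i j)
  simp_rw [e1]
  rw [integral_finsetSum _ fun i _ => integrable_finsetSum _ fun j _ => hi i j, Finset.mul_sum]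
  refine Finset.sum_le_sum fun i _ => ?_
  rw [integral_finsetSum _ fun j _ => hi i j, Finset.mul_sum]
  refine Finset.sum_le_sum fun j _ => ?_
  simp_rw [e2]
  have hi1 : Integrable (fun x => p κ ^ 2 - p κ * {y | |⟪w i, y⟫| ≤ κ}.indicator 1 x)
    (stdGaussian E) := (integrable_const _).sub ((hind i).const_mul _)
  have hi2 : Integrable (fun x => p κ ^ 2 - p κ * {y | |⟪w i, y⟫| ≤ κ}.indicator 1 x -
    p κ * {y | |⟪w j, y⟫| ≤ κ}.indicator 1 x) (stdGaussian E) := hi1.sub ((hind j).const_mul _)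
  rw [integral_add hi2 (hindj i j), integral_sub hi1 ((hind j).const_mul _),
    integral_sub (integrable_const _) ((hind i).const_mul _), integral_const_mul, integral_const_mul,
    integral_indicator_one (hms i),
    integral_indicator_one (hms j), integral_indicator_one ((hms i).inter (hms j)),
    stdGaussian_slab (hw i), stdGaussian_slab (hw j)]
  have hR : |⟪w i, w j⟫| ≤ 1 := by
    have := abs_real_inner_le_norm (w i) (w j)
    rwa [hw i, hw j, one_mul] at this
  have hβ : (1 + ⟪w i, w j⟫) / 2 ∈ Set.Icc (0 : ℝ) 1 := by
    rw [abs_le] at hR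
    constructor <;> linarith
  have hq := q_eq_stdGaussian (hw i) (hw j) κ (β := (1 + ⟪w i, w j⟫) / 2) (by ring)
  have hq' := q_le_sq hκ hβ
  have e3 : 2 * ((1 + ⟪w i, w j⟫) / 2) - 1 = ⟪w i, w j⟫ := by ring
  rw [e3, hq] at hq'
  have e4 : {x : E | |⟪w i, x⟫| ≤ κ ∧ |⟪w j, x⟫| ≤ κ} =
    {y | |⟪w i, y⟫| ≤ κ} ∩ {y | |⟪w j, y⟫| ≤ κ} := rfl
  rw [e4] at hq'
  simp only [integral_const, probReal_univ, smul_eq_mul, one_mul]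
  nlinarith

lemma integral_card_slice (κ : ℝ) (D : Finset ι) (w : ι → E) (hw : ∀ i, ‖w i‖ = 1) :
    ∫ x, ((slice κ w D x).card : ℝ) ∂(stdGaussian E) = D.card * p κ := by
  simp_rw [card_slice]
  have hind (i : ι) : Integrable ({y | |⟪w i, y⟫| ≤ κ}.indicator (1 : E → ℝ)) (stdGaussian E) :=
    (integrable_const (1 : ℝ)).indicator (measurableSet_slab_inner κ (w i))
  rw [integral_finsetSum _ fun i _ => hind i]
  simp_rw [integral_indicator_one (measurableSet_slab_inner κ _), stdGaussian_slab (hw _)]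
  simp

lemma neg_log_le_of_le {r c : ℝ} (hc : 0 < c) (hr : c ≤ r) :
    -Real.log r ≤ (1 - r) + (1 - r) ^ 2 / c := by
  have hr0 := hc.trans_le hr
  have h1 := Real.log_le_sub_one_of_pos (inv_pos.2 hr0)
  rw [Real.log_inv] at h1
  have h2 : r⁻¹ - 1 = (1 - r) + (1 - r) ^ 2 / r := by field_simp; ring
  have h3 : (1 - r) ^ 2 / r ≤ (1 - r) ^ 2 / c := by gcongr
  linarith

/-- Away from small slices, the expected logarithmic loss of a random slab, relative to its
typical value `p κ`, is of second order in the overlaps. -/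
lemma integral_neg_log_card_slice_le [Finite ι] {κ c : ℝ} (hκ : 0 < κ) (hc : 0 < c) (hcp : c ≤ p κ)
    (D : Finset ι) (hD : D.Nonempty) (w : ι → E) (hw : ∀ i, ‖w i‖ = 1) :
    ∫ x, {x | c * D.card ≤ ((slice κ w D x).card : ℝ)}.indicator
        (fun x => -Real.log ((slice κ w D x).card / (D.card * p κ))) x ∂(stdGaussian E) ≤
      (2 * κ ^ 2 + 4) / (c * p κ) *
        ((∑ i ∈ D, ∑ j ∈ D, ⟪w i, w j⟫ ^ 2) / (D.card : ℝ) ^ 2) := by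
  have hp := p_pos hκ
  have hD0 : (0 : ℝ) < D.card := Nat.cast_pos.2 hD.card_pos
  have hmeas := measurable_card_slice κ w D
  have hset : MeasurableSet {x | c * D.card ≤ ((slice κ w D x).card : ℝ)} :=
    measurableSet_le measurable_const hmeas
  have hcard : Integrable (fun x => ((slice κ w D x).card : ℝ)) (stdGaussian E) :=
    Integrable.of_bound hmeas.aestronglyMeasurable D.card (Eventually.of_forall fun x => by
      rw [Real.norm_of_nonneg (by positivity)]; exact card_slice_le κ w D x)
  have hsq : Integrable (fun x => ((D.card : ℝ) * p κ - (slice κ w D x).card) ^ 2)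
      (stdGaussian E) := by
    refine Integrable.of_bound ((measurable_const.sub hmeas).pow_const 2).aestronglyMeasurable
      ((D.card * p κ + D.card) ^ 2) (Eventually.of_forall fun x => ?_)
    rw [norm_pow, Real.norm_eq_abs]
    gcongr
    have := card_slice_le κ w D x
    have h2 : (0 : ℝ) ≤ (slice κ w D x).card := by positivity
    have h3 : 0 < D.card * p κ := by positivity
    rw [abs_le]
    constructor <;> linarith
  have hpt (x : E) : {x | c * D.card ≤ ((slice κ w D x).card : ℝ)}.indicator
        (fun x => -Real.log ((slice κ w D x).card / (D.card * p κ))) x ≤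
      (D.card * p κ - (slice κ w D x).card) / (D.card * p κ) +
        (D.card * p κ - (slice κ w D x).card) ^ 2 / (D.card ^ 2 * (c * p κ)) := by
    by_cases hx : c * D.card ≤ ((slice κ w D x).card : ℝ)
    · rw [Set.indicator_of_mem (by exact hx)]
      refine (neg_log_le_of_le (c := c / p κ) (by positivity) ?_).trans (le_of_eq ?_)
      · rw [div_le_div_iff₀ hp (by positivity)]
        nlinarith
      · field_simp
    · rw [Set.indicator_of_notMem (by exact hx)]
      have h1 : ((slice κ w D x).card : ℝ) ≤ D.card * p κ := by
        nlinarith [not_le.1 hx]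
      have h2 : 0 ≤ D.card * p κ - (slice κ w D x).card := by linarith
      positivity
  have hi1 : Integrable (fun x => (D.card * p κ - (slice κ w D x).card) / (D.card * p κ))
      (stdGaussian E) := ((integrable_const _).sub hcard).div_const _
  calc _ ≤ ∫ x, ((D.card * p κ - (slice κ w D x).card) / (D.card * p κ) +
        (D.card * p κ - (slice κ w D x).card) ^ 2 / (D.card ^ 2 * (c * p κ))) ∂(stdGaussian E) := by
        refine integral_mono ?_ (hi1.add (hsq.div_const _)) hpt
        refine Integrable.indicator ?_ hset
        exact integrable_comp_slice _ κ w D fun S => -Real.log (S.card / (D.card * p κ))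
    _ ≤ _ := by
        rw [integral_add hi1 (hsq.div_const _), integral_div, integral_div,
          integral_sub (integrable_const _) hcard, integral_card_slice κ D w hw]
        simp only [integral_const, probReal_univ, smul_eq_mul, one_mul, sub_self, zero_div,
          zero_add]
        rw [div_mul_div_comm, mul_comm (c * p κ)]
        gcongr
        exact integral_card_slice_sub_sq_le hκ D w hw

end Slice

/-! ### The potential and its one-step bound -/

section Potential

variable {E : Type*} [NormedAddCommGroup E] [InnerProductSpace ℝ E] {ι : Type*}

/-- Jensen's inequality for the exponential, through its tangent at `Ψ`. -/
lemma sum_sq_inner_le (D : Finset ι) (w : ι → E) {b Ψ : ℝ}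
    (h : ∑ i ∈ D, ∑ j ∈ D, Real.exp (b * ⟪w i, w j⟫ ^ 2) ≤ Real.exp Ψ * (D.card : ℝ) ^ 2) :
    b * ∑ i ∈ D, ∑ j ∈ D, ⟪w i, w j⟫ ^ 2 ≤ Ψ * (D.card : ℝ) ^ 2 := by
  have h1 : ∑ i ∈ D, ∑ j ∈ D, (b * ⟪w i, w j⟫ ^ 2 - Ψ + 1) ≤
      ∑ i ∈ D, ∑ j ∈ D, Real.exp (-Ψ) * Real.exp (b * ⟪w i, w j⟫ ^ 2) := by
    refine Finset.sum_le_sum fun i _ => Finset.sum_le_sum fun j _ => ?_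
    rw [← Real.exp_add]
    have := Real.add_one_le_exp (-Ψ + b * ⟪w i, w j⟫ ^ 2)
    linarith
  simp only [← Finset.mul_sum, Finset.sum_add_distrib, Finset.sum_sub_distrib, Finset.sum_const,
    nsmul_eq_mul] at h1
  have h2 := mul_le_mul_of_nonneg_left h (Real.exp_pos (-Ψ)).le
  rw [← mul_assoc, ← Real.exp_add, neg_add_cancel, Real.exp_zero, one_mul] at h2
  nlinarith

/-- The pointwise bound `z² ≤ 2Ψ² + 4 exp (z - Ψ)` plays the role of a tangent. -/
lemma sum_pow_four_inner_le (D : Finset ι) (w : ι → E) {b Ψ : ℝ} (hb : 0 ≤ b) (hΨ : 0 ≤ Ψ)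
    (h : ∑ i ∈ D, ∑ j ∈ D, Real.exp (b * ⟪w i, w j⟫ ^ 2) ≤ Real.exp Ψ * (D.card : ℝ) ^ 2) :
    b ^ 2 * ∑ i ∈ D, ∑ j ∈ D, ⟪w i, w j⟫ ^ 4 ≤ (2 * Ψ ^ 2 + 4) * (D.card : ℝ) ^ 2 := by
  have h1 : ∑ i ∈ D, ∑ j ∈ D, (b ^ 2 * ⟪w i, w j⟫ ^ 4 - 2 * Ψ ^ 2) ≤
      ∑ i ∈ D, ∑ j ∈ D, 4 * Real.exp (-Ψ) * Real.exp (b * ⟪w i, w j⟫ ^ 2) := by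
    refine Finset.sum_le_sum fun i _ => Finset.sum_le_sum fun j _ => ?_
    rw [mul_assoc, ← Real.exp_add]
    have hz : 0 ≤ b * ⟪w i, w j⟫ ^ 2 := by positivity
    have e : b ^ 2 * ⟪w i, w j⟫ ^ 4 = (b * ⟪w i, w j⟫ ^ 2) ^ 2 := by ring
    rw [e]
    generalize b * ⟪w i, w j⟫ ^ 2 = z at hz ⊢
    rcases le_total Ψ z with hz' | hz'
    · have h2 := Real.quadratic_le_exp_of_nonneg (x := -Ψ + z) (by linarith)
      nlinarith [sq_nonneg (2 * Ψ - z)]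
    · have := Real.exp_pos (-Ψ + z)
      nlinarith
  simp only [← Finset.mul_sum, Finset.sum_sub_distrib, Finset.sum_const, nsmul_eq_mul] at h1
  have h2 := mul_le_mul_of_nonneg_left h (Real.exp_pos (-Ψ)).le
  rw [← mul_assoc, ← Real.exp_add, neg_add_cancel, Real.exp_zero, one_mul] at h2
  nlinarith

/-- Third moments of the overlaps, by interpolation between the second and the fourth. -/
lemma sum_abs_cube_inner_le (D : Finset ι) (w : ι → E) {b Ψ : ℝ} (hb : 0 ≤ b) (hΨ : 0 ≤ Ψ)
    (h : ∑ i ∈ D, ∑ j ∈ D, Real.exp (b * ⟪w i, w j⟫ ^ 2) ≤ Real.exp Ψ * (D.card : ℝ) ^ 2) :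
    b * √b * ∑ i ∈ D, ∑ j ∈ D, |⟪w i, w j⟫| ^ 3 ≤ (Ψ + 2 * Ψ ^ 2 + 4) * (D.card : ℝ) ^ 2 := by
  have h1 : ∑ i ∈ D, ∑ j ∈ D, b * √b * |⟪w i, w j⟫| ^ 3 ≤
      ∑ i ∈ D, ∑ j ∈ D, (b * ⟪w i, w j⟫ ^ 2 + b ^ 2 * ⟪w i, w j⟫ ^ 4) := by
    refine Finset.sum_le_sum fun i _ => Finset.sum_le_sum fun j _ => ?_
    generalize ⟪w i, w j⟫ = r
    have e1 : r ^ 2 = |r| ^ 2 := (sq_abs r).symm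
    have e2 : r ^ 4 = |r| ^ 4 := (Even.pow_abs (by decide) r).symm
    have hs := Real.sq_sqrt hb
    have hs0 := Real.sqrt_nonneg b
    rw [e1, e2]
    generalize √b = s at *
    subst hs
    have hy : 0 ≤ s * |r| := by positivity
    generalize |r| = a at *
    have e3 : s ^ 2 * s * a ^ 3 = (s * a) ^ 3 := by ring
    have e4 : s ^ 2 * a ^ 2 + (s ^ 2) ^ 2 * a ^ 4 = (s * a) ^ 2 + (s * a) ^ 4 := by ring
    rw [e3, e4]
    nlinarith [mul_nonneg (sq_nonneg (s * a)) (sq_nonneg (s * a - 1)), sq_nonneg (s * a),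
      sq_nonneg ((s * a) ^ 2)]
  simp only [← Finset.mul_sum, Finset.sum_add_distrib] at h1
  have h2 := sum_sq_inner_le D w h
  have h3 := sum_pow_four_inner_le D w hb hΨ h
  linarith

variable [Fintype ι]

/-- The density of `D` relative to the expected size of the solution space after `t`
constraints. -/
noncomputable def density (κ : ℝ) (t : ℕ) (D : Finset ι) : ℝ :=
  D.card / (Fintype.card ι * p κ ^ t)

/-- The overlap energy of `D`: the exponential moment of the squared overlaps of pairs in `D`,
normalised by the square of the expected size of the solution space after `t` constraints. -/
noncomputable def energy (κ b : ℝ) (w : ι → E) (t : ℕ) (D : Finset ι) : ℝ :=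
  (∑ i ∈ D, ∑ j ∈ D, Real.exp (b * ⟪w i, w j⟫ ^ 2)) / (Fintype.card ι * p κ ^ t) ^ 2

lemma energy_empty (κ b : ℝ) (w : ι → E) (t : ℕ) : energy κ b w t (∅ : Finset ι) = 0 := by
  simp [energy]

/-- The logarithm of `B` over the squared density. If the energy is at most `B`, it dominates the
logarithm of the mean of `exp (b R²)` over the overlaps `R` of pairs in `D`. -/
noncomputable def logDefect (κ B : ℝ) (t : ℕ) (D : Finset ι) : ℝ :=
  Real.log B - 2 * Real.log (density κ t D)

/-- A set of replicas that is nonempty, of controlled energy and of controlled density. -/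
def Admissible (κ b : ℝ) (w : ι → E) (A B : ℝ) (t : ℕ) (D : Finset ι) : Prop :=
  D.Nonempty ∧ energy κ b w t D ≤ B ∧ logDefect κ B t D ≤ A

open Classical in
/-- Replaces a set which is not admissible by the empty set. -/
noncomputable def kill (κ b : ℝ) (w : ι → E) (A B : ℝ) (t : ℕ) (D : Finset ι) : Finset ι :=
  if Admissible κ b w A B t D then D else ∅

/-- The potential: the logarithmic defect of a surviving set, and the cap `A` for a dead one. -/
noncomputable def potential (κ A B : ℝ) (t : ℕ) (D : Finset ι) : ℝ :=
  if D.Nonempty then logDefect κ B t D else A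

lemma potential_empty (κ A B : ℝ) (t : ℕ) : potential κ A B t (∅ : Finset ι) = A := by
  simp [potential]

lemma potential_of_nonempty (κ A B : ℝ) (t : ℕ) {D : Finset ι} (hD : D.Nonempty) :
    potential κ A B t D = logDefect κ B t D := if_pos hD

lemma kill_of_admissible {κ b : ℝ} {w : ι → E} {A B : ℝ} {t : ℕ} {D : Finset ι}
    (h : Admissible κ b w A B t D) : kill κ b w A B t D = D := if_pos h

lemma kill_of_not_admissible {κ b : ℝ} {w : ι → E} {A B : ℝ} {t : ℕ} {D : Finset ι}
    (h : ¬ Admissible κ b w A B t D) : kill κ b w A B t D = ∅ := if_neg h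

lemma admissible_of_kill_nonempty {κ b : ℝ} {w : ι → E} {A B : ℝ} {t : ℕ} {D : Finset ι}
    (h : (kill κ b w A B t D).Nonempty) : Admissible κ b w A B t D := by
  by_contra hA
  rw [kill_of_not_admissible hA] at h
  exact Finset.not_nonempty_empty h

lemma potential_kill_le (κ b : ℝ) (w : ι → E) (A B : ℝ) (t : ℕ) (D : Finset ι) :
    potential κ A B t (kill κ b w A B t D) ≤ A := by
  by_cases h : Admissible κ b w A B t D
  · rw [kill_of_admissible h, potential_of_nonempty _ _ _ _ h.1]
    exact h.2.2
  · rw [kill_of_not_admissible h, potential_empty]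

lemma density_pos {κ : ℝ} (hκ : 0 < κ) (t : ℕ) {D : Finset ι} (hD : D.Nonempty) :
    0 < density κ t D := by
  have : Nonempty ι := ⟨hD.choose⟩
  have := p_pos hκ
  have := hD.card_pos
  have : 0 < Fintype.card ι := Fintype.card_pos
  unfold density
  positivity

lemma sum_exp_eq_energy_mul {κ : ℝ} (hκ : 0 < κ) (b : ℝ) (w : ι → E) (t : ℕ) {D : Finset ι}
    (hD : D.Nonempty) :
    ∑ i ∈ D, ∑ j ∈ D, Real.exp (b * ⟪w i, w j⟫ ^ 2) =
      energy κ b w t D / density κ t D ^ 2 * (D.card : ℝ) ^ 2 := by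
  have : Nonempty ι := ⟨hD.choose⟩
  have h1 := p_pos hκ
  have h2 : (0 : ℝ) < D.card := Nat.cast_pos.2 hD.card_pos
  have h3 : (0 : ℝ) < Fintype.card ι := Nat.cast_pos.2 Fintype.card_pos
  unfold density energy
  field_simp

lemma exp_logDefect {κ B : ℝ} (hκ : 0 < κ) (hB : 0 < B) (t : ℕ) {D : Finset ι}
    (hD : D.Nonempty) : Real.exp (logDefect κ B t D) = B / density κ t D ^ 2 := by
  have h := density_pos hκ t hD
  rw [logDefect, Real.exp_sub, Real.exp_log hB, ← Real.exp_log (pow_pos h 2), Real.log_pow]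
  norm_num

lemma sum_exp_le {κ b B : ℝ} {w : ι → E} (hκ : 0 < κ) (hB : 0 < B) {t : ℕ} {D : Finset ι}
    (hD : D.Nonempty) (h : energy κ b w t D ≤ B) :
    ∑ i ∈ D, ∑ j ∈ D, Real.exp (b * ⟪w i, w j⟫ ^ 2) ≤
      Real.exp (logDefect κ B t D) * (D.card : ℝ) ^ 2 := by
  rw [sum_exp_eq_energy_mul hκ b w t hD, exp_logDefect hκ hB t hD]
  gcongr

/-- The energy is at least the squared density, as each pair contributes at least one. -/
lemma logDefect_nonneg {κ b B : ℝ} {w : ι → E} (hκ : 0 < κ) (hb : 0 ≤ b) (hB : 0 < B) {t : ℕ}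
    {D : Finset ι} (hD : D.Nonempty) (h : energy κ b w t D ≤ B) : 0 ≤ logDefect κ B t D := by
  have h1 := sum_exp_le hκ hB hD h
  have h2 : (D.card : ℝ) ^ 2 ≤ ∑ i ∈ D, ∑ j ∈ D, Real.exp (b * ⟪w i, w j⟫ ^ 2) := by
    have : (D.card : ℝ) ^ 2 = ∑ i ∈ D, ∑ j ∈ D, (1 : ℝ) := by simp [sq]
    rw [this]
    exact Finset.sum_le_sum fun i _ => Finset.sum_le_sum fun j _ =>
      Real.one_le_exp (by positivity)
  have h3 : (0 : ℝ) < (D.card : ℝ) ^ 2 := pow_pos (Nat.cast_pos.2 hD.card_pos) 2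
  have h4 := h2.trans h1
  rw [← Real.one_le_exp_iff]
  exact le_of_mul_le_mul_right (by linarith) h3

lemma logDefect_slice {κ : ℝ} (hκ : 0 < κ) (B : ℝ) (w : ι → E) (t : ℕ) (D : Finset ι) (x : E)
    (hS : (slice κ w D x).Nonempty) :
    logDefect κ B (t + 1) (slice κ w D x) =
      logDefect κ B t D + 2 * -Real.log ((slice κ w D x).card / (D.card * p κ)) := by
  have hD : D.Nonempty := hS.mono (slice_subset κ w D x)
  have : Nonempty ι := ⟨hD.choose⟩
  have h1 := p_pos hκ
  have h2 : (0 : ℝ) < D.card := Nat.cast_pos.2 hD.card_pos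
  have h3 : (0 : ℝ) < Fintype.card ι := Nat.cast_pos.2 Fintype.card_pos
  have h4 : (0 : ℝ) < (slice κ w D x).card := Nat.cast_pos.2 hS.card_pos
  have e : density κ (t + 1) (slice κ w D x) =
      density κ t D * ((slice κ w D x).card / (D.card * p κ)) := by
    unfold density
    field_simp
    ring
  rw [logDefect, logDefect, e, Real.log_mul (density_pos hκ t hD).ne' (by positivity)]
  ring

/-- Pointwise effect of one constraint on the potential. -/
lemma potential_slice_le {κ b A B c : ℝ} {w : ι → E} (hκ : 0 < κ) (hb : 0 ≤ b) (hB : 0 < B)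
    (hA : 0 ≤ A) (hc : 0 < c) {t : ℕ} {D : Finset ι} (hD : Admissible κ b w A B t D) (x : E) :
    potential κ A B (t + 1) (kill κ b w A B (t + 1) (slice κ w D x)) ≤
      logDefect κ B t D
      + 2 * {x | c * D.card ≤ ((slice κ w D x).card : ℝ)}.indicator
        (fun x => -Real.log ((slice κ w D x).card / (D.card * p κ))) x
      + A * {x | ((slice κ w D x).card : ℝ) < c * D.card}.indicator 1 x
      + (A - 2 * Real.log (p κ)) *
        {x | B < energy κ b w (t + 1) (slice κ w D x)}.indicator 1 x := by
  have hΨ := logDefect_nonneg hκ hb hB hD.1 hD.2.1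
  have hp := p_pos hκ
  have hlp := log_p_neg hκ
  have hkill := potential_kill_le κ b w A B (t + 1) (slice κ w D x)
  have hD0 : (0 : ℝ) < D.card := Nat.cast_pos.2 hD.1.card_pos
  have hind : (0 : ℝ) ≤ {x | B < energy κ b w (t + 1) (slice κ w D x)}.indicator 1 x :=
    Set.indicator_nonneg (fun _ _ => zero_le_one) _
  have hlast := mul_nonneg (by linarith : 0 ≤ A - 2 * Real.log (p κ)) hind
  rcases lt_or_ge ((slice κ w D x).card : ℝ) (c * D.card) with hx | hx
  · rw [Set.indicator_of_notMem (s := {x | c * D.card ≤ ((slice κ w D x).card : ℝ)})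
      (by rw [Set.mem_ofPred_eq]; exact not_le.2 hx),
      Set.indicator_of_mem (s := {x | ((slice κ w D x).card : ℝ) < c * D.card}) (by exact hx)]
    simp only [Pi.one_apply]
    linarith
  · have hS : (slice κ w D x).Nonempty := by
      rw [← Finset.card_pos, ← Nat.cast_pos (α := ℝ)]
      exact lt_of_lt_of_le (by positivity) hx
    have hS0 : (0 : ℝ) < (slice κ w D x).card := Nat.cast_pos.2 hS.card_pos
    rw [Set.indicator_of_mem (s := {x | c * D.card ≤ ((slice κ w D x).card : ℝ)}) (by exact hx),
      Set.indicator_of_notMem (s := {x | ((slice κ w D x).card : ℝ) < c * D.card})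
      (by rw [Set.mem_ofPred_eq]; exact not_lt.2 hx)]
    have hL := logDefect_slice hκ B w t D x hS
    by_cases hQ : B < energy κ b w (t + 1) (slice κ w D x)
    · rw [Set.indicator_of_mem (s := {x | B < energy κ b w (t + 1) (slice κ w D x)})
        (by exact hQ)]
      -- the fraction is at most one, so the logarithmic gain is at most `-log (p κ)`
      have h1 : Real.log ((slice κ w D x).card / (D.card * p κ)) ≤ -Real.log (p κ) := by
        rw [← Real.log_inv]
        refine Real.log_le_log (by positivity) ?_
        rw [div_le_iff₀ (by positivity), mul_comm, mul_assoc, mul_inv_cancel₀ hp.ne', mul_one]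
        exact card_slice_le κ w D x
      simp only [Pi.one_apply]
      linarith
    · by_cases hG : Admissible κ b w A B (t + 1) (slice κ w D x)
      · rw [kill_of_admissible hG, potential_of_nonempty _ _ _ _ hS, hL]
        linarith
      · have h1 : A < logDefect κ B (t + 1) (slice κ w D x) := by
          by_contra h2
          exact hG ⟨hS, not_lt.1 hQ, not_lt.1 h2⟩
        linarith

variable [MeasurableSpace E] [BorelSpace E] [FiniteDimensional ℝ E]

/-- One step of the potential argument, averaged over the new constraint. The hypothesis
`hsmall` is the small-ball estimate. -/
lemma integral_potential_slice_le {κ b A B c C : ℝ} {w : ι → E} (hκ : 0 < κ) (hb : 0 < b)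
    (hB : 0 < B) (hA : 0 ≤ A) (hc : 0 < c) (hcp : c ≤ p κ) (hw : ∀ i, ‖w i‖ = 1) (hC : 0 ≤ C)
    (hsmall : ∀ D : Finset ι, D.Nonempty →
      (stdGaussian E).real {x | ((slice κ w D x).card : ℝ) < c * D.card} ≤
        C * ((∑ i ∈ D, ∑ j ∈ D, |⟪w i, w j⟫| ^ 3) / (D.card : ℝ) ^ 2))
    {t : ℕ} {D : Finset ι} (hD : Admissible κ b w A B t D) :
    ∫ x, potential κ A B (t + 1) (kill κ b w A B (t + 1) (slice κ w D x)) ∂(stdGaussian E) ≤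
      (1 + 2 * ((2 * κ ^ 2 + 4) / (c * p κ)) / b) * potential κ A B t D
      + A * (C * ((A + 2 * A ^ 2 + 4) / (b * √b)))
      + (A - 2 * Real.log (p κ)) *
        (stdGaussian E).real {x | B < energy κ b w (t + 1) (slice κ w D x)} := by
  have hp := p_pos hκ
  have hlp := log_p_neg hκ
  have hD0 : (0 : ℝ) < D.card := Nat.cast_pos.2 hD.1.card_pos
  have hΨ := logDefect_nonneg hκ hb.le hB hD.1 hD.2.1
  have hexp := sum_exp_le hκ hB hD.1 hD.2.1
  have hms {s : Set (Finset ι)} : MeasurableSet {x | slice κ w D x ∈ s} :=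
    measurable_slice κ w D (DiscreteMeasurableSpace.forall_measurableSet s)
  have m1 : MeasurableSet {x | c * D.card ≤ ((slice κ w D x).card : ℝ)} :=
    hms (s := {S | c * D.card ≤ (S.card : ℝ)})
  have m2 : MeasurableSet {x | ((slice κ w D x).card : ℝ) < c * D.card} :=
    hms (s := {S | (S.card : ℝ) < c * D.card})
  have m3 : MeasurableSet {x | B < energy κ b w (t + 1) (slice κ w D x)} :=
    hms (s := {S | B < energy κ b w (t + 1) S})
  have i1 : Integrable ({x | c * D.card ≤ ((slice κ w D x).card : ℝ)}.indicator
        (fun x => -Real.log ((slice κ w D x).card / (D.card * p κ)))) (stdGaussian E) :=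
    (integrable_comp_slice _ κ w D fun S => -Real.log (S.card / (D.card * p κ))).indicator m1
  have i2 := (integrable_const (μ := stdGaussian E) (1 : ℝ)).indicator m2
  have i3 := (integrable_const (μ := stdGaussian E) (1 : ℝ)).indicator m3
  have add {f g : E → ℝ} {I J : ℝ}
      (hf : Integrable f (stdGaussian E) ∧ ∫ x, f x ∂(stdGaussian E) = I)
      (hg : Integrable g (stdGaussian E) ∧ ∫ x, g x ∂(stdGaussian E) = J) :
      Integrable (fun x => f x + g x) (stdGaussian E) ∧
        ∫ x, (f x + g x) ∂(stdGaussian E) = I + J :=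
    ⟨hf.1.add hg.1, by rw [integral_add hf.1 hg.1, hf.2, hg.2]⟩
  have smul (c : ℝ) {f : E → ℝ} {I : ℝ}
      (hf : Integrable f (stdGaussian E) ∧ ∫ x, f x ∂(stdGaussian E) = I) :
      Integrable (fun x => c * f x) (stdGaussian E) ∧ ∫ x, c * f x ∂(stdGaussian E) = c * I :=
    ⟨hf.1.const_mul c, by rw [integral_const_mul, hf.2]⟩
  have const (c : ℝ) : Integrable (fun _ : E => c) (stdGaussian E) ∧
      ∫ _, c ∂(stdGaussian E) = c := ⟨integrable_const c, by simp⟩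
  have key := add (add (add (const (logDefect κ B t D)) (smul 2 ⟨i1, rfl⟩))
    (smul A ⟨i2, integral_indicator_one m2⟩))
    (smul (A - 2 * Real.log (p κ)) ⟨i3, integral_indicator_one m3⟩)
  have hle := integral_mono (integrable_comp_slice (stdGaussian E) κ w D fun S =>
    potential κ A B (t + 1) (kill κ b w A B (t + 1) S)) key.1
    (fun x => potential_slice_le hκ hb.le hB hA hc hD x)
  refine (hle.trans (le_of_eq key.2)).trans ?_
  have l1 := integral_neg_log_card_slice_le hκ hc hcp D hD.1 w hw
  have l2 := hsmall D hD.1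
  have s1 : (∑ i ∈ D, ∑ j ∈ D, ⟪w i, w j⟫ ^ 2) / (D.card : ℝ) ^ 2 ≤ logDefect κ B t D / b := by
    rw [div_le_div_iff₀ (by positivity) hb, mul_comm]
    exact sum_sq_inner_le D w hexp
  have s2 : (∑ i ∈ D, ∑ j ∈ D, |⟪w i, w j⟫| ^ 3) / (D.card : ℝ) ^ 2 ≤
      (A + 2 * A ^ 2 + 4) / (b * √b) := by
    have hsb := Real.sqrt_pos.2 hb
    rw [div_le_div_iff₀ (by positivity) (by positivity), mul_comm]
    refine (sum_abs_cube_inner_le D w hb.le hΨ hexp).trans ?_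
    have hΨA := hD.2.2
    gcongr
  have l3 := l1.trans (mul_le_mul_of_nonneg_left s1 (by positivity))
  have l4 := mul_le_mul_of_nonneg_left (l2.trans (mul_le_mul_of_nonneg_left s2 hC)) hA
  rw [potential_of_nonempty _ _ _ _ hD.1]
  have e : (1 + 2 * ((2 * κ ^ 2 + 4) / (c * p κ)) / b) * logDefect κ B t D =
      logDefect κ B t D + 2 * ((2 * κ ^ 2 + 4) / (c * p κ) * (logDefect κ B t D / b)) := by ring
  rw [e]
  linarith

end Potential

/-! ### The killed chain of survivors -/

section Chain

variable {E : Type*} [NormedAddCommGroup E] [InnerProductSpace ℝ E] {ι : Type*} [Fintype ι]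

/-- The indices that satisfy the first `t` of the slab constraints given by `x`. -/
noncomputable def survivors (κ : ℝ) (w : ι → E) (x : ℕ → E) : ℕ → Finset ι
  | 0 => Finset.univ
  | t + 1 => slice κ w (survivors κ w x t) (x t)

/-- The survivors, replaced by the empty set from the first time on at which they are not
admissible. -/
noncomputable def chain (κ b : ℝ) (w : ι → E) (A B : ℝ) (x : ℕ → E) : ℕ → Finset ι
  | 0 => kill κ b w A B 0 Finset.univ
  | t + 1 => kill κ b w A B (t + 1) (slice κ w (chain κ b w A B x t) (x t))

lemma mem_survivors {κ : ℝ} {w : ι → E} {x : ℕ → E} {t : ℕ} {i : ι} :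
    i ∈ survivors κ w x t ↔ ∀ s < t, |⟪w i, x s⟫| ≤ κ := by
  induction t with
  | zero => simp [survivors]
  | succ t ih => rw [survivors, slice, Finset.mem_filter, ih, Nat.forall_lt_succ_right]

lemma admissible_chain {κ b : ℝ} {w : ι → E} {A B : ℝ} {x : ℕ → E} {t : ℕ}
    (h : (chain κ b w A B x t).Nonempty) : Admissible κ b w A B t (chain κ b w A B x t) := by
  cases t with
  | zero =>
    rw [chain] at h ⊢
    have := admissible_of_kill_nonempty h
    rwa [kill_of_admissible this]
  | succ t =>
    rw [chain] at h ⊢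
    have := admissible_of_kill_nonempty h
    rwa [kill_of_admissible this]

lemma chain_eq_survivors {κ b : ℝ} {w : ι → E} {A B : ℝ} {x : ℕ → E} {t : ℕ}
    (h : (chain κ b w A B x t).Nonempty) : chain κ b w A B x t = survivors κ w x t := by
  induction t with
  | zero =>
    rw [chain] at h ⊢
    rw [kill_of_admissible (admissible_of_kill_nonempty h), survivors]
  | succ t ih =>
    rw [chain] at h ⊢
    have hA := admissible_of_kill_nonempty h
    rw [kill_of_admissible hA, survivors, ih]
    by_contra hne
    rw [Finset.not_nonempty_iff_eq_empty] at hne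
    rw [hne, slice_empty] at hA
    exact Finset.not_nonempty_empty hA.1

lemma chain_congr {κ b : ℝ} {w : ι → E} {A B : ℝ} {x y : ℕ → E} {t : ℕ}
    (h : ∀ s < t, x s = y s) : chain κ b w A B x t = chain κ b w A B y t := by
  induction t with
  | zero => rfl
  | succ t ih => rw [chain, chain, ih fun s hs => h s (by omega), h t (by omega)]

variable [MeasurableSpace E] [BorelSpace E] [FiniteDimensional ℝ E]

lemma measurable_slice_prod (κ : ℝ) (w : ι → E) :
    Measurable fun z : Finset ι × E => slice κ w z.1 z.2 :=
  measurable_from_prod_countable_right fun D => measurable_slice κ w D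

lemma measurable_survivors (κ : ℝ) (w : ι → E) (t : ℕ) :
    Measurable fun x : ℕ → E => survivors κ w x t := by
  induction t with
  | zero => exact measurable_const
  | succ t ih => exact (measurable_slice_prod κ w).comp (ih.prodMk (measurable_pi_apply t))

lemma measurable_chain (κ b : ℝ) (w : ι → E) (A B : ℝ) (t : ℕ) :
    Measurable fun x : ℕ → E => chain κ b w A B x t := by
  induction t with
  | zero => exact measurable_const
  | succ t ih =>
    exact (Measurable.of_discrete (f := kill κ b w A B (t + 1))).comp
      ((measurable_slice_prod κ w).comp (ih.prodMk (measurable_pi_apply t)))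

variable {Ω : Type*} [MeasurableSpace Ω] {P : Measure Ω} {Y : ℕ → Ω → E}

lemma indepFun_chain (hY : ∀ t, Measurable (Y t)) (hindep : iIndepFun Y P) (κ b : ℝ)
    (w : ι → E) (A B : ℝ) (t : ℕ) :
    IndepFun (fun ω => chain κ b w A B (fun s => Y s ω) t) (Y t) P := by
  have h := hindep.indepFun_finset (Finset.range t) {t} (by simp) hY
  have hφ : Measurable fun y : (Finset.range t → E) =>
      chain κ b w A B (fun s => if hs : s ∈ Finset.range t then y ⟨s, hs⟩ else 0) t := by
    refine (measurable_chain κ b w A B t).comp (measurable_pi_lambda _ fun s => ?_)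
    by_cases hs : s ∈ Finset.range t
    · simp only [hs, dite_true]
      exact measurable_pi_apply _
    · simp only [hs, dite_false]
      exact measurable_const
  have hψ : Measurable fun y : (({t} : Finset ℕ) → E) => y ⟨t, by simp⟩ := measurable_pi_apply _
  have h2 := h.comp hφ hψ
  convert h2 using 1
  · funext ω
    refine chain_congr fun s hs => ?_
    simp [hs]
  · rfl

variable [IsProbabilityMeasure P]

lemma integrable_comp_finset {f : Ω → Finset ι} (hf : Measurable f) (g : Finset ι → ℝ) :
    Integrable (fun ω => g (f ω)) P :=
  Integrable.comp_measurable (g := g) Integrable.of_finite hf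

/-- The new constraint is independent of the past: averages over one step may be taken first over
the new constraint. -/
lemma integral_comp_slice_chain (hY : ∀ t, Measurable (Y t))
    (hlaw : ∀ t, P.map (Y t) = stdGaussian E) (hindep : iIndepFun Y P) (κ b : ℝ)
    (w : ι → E) (A B : ℝ) (t : ℕ) (g : Finset ι → ℝ) :
    ∫ ω, g (slice κ w (chain κ b w A B (fun s => Y s ω) t) (Y t ω)) ∂P =
      ∫ ω, ∫ x, g (slice κ w (chain κ b w A B (fun s => Y s ω) t) x) ∂(stdGaussian E) ∂P := by
  have hc : Measurable fun ω => chain κ b w A B (fun s => Y s ω) t :=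
    (measurable_chain κ b w A B t).comp (measurable_pi_lambda _ hY)
  have hprod := (indepFun_iff_map_prod_eq_prod_map_map hc.aemeasurable
    (hY t).aemeasurable).1 (indepFun_chain hY hindep κ b w A B t)
  have hg : Measurable fun z : Finset ι × E => g (slice κ w z.1 z.2) :=
    Measurable.of_discrete.comp (measurable_slice_prod κ w)
  have h1 := integral_map (μ := P) (hc.prodMk (hY t)).aemeasurable hg.aestronglyMeasurable
  rw [← h1, hprod, hlaw t]
  have : IsProbabilityMeasure (P.map fun ω => chain κ b w A B (fun s => Y s ω) t) :=
    Measure.isProbabilityMeasure_map hc.aemeasurable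
  rw [integral_prod, integral_map hc.aemeasurable]
  · exact (Measurable.of_discrete (f := fun D : Finset ι =>
      ∫ x, g (slice κ w D x) ∂(stdGaussian E))).aestronglyMeasurable
  · exact integrable_comp_finset (measurable_slice_prod κ w) g

/-- Gronwall bound for the potential: the survivors are nonempty and of logarithmic defect at most
`A`, except on an event whose probability is of the order of the mean potential over `A`. -/
theorem measureReal_sparse_mul_le {κ b A B c C η : ℝ} {w : ι → E} (hκ : 0 < κ) (hb : 0 < b)
    (hB : 1 ≤ B) (hAB : Real.log B ≤ A) (hc : 0 < c) (hcp : c ≤ p κ) (hw : ∀ i, ‖w i‖ = 1)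
    (hC : 0 ≤ C)
    (hsmall : ∀ D : Finset ι, D.Nonempty →
      (stdGaussian E).real {x | ((slice κ w D x).card : ℝ) < c * D.card} ≤
        C * ((∑ i ∈ D, ∑ j ∈ D, |⟪w i, w j⟫| ^ 3) / (D.card : ℝ) ^ 2))
    (hY : ∀ t, Measurable (Y t)) (hlaw : ∀ t, P.map (Y t) = stdGaussian E)
    (hindep : iIndepFun Y P) [Nonempty ι] (T : ℕ) (hη : 0 ≤ η)
    (hinit : energy κ b w 0 (Finset.univ : Finset ι) ≤ B)
    (henergy : ∀ t ≤ T, P.real {ω | B < energy κ b w t (survivors κ w (fun s => Y s ω) t)} ≤ η) :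
    P.real {ω | survivors κ w (fun s => Y s ω) T = ∅ ∨
        A < logDefect κ B T (survivors κ w (fun s => Y s ω) T)} * A ≤
      (1 + 2 * ((2 * κ ^ 2 + 4) / (c * p κ)) / b) ^ T *
        (Real.log B + T * (A * (C * ((A + 2 * A ^ 2 + 4) / (b * √b)))
          + (A - 2 * Real.log (p κ)) * η)) := by
  have hp := p_pos hκ
  have hlp := log_p_neg hκ
  have hB0 : 0 < B := by linarith
  have hlB : 0 ≤ Real.log B := Real.log_nonneg hB
  have hA : 0 ≤ A := hlB.trans hAB
  set ρ := 1 + 2 * ((2 * κ ^ 2 + 4) / (c * p κ)) / b with hρ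
  set δ₁ := A * (C * ((A + 2 * A ^ 2 + 4) / (b * √b))) with hδ₁
  set δ := δ₁ + (A - 2 * Real.log (p κ)) * η with hδ
  have hρ1 : 1 ≤ ρ := by
    have : 0 ≤ 2 * ((2 * κ ^ 2 + 4) / (c * p κ)) / b := by positivity
    linarith
  have hδ1 : 0 ≤ δ₁ := by positivity
  have hA2 : 0 ≤ A - 2 * Real.log (p κ) := by linarith
  have hδ0 : 0 ≤ δ := add_nonneg hδ1 (mul_nonneg hA2 hη)
  have hcm (t : ℕ) : Measurable fun ω => chain κ b w A B (fun s => Y s ω) t :=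
    (measurable_chain κ b w A B t).comp (measurable_pi_lambda _ hY)
  have hsm (t : ℕ) : Measurable fun ω =>
      slice κ w (chain κ b w A B (fun s => Y s ω) t) (Y t ω) :=
    (measurable_slice_prod κ w).comp ((hcm t).prodMk (hY t))
  -- one step, after integrating the new constraint first; a dead set keeps the potential `A`
  have hstep (t : ℕ) (ht : t < T) :
      ∫ ω, potential κ A B (t + 1) (chain κ b w A B (fun s => Y s ω) (t + 1)) ∂P ≤
        ρ * ∫ ω, potential κ A B t (chain κ b w A B (fun s => Y s ω) t) ∂P + δ := by
    have h1 := integral_comp_slice_chain hY hlaw hindep κ b w A B t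
      fun S => potential κ A B (t + 1) (kill κ b w A B (t + 1) S)
    have h2 := integral_comp_slice_chain hY hlaw hindep κ b w A B t
      ({S | B < energy κ b w (t + 1) S}.indicator 1)
    have hpt (D : Finset ι) (hD : D.Nonempty → Admissible κ b w A B t D) :
        ∫ x, potential κ A B (t + 1) (kill κ b w A B (t + 1) (slice κ w D x)) ∂(stdGaussian E) ≤
          ρ * potential κ A B t D + δ₁
          + (A - 2 * Real.log (p κ)) *
            ∫ x, {S | B < energy κ b w (t + 1) S}.indicator 1 (slice κ w D x)
              ∂(stdGaussian E) := by
      have e : ∫ x, {S | B < energy κ b w (t + 1) S}.indicator (1 : Finset ι → ℝ) (slice κ w D x)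
          ∂(stdGaussian E) =
          (stdGaussian E).real {x | B < energy κ b w (t + 1) (slice κ w D x)} := by
        rw [← integral_indicator_one]
        · rfl
        · exact measurable_slice κ w D (DiscreteMeasurableSpace.forall_measurableSet
            {S | B < energy κ b w (t + 1) S})
      rw [e]
      rcases D.eq_empty_or_nonempty with rfl | hne
      · have h3 : kill κ b w A B (t + 1) (∅ : Finset ι) = ∅ := by
          simp [kill]
        simp only [slice_empty, h3, potential_empty, integral_const, probReal_univ, smul_eq_mul,
          one_mul]
        have := mul_le_mul_of_nonneg_right hρ1 hA
        have := mul_nonneg hA2 (measureReal_nonneg (μ := stdGaussian E)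
          (s := {x : E | B < energy κ b w (t + 1) (∅ : Finset ι)}))
        linarith
      · exact integral_potential_slice_le hκ hb hB0 hA hc hcp hw hC hsmall (hD hne)
    have h3 : P.real {ω | B < energy κ b w (t + 1)
        (slice κ w (chain κ b w A B (fun s => Y s ω) t) (Y t ω))} ≤ η := by
      refine (measureReal_mono fun ω hω => ?_).trans (henergy (t + 1) ht)
      rw [Set.mem_ofPred_eq] at hω ⊢
      rcases (chain κ b w A B (fun s => Y s ω) t).eq_empty_or_nonempty with h | h
      · rw [h, slice_empty, energy_empty] at hω
        linarith
      · rwa [chain_eq_survivors h] at hω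
    have h4 : ∫ ω, {S | B < energy κ b w (t + 1) S}.indicator (1 : Finset ι → ℝ)
        (slice κ w (chain κ b w A B (fun s => Y s ω) t) (Y t ω)) ∂P ≤ η := by
      refine le_trans (le_of_eq ?_) h3
      rw [← integral_indicator_one]
      · rfl
      · exact hsm t (DiscreteMeasurableSpace.forall_measurableSet
          {S | B < energy κ b w (t + 1) S})
    have i1 := integrable_comp_finset (P := P) (hcm t) (potential κ A B t)
    have i2 := integrable_comp_finset (P := P) (hcm t) fun D =>
      ∫ x, {S | B < energy κ b w (t + 1) S}.indicator (1 : Finset ι → ℝ) (slice κ w D x)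
        ∂(stdGaussian E)
    have i3 : Integrable (fun ω => ρ * potential κ A B t (chain κ b w A B (fun s => Y s ω) t) +
        δ₁) P := (i1.const_mul ρ).add (integrable_const _)
    calc _ = ∫ ω, ∫ x, potential κ A B (t + 1) (kill κ b w A B (t + 1)
            (slice κ w (chain κ b w A B (fun s => Y s ω) t) x)) ∂(stdGaussian E) ∂P := h1
      _ ≤ ∫ ω, (ρ * potential κ A B t (chain κ b w A B (fun s => Y s ω) t)
          + δ₁
          + (A - 2 * Real.log (p κ)) *
            ∫ x, {S | B < energy κ b w (t + 1) S}.indicator 1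
              (slice κ w (chain κ b w A B (fun s => Y s ω) t) x) ∂(stdGaussian E)) ∂P := by
          refine integral_mono (integrable_comp_finset (hcm t) fun D => ∫ x,
            potential κ A B (t + 1) (kill κ b w A B (t + 1) (slice κ w D x)) ∂(stdGaussian E))
            (i3.add (i2.const_mul _)) fun ω => hpt _ admissible_chain
      _ ≤ _ := by
          rw [integral_add i3 (i2.const_mul _), integral_add (i1.const_mul ρ) (integrable_const _),
            integral_const_mul ρ, integral_const_mul (A - 2 * Real.log (p κ)), ← h2, hδ]
          have := mul_le_mul_of_nonneg_left h4 hA2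
          simp only [integral_const, probReal_univ, smul_eq_mul, one_mul]
          linarith
  have hmain (t : ℕ) (ht : t ≤ T) :
      ∫ ω, potential κ A B t (chain κ b w A B (fun s => Y s ω) t) ∂P ≤
        ρ ^ t * (Real.log B + t * δ) := by
    induction t with
    | zero =>
      have h0 : density κ 0 (Finset.univ : Finset ι) = 1 := by
        have : (0 : ℝ) < Fintype.card ι := Nat.cast_pos.2 Fintype.card_pos
        rw [density, pow_zero, mul_one, Finset.card_univ, div_self this.ne']
      have hL : logDefect κ B 0 (Finset.univ : Finset ι) = Real.log B := by
        rw [logDefect, h0]; simp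
      have h1 : Admissible κ b w A B 0 (Finset.univ : Finset ι) :=
        ⟨Finset.univ_nonempty, hinit, by rwa [hL]⟩
      simp only [chain, kill_of_admissible h1, potential_of_nonempty _ _ _ _ h1.1, hL]
      simp
    | succ t ih =>
      refine (hstep t ht).trans ?_
      have h1 := mul_le_mul_of_nonneg_left (ih (by omega)) (by linarith : 0 ≤ ρ)
      have h2 : 1 ≤ ρ ^ (t + 1) := one_le_pow₀ hρ1
      have h3 := mul_le_mul_of_nonneg_right h2 hδ0
      push_cast
      have e : ρ ^ (t + 1) * (Real.log B + (t + 1) * δ) =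
          ρ * (ρ ^ t * (Real.log B + t * δ)) + ρ ^ (t + 1) * δ := by ring
      rw [e]
      linarith
  have hnonneg (ω : Ω) : 0 ≤ potential κ A B T (chain κ b w A B (fun s => Y s ω) T) := by
    rcases (chain κ b w A B (fun s => Y s ω) T).eq_empty_or_nonempty with h | h
    · rw [h, potential_empty]
      exact hA
    · have := admissible_chain h
      rw [potential_of_nonempty _ _ _ _ h]
      exact logDefect_nonneg hκ hb.le hB0 h this.2.1
  have hmark := mul_meas_ge_le_integral_of_nonneg (μ := P) (Eventually.of_forall hnonneg)
    (integrable_comp_finset (hcm T) (potential κ A B T)) A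
  refine le_trans ?_ (hmark.trans (hmain T le_rfl))
  rw [mul_comm]
  refine mul_le_mul_of_nonneg_left (measureReal_mono fun ω hω => ?_) hA
  rw [Set.mem_ofPred_eq] at hω ⊢
  rcases (chain κ b w A B (fun s => Y s ω) T).eq_empty_or_nonempty with h | h
  · rw [h, potential_empty]
  · exfalso
    have h1 := admissible_chain h
    have h2 := chain_eq_survivors h
    rw [h2] at h h1
    rcases hω with hω | hω
    · rw [hω] at h
      exact Finset.not_nonempty_empty h
    · linarith [h1.2.2]

end Chain

/-! ### First and second moments on the cube -/

section Moments

variable {E : Type*} [NormedAddCommGroup E] [InnerProductSpace ℝ E] {ι : Type*} [Fintype ι]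
  [MeasurableSpace E] [FiniteDimensional ℝ E]
  {Ω : Type*} [MeasurableSpace Ω] {P : Measure Ω} {Y : ℕ → Ω → E}

lemma measureReal_forall_mem (hY : ∀ t, Measurable (Y t))
    (hlaw : ∀ t, P.map (Y t) = stdGaussian E) (hindep : iIndepFun Y P) {A : Set E}
    (hA : MeasurableSet A) (t : ℕ) :
    P.real {ω | ∀ s < t, Y s ω ∈ A} = (stdGaussian E).real A ^ t := by
  have h := hindep.measure_inter_preimage_eq_mul (Finset.range t) (sets := fun _ => A)
    fun _ _ => hA
  have e : {ω | ∀ s < t, Y s ω ∈ A} = ⋂ s ∈ Finset.range t, Y s ⁻¹' A := by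
    ext ω
    simp
  rw [e, measureReal_def, h, ENNReal.toReal_prod]
  have h2 (s : ℕ) : (P (Y s ⁻¹' A)).toReal = (stdGaussian E).real A := by
    rw [← hlaw s, measureReal_def, Measure.map_apply (hY s) hA]
  simp [h2]

variable [BorelSpace E]

lemma measureReal_mem_survivors (hY : ∀ t, Measurable (Y t))
    (hlaw : ∀ t, P.map (Y t) = stdGaussian E) (hindep : iIndepFun Y P) (κ : ℝ) (w : ι → E)
    (i j : ι) (t : ℕ) :
    P.real {ω | i ∈ survivors κ w (fun s => Y s ω) t ∧ j ∈ survivors κ w (fun s => Y s ω) t} =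
      (stdGaussian E).real {y | |⟪w i, y⟫| ≤ κ ∧ |⟪w j, y⟫| ≤ κ} ^ t := by
  rw [← measureReal_forall_mem hY hlaw hindep (measurableSet_and (measurableSet_slab_inner κ (w i))
    (measurableSet_slab_inner κ (w j)))]
  congr 1
  ext ω
  simp only [Set.mem_ofPred_eq, mem_survivors]
  exact ⟨fun h s hs => ⟨h.1 s hs, h.2 s hs⟩, fun h => ⟨fun s hs => (h s hs).1,
    fun s hs => (h s hs).2⟩⟩

variable [IsProbabilityMeasure P]

lemma integral_card_survivors (hY : ∀ t, Measurable (Y t))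
    (hlaw : ∀ t, P.map (Y t) = stdGaussian E) (hindep : iIndepFun Y P) (κ : ℝ) {w : ι → E}
    (hw : ∀ i, ‖w i‖ = 1) (t : ℕ) :
    ∫ ω, ((survivors κ w (fun s => Y s ω) t).card : ℝ) ∂P = Fintype.card ι * p κ ^ t := by
  classical
  have hsm : Measurable fun ω => survivors κ w (fun s => Y s ω) t :=
    (measurable_survivors κ w t).comp (measurable_pi_lambda _ hY)
  have hm (i : ι) : MeasurableSet {ω | i ∈ survivors κ w (fun s => Y s ω) t} :=
    hsm (DiscreteMeasurableSpace.forall_measurableSet {D | i ∈ D})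
  have hi (i : ι) : Integrable ({ω | i ∈ survivors κ w (fun s => Y s ω) t}.indicator
      (1 : Ω → ℝ)) P := (integrable_const (1 : ℝ)).indicator (hm i)
  have e (ω : Ω) : ((survivors κ w (fun s => Y s ω) t).card : ℝ) =
      ∑ i, {ω | i ∈ survivors κ w (fun s => Y s ω) t}.indicator 1 ω := by
    simp [Set.indicator_apply]
  simp_rw [e]
  rw [integral_finsetSum _ fun i _ => hi i]
  have h (i : ι) := measureReal_mem_survivors hY hlaw hindep κ w i i t
  simp only [and_self, stdGaussian_slab (hw _)] at h
  simp_rw [integral_indicator_one (hm _), h]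
  simp

lemma integral_energy_survivors (hY : ∀ t, Measurable (Y t))
    (hlaw : ∀ t, P.map (Y t) = stdGaussian E) (hindep : iIndepFun Y P) (κ b : ℝ) (w : ι → E)
    (t : ℕ) :
    ∫ ω, energy κ b w t (survivors κ w (fun s => Y s ω) t) ∂P =
      (∑ i, ∑ j, Real.exp (b * ⟪w i, w j⟫ ^ 2) *
        (stdGaussian E).real {y | |⟪w i, y⟫| ≤ κ ∧ |⟪w j, y⟫| ≤ κ} ^ t) /
        (Fintype.card ι * p κ ^ t) ^ 2 := by
  classical
  have hsm : Measurable fun ω => survivors κ w (fun s => Y s ω) t :=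
    (measurable_survivors κ w t).comp (measurable_pi_lambda _ hY)
  have hm (i j : ι) : MeasurableSet {ω | i ∈ survivors κ w (fun s => Y s ω) t ∧
      j ∈ survivors κ w (fun s => Y s ω) t} :=
    hsm (DiscreteMeasurableSpace.forall_measurableSet {D | i ∈ D ∧ j ∈ D})
  have hi (i j : ι) : Integrable (fun ω => Real.exp (b * ⟪w i, w j⟫ ^ 2) *
      {ω | i ∈ survivors κ w (fun s => Y s ω) t ∧
      j ∈ survivors κ w (fun s => Y s ω) t}.indicator (1 : Ω → ℝ) ω) P :=
    ((integrable_const (1 : ℝ)).indicator (hm i j)).const_mul _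
  have e (ω : Ω) : ∑ i ∈ survivors κ w (fun s => Y s ω) t, ∑ j ∈ survivors κ w (fun s => Y s ω) t,
      Real.exp (b * ⟪w i, w j⟫ ^ 2) =
      ∑ i, ∑ j, Real.exp (b * ⟪w i, w j⟫ ^ 2) * {ω | i ∈ survivors κ w (fun s => Y s ω) t ∧
      j ∈ survivors κ w (fun s => Y s ω) t}.indicator 1 ω := by
    simp [Set.indicator_apply, ite_and]
  simp_rw [energy]
  rw [integral_div]
  simp_rw [e]
  rw [integral_finsetSum _ fun i _ => integrable_finsetSum _ fun j _ => hi i j]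
  congr 1
  refine Finset.sum_congr rfl fun i _ => ?_
  rw [integral_finsetSum _ fun j _ => hi i j]
  refine Finset.sum_congr rfl fun j _ => ?_
  rw [integral_const_mul, integral_indicator_one (hm i j),
    measureReal_mem_survivors hY hlaw hindep κ w i j t]

end Moments

/-- The normalised vector `σ / √N` of a point of the cube. -/
noncomputable def cubeVec {N : ℕ} (σ : Cube N) : EuclideanSpace ℝ (Fin N) :=
  WithLp.toLp 2 fun j => ((σ j : ℤ) : ℝ) / √(N : ℝ)

/-- The fraction of coordinates on which two points of the cube agree. -/
noncomputable def agreement {N : ℕ} (σ τ : Cube N) : ℝ :=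
  ((Finset.univ.filter fun j => σ j = τ j).card : ℝ) / N

lemma inner_cubeVec {N : ℕ} (σ : Cube N) (x : EuclideanSpace ℝ (Fin N)) :
    ⟪cubeVec σ, x⟫ = dot x σ / √(N : ℝ) := by
  simp only [cubeVec, dot, PiLp.inner_apply, Finset.sum_div]
  refine Finset.sum_congr rfl fun j _ => ?_
  simp
  ring

lemma mem_slab_iff {N : ℕ} (hN : 0 < N) (κ : ℝ) (σ : Cube N) (x : EuclideanSpace ℝ (Fin N)) :
    σ ∈ slab κ x ↔ |⟪cubeVec σ, x⟫| ≤ κ := by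
  have h : 0 < √(N : ℝ) := Real.sqrt_pos.2 (Nat.cast_pos.2 hN)
  rw [inner_cubeVec, abs_div, abs_of_pos h, div_le_iff₀ h, slab, Set.mem_ofPred_eq]

lemma coe_survivors {N : ℕ} (hN : 0 < N) (κ : ℝ) (x : ℕ → EuclideanSpace ℝ (Fin N)) (t : ℕ) :
    (survivors κ (cubeVec (N := N)) x t : Set (Cube N)) = solutions κ t x := by
  ext σ
  simp [mem_survivors, solutions, mem_slab_iff hN]

lemma inner_cubeVec_cubeVec {N : ℕ} (hN : 0 < N) (σ τ : Cube N) :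
    ⟪cubeVec σ, cubeVec τ⟫ = 2 * agreement σ τ - 1 := by
  have hN' : (0 : ℝ) < N := Nat.cast_pos.2 hN
  have h1 : ∀ j, ((τ j : ℤ) : ℝ) * ((σ j : ℤ) : ℝ) = 2 * (if σ j = τ j then 1 else 0) - 1 := by
    intro j
    rcases Int.units_eq_one_or (σ j) with h | h <;>
      rcases Int.units_eq_one_or (τ j) with h' | h' <;> norm_num [h, h']
  have h2 : dot (cubeVec τ) σ =
      (2 * (Finset.univ.filter fun j => σ j = τ j).card - N) / √(N : ℝ) := by
    have e (j : Fin N) : cubeVec τ j * ((σ j : ℤ) : ℝ) =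
        (2 * (if σ j = τ j then 1 else 0) - 1) / √(N : ℝ) := by
      rw [← h1, cubeVec]
      simp
      ring
    simp_rw [dot, e]
    rw [← Finset.sum_div, Finset.sum_sub_distrib, ← Finset.mul_sum]
    simp
  rw [inner_cubeVec, h2, div_div, Real.mul_self_sqrt hN'.le, agreement]
  field_simp

lemma norm_cubeVec {N : ℕ} (hN : 0 < N) (σ : Cube N) : ‖cubeVec σ‖ = 1 := by
  have h := inner_cubeVec_cubeVec hN σ σ
  have hN' : (N : ℝ) ≠ 0 := (Nat.cast_pos.2 hN).ne'
  rw [real_inner_self_eq_norm_sq] at h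
  have e : agreement σ σ = 1 := by simp [agreement, hN']
  rw [e] at h
  have h2 : ‖cubeVec σ‖ ^ 2 = 1 := by linarith
  exact (pow_eq_one_iff_of_nonneg (norm_nonneg _) two_ne_zero).1 h2

/-- Points of the cube correspond to their sets of agreements with a fixed point. -/
lemma sum_agreement {N : ℕ} (σ : Cube N) (f : ℝ → ℝ) :
    ∑ τ, f (agreement σ τ) = ∑ k ∈ Finset.range (N + 1), (N.choose k : ℝ) * f (k / N) := by
  have hinj : Function.Injective fun τ : Cube N => Finset.univ.filter fun j => σ j = τ j := by
    intro τ τ' h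
    funext j
    have hj := Finset.ext_iff.1 h j
    simp only [Finset.mem_filter, Finset.mem_univ, true_and] at hj
    rcases Int.units_eq_one_or (σ j) with h1 | h1 <;>
      rcases Int.units_eq_one_or (τ j) with h2 | h2 <;>
      rcases Int.units_eq_one_or (τ' j) with h3 | h3 <;> simp_all
  have hbij := (Fintype.bijective_iff_injective_and_card _).2 ⟨hinj, by simp⟩
  have h1 := Fintype.sum_bijective _ hbij (fun τ => f (agreement σ τ))
    (fun s : Finset (Fin N) => f ((s.card : ℝ) / N)) fun τ => rfl
  have h2 := Finset.sum_powerset_apply_card (fun k : ℕ => f ((k : ℝ) / N))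
    (x := (Finset.univ : Finset (Fin N)))
  rw [h1, ← Finset.powerset_univ, h2]
  simp

/-- The binomial expansion of `(β + (1 - β)) ^ N` at `β = k / N` has a single term at most one. -/
lemma choose_le_exp_binEntropy {N k : ℕ} (hN : 0 < N) (hk : k ≤ N) :
    (N.choose k : ℝ) ≤ Real.exp (N * Real.binEntropy (k / N)) := by
  have hN' : (0 : ℝ) < N := Nat.cast_pos.2 hN
  rcases Nat.eq_zero_or_pos k with rfl | hk0
  · simp
  rcases hk.eq_or_lt with rfl | hkN
  · simp [hN'.ne']
  set β : ℝ := k / N with hβ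
  have hβ0 : 0 < β := div_pos (Nat.cast_pos.2 hk0) hN'
  have hβ1 : 0 < 1 - β := by
    rw [sub_pos, hβ, div_lt_one hN']
    exact_mod_cast hkN
  have h1 : β ^ k * (1 - β) ^ (N - k) * (N.choose k : ℝ) ≤ 1 := by
    have h2 := add_pow β (1 - β) N
    rw [add_sub_cancel, one_pow] at h2
    refine le_trans ?_ h2.symm.le
    exact Finset.single_le_sum (f := fun m => β ^ m * (1 - β) ^ (N - m) * (N.choose m : ℝ))
      (fun m _ => by positivity) (Finset.mem_range.2 (by omega))
  have h3 : β ^ k * (1 - β) ^ (N - k) = Real.exp (-(N * Real.binEntropy β)) := by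
    have e1 : β ^ k = Real.exp (k * Real.log β) := by rw [Real.exp_nat_mul, Real.exp_log hβ0]
    have e2 : (1 - β) ^ (N - k) = Real.exp ((N - k : ℕ) * Real.log (1 - β)) := by
      rw [Real.exp_nat_mul, Real.exp_log hβ1]
    rw [e1, e2, ← Real.exp_add, Real.binEntropy, Real.log_inv, Real.log_inv, Nat.cast_sub hk]
    congr 1
    have : (k : ℝ) = N * β := by rw [hβ]; field_simp
    rw [this]
    ring
  rw [h3, Real.exp_neg, inv_mul_le_iff₀ (Real.exp_pos _), mul_one] at h1
  exact h1

/-- Second-moment bound: with the quadratic gap of `F` at `1/2` as tilt, each overlap value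
contributes at most one to the mean energy. -/
lemma sum_pair_le {κ α c : ℝ} (hκ : 0 < κ)
    (hgap : ∀ β ∈ Set.Icc (0 : ℝ) 1, F κ α β ≤ F κ α (1 / 2) - c * (2 * β - 1) ^ 2)
    {N t : ℕ} (hN : 0 < N) (ht : t ≤ α * N) :
    (∑ σ : Cube N, ∑ τ : Cube N, Real.exp (c * N * ⟪cubeVec σ, cubeVec τ⟫ ^ 2) *
        (stdGaussian (EuclideanSpace ℝ (Fin N))).real
          {y | |⟪cubeVec σ, y⟫| ≤ κ ∧ |⟪cubeVec τ, y⟫| ≤ κ} ^ t) /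
        (Fintype.card (Cube N) * p κ ^ t) ^ 2 ≤ N + 1 := by
  have hp := p_pos hκ
  have hN' : (0 : ℝ) < N := Nat.cast_pos.2 hN
  have hcard : (Fintype.card (Cube N) : ℝ) = 2 ^ N := by simp
  have h1 (σ : Cube N) : ∑ τ : Cube N, Real.exp (c * N * ⟪cubeVec σ, cubeVec τ⟫ ^ 2) *
        (stdGaussian (EuclideanSpace ℝ (Fin N))).real
          {y | |⟪cubeVec σ, y⟫| ≤ κ ∧ |⟪cubeVec τ, y⟫| ≤ κ} ^ t ≤
      (N + 1) * (2 ^ N * (p κ ^ t) ^ 2) := by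
    have e (τ : Cube N) : Real.exp (c * N * ⟪cubeVec σ, cubeVec τ⟫ ^ 2) *
        (stdGaussian (EuclideanSpace ℝ (Fin N))).real
          {y | |⟪cubeVec σ, y⟫| ≤ κ ∧ |⟪cubeVec τ, y⟫| ≤ κ} ^ t =
        (fun β => Real.exp (c * N * (2 * β - 1) ^ 2) * q κ β ^ t) (agreement σ τ) := by
      rw [inner_cubeVec_cubeVec hN, ← q_eq_stdGaussian (norm_cubeVec hN σ) (norm_cubeVec hN τ) κ
        (inner_cubeVec_cubeVec hN σ τ)]
    simp_rw [e]
    rw [sum_agreement σ fun β => Real.exp (c * N * (2 * β - 1) ^ 2) * q κ β ^ t]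
    have hterm : ∀ k ∈ Finset.range (N + 1), (N.choose k : ℝ) *
        (Real.exp (c * N * (2 * (k / N : ℝ) - 1) ^ 2) * q κ (k / N) ^ t) ≤
        2 ^ N * (p κ ^ t) ^ 2 := by
      intro k hk
      have hkN : k ≤ N := by
        have := Finset.mem_range.1 hk
        omega
      have hβ : (k / N : ℝ) ∈ Set.Icc (0 : ℝ) 1 :=
        ⟨by positivity, div_le_one_of_le₀ (by exact_mod_cast hkN) hN'.le⟩
      have hch := choose_le_exp_binEntropy hN hkN
      have hg := hgap _ hβ
      generalize (k / N : ℝ) = β at *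
      have hq := q_pos hκ hβ
      -- replacing the number of constraints by `αN` only increases the pair correlation
      have hqp : 0 ≤ Real.log (q κ β) - 2 * Real.log (p κ) := by
        have h2 := Real.log_le_log (pow_pos hp 2) (sq_p_le_q hκ hβ)
        rw [Real.log_pow] at h2
        push_cast at h2
        linarith
      have hq2 : q κ β ^ t = Real.exp (t * Real.log (q κ β)) := by
        rw [Real.exp_nat_mul, Real.exp_log hq]
      have hp2 : (p κ ^ t) ^ 2 = Real.exp (t * (2 * Real.log (p κ))) := by
        rw [← pow_mul, mul_comm t 2, pow_mul, Real.exp_nat_mul, mul_comm 2, Real.exp_mul,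
          Real.exp_log hp]
        norm_num
      have h2N : (2 : ℝ) ^ N = Real.exp (N * Real.log 2) := by
        rw [Real.exp_nat_mul, Real.exp_log two_pos]
      rw [hq2, hp2, h2N, ← Real.exp_add, ← Real.exp_add]
      refine (mul_le_mul_of_nonneg_right hch (Real.exp_pos _).le).trans ?_
      rw [← Real.exp_add]
      refine Real.exp_le_exp.2 ?_
      rw [F_half hκ, F] at hg
      have h3 := mul_le_mul_of_nonneg_right ht hqp
      have h4 := mul_le_mul_of_nonneg_left hg hN'.le
      nlinarith
    refine (Finset.sum_le_sum hterm).trans (le_of_eq ?_)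
    simp
  rw [hcard, div_le_iff₀ (by positivity)]
  refine (Finset.sum_le_sum fun σ _ => h1 σ).trans (le_of_eq ?_)
  rw [Finset.sum_const, nsmul_eq_mul, Finset.card_univ, hcard]
  ring

/-! ### Conclusion -/

/-- The threshold density is where the exponential growth rate of the mean number of solutions
changes sign. -/
lemma log_two_add_mul_log_p_neg {κ α : ℝ} (hκ : 0 < κ) (hα : alphaC κ < α) :
    Real.log 2 + α * Real.log (p κ) < 0 := by
  have h := log_p_neg hκ
  rw [alphaC, div_lt_iff_of_neg h] at hα
  linarith

lemma abs_floor_mul_log_sub_le {κ α : ℝ} (hκ : 0 < κ) (hα : 0 ≤ α) (N : ℕ) :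
    |(⌊α * N⌋₊ : ℝ) * Real.log (p κ) - α * N * Real.log (p κ)| ≤ -Real.log (p κ) := by
  have h := log_p_neg hκ
  have h1 := Nat.floor_le (by positivity : 0 ≤ α * N)
  have h2 := Nat.lt_floor_add_one (α * N)
  rw [← sub_mul, abs_mul, abs_of_neg h, abs_of_nonpos (by linarith)]
  nlinarith

section FixedDimension

variable {Ω : Type*} [MeasurableSpace Ω] {P : Measure Ω} [IsProbabilityMeasure P] {N : ℕ}
  {Y : ℕ → Ω → EuclideanSpace ℝ (Fin N)}

lemma measureReal_le_card_survivors_mul_le (hN : 0 < N) (hY : ∀ t, Measurable (Y t))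
    (hlaw : ∀ t, P.map (Y t) = stdGaussian (EuclideanSpace ℝ (Fin N)))
    (hindep : iIndepFun Y P) (κ : ℝ) (t : ℕ) (a : ℝ) :
    a * P.real {ω | a ≤ ((survivors κ (cubeVec (N := N)) (fun s => Y s ω) t).card : ℝ)} ≤
      2 ^ N * p κ ^ t := by
  have hsm : Measurable fun ω => survivors κ (cubeVec (N := N)) (fun s => Y s ω) t :=
    (measurable_survivors κ cubeVec t).comp (measurable_pi_lambda _ hY)
  have h := mul_meas_ge_le_integral_of_nonneg (μ := P)
    (f := fun ω => ((survivors κ (cubeVec (N := N)) (fun s => Y s ω) t).card : ℝ))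
    (Eventually.of_forall fun ω => by positivity)
    (integrable_comp_finset hsm fun D => (D.card : ℝ)) a
  rw [integral_card_survivors hY hlaw hindep κ (norm_cubeVec hN) t] at h
  simpa using h

lemma measureReal_energy_le (hN : 0 < N) (hY : ∀ t, Measurable (Y t))
    (hlaw : ∀ t, P.map (Y t) = stdGaussian (EuclideanSpace ℝ (Fin N)))
    (hindep : iIndepFun Y P) {κ α c : ℝ} (hκ : 0 < κ)
    (hgap : ∀ β ∈ Set.Icc (0 : ℝ) 1, F κ α β ≤ F κ α (1 / 2) - c * (2 * β - 1) ^ 2)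
    {t : ℕ} (ht : t ≤ α * N) {B : ℝ} (hB : 0 < B) :
    P.real {ω | B < energy κ (c * N) cubeVec t
      (survivors κ (cubeVec (N := N)) (fun s => Y s ω) t)} ≤ (N + 1) / B := by
  have hp := p_pos hκ
  have hsm : Measurable fun ω => survivors κ (cubeVec (N := N)) (fun s => Y s ω) t :=
    (measurable_survivors κ cubeVec t).comp (measurable_pi_lambda _ hY)
  have h := mul_meas_ge_le_integral_of_nonneg (μ := P)
    (f := fun ω => energy κ (c * N) cubeVec t
      (survivors κ (cubeVec (N := N)) (fun s => Y s ω) t))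
    (Eventually.of_forall fun ω => by unfold energy; positivity)
    (integrable_comp_finset hsm (energy κ (c * N) cubeVec t)) B
  rw [integral_energy_survivors hY hlaw hindep κ (c * N) cubeVec t] at h
  rw [le_div_iff₀' hB]
  refine le_trans (mul_le_mul_of_nonneg_left (measureReal_mono fun ω hω => ?_) hB.le)
    (h.trans (sum_pair_le hκ hgap hN ht))
  rw [Set.mem_ofPred_eq] at hω ⊢
  exact hω.le

/-- Non-asymptotic lower bound on the number of solutions, from the Gronwall bound with energy cap
`(N + 1) ^ 3`. -/
lemma measureReal_sparse_cube_mul_le (hN : 0 < N) (hY : ∀ t, Measurable (Y t))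
    (hlaw : ∀ t, P.map (Y t) = stdGaussian (EuclideanSpace ℝ (Fin N)))
    (hindep : iIndepFun Y P) {κ α c s c₀ A : ℝ} (hκ : 0 < κ) (hα : 0 ≤ α) (hc : 0 < c)
    (hgap : ∀ β ∈ Set.Icc (0 : ℝ) 1, F κ α β ≤ F κ α (1 / 2) - c * (2 * β - 1) ^ 2)
    (hc₀ : 0 < c₀) (hc₀p : c₀ ≤ p κ)
    (hs : c₀ ≤ gaussAvg s / 2 - Real.exp (-(s ^ 2 * κ ^ 2) / 2))
    (hA : 3 * Real.log (N + 1) ≤ A) :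
    P.real {ω | survivors κ (cubeVec (N := N)) (fun s => Y s ω) ⌊α * N⌋₊ = ∅ ∨
        A < logDefect κ ((N + 1) ^ 3) ⌊α * N⌋₊
          (survivors κ (cubeVec (N := N)) (fun s => Y s ω) ⌊α * N⌋₊)} * A ≤
      (1 + 2 * ((2 * κ ^ 2 + 4) / (c₀ * p κ)) / (c * N)) ^ ⌊α * N⌋₊ *
        (3 * Real.log (N + 1) + ⌊α * N⌋₊ * (A * (14256 * s ^ 6 *
          (∫ η, η ^ 6 ∂(gaussianReal 0 1)) / (gaussAvg s / 2) ^ 4 *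
            ((A + 2 * A ^ 2 + 4) / (c * N * √(c * N))))
          + (A - 2 * Real.log (p κ)) * ((N + 1) / (N + 1) ^ 3))) := by
  have hN' : (0 : ℝ) < N := Nat.cast_pos.2 hN
  have hlog : Real.log (((N : ℝ) + 1) ^ 3) = 3 * Real.log (N + 1) := by
    rw [Real.log_pow]; norm_num
  have hfl := Nat.floor_le (by positivity : 0 ≤ α * N)
  have hB1 : 1 ≤ ((N : ℝ) + 1) ^ 3 := one_le_pow₀ (by linarith)
  have hm := gaussAvg_pos s
  have h6 : 0 ≤ ∫ η, η ^ 6 ∂(gaussianReal 0 1) := integral_nonneg fun η => by positivity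
  have hinit : energy κ (c * N) (cubeVec (N := N)) 0 Finset.univ ≤ ((N : ℝ) + 1) ^ 3 := by
    have h1 := integral_energy_survivors hY hlaw hindep κ (c * N) (cubeVec (N := N)) 0
    simp only [survivors, integral_const, probReal_univ, smul_eq_mul, one_mul] at h1
    rw [h1]
    refine (sum_pair_le hκ hgap hN (by simp; positivity)).trans ?_
    nlinarith [sq_nonneg (N : ℝ)]
  have h := measureReal_sparse_mul_le (P := P) (Y := Y) (η := (N + 1) / (N + 1) ^ 3) hκ
    (mul_pos hc hN') hB1 (hlog.le.trans hA) hc₀ hc₀p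
    (norm_cubeVec hN) (C := 14256 * s ^ 6 * (∫ η, η ^ 6 ∂(gaussianReal 0 1)) /
      (gaussAvg s / 2) ^ 4) (by positivity)
    (fun D hD => measureReal_card_slice_lt_le hκ.le hs D hD cubeVec (norm_cubeVec hN)) hY hlaw hindep
    ⌊α * N⌋₊ (by positivity) hinit
    (fun t ht => measureReal_energy_le hN hY hlaw hindep hκ hgap
      ((Nat.cast_le.2 ht).trans hfl) (by positivity))
  rwa [hlog] at h

end FixedDimension

lemma tendsto_log_pow_three_div_sqrt :
    Tendsto (fun N : ℕ => Real.log N ^ 3 / √(N : ℝ)) atTop (𝓝 0) := by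
  have h := (isLittleO_log_rpow_rpow_atTop (s := 1 / 2) 3 (by norm_num)).tendsto_div_nhds_zero
  refine (h.comp tendsto_natCast_atTop_atTop).congr fun N => ?_
  simp only [Function.comp_apply, Real.sqrt_eq_rpow]
  norm_cast

/-- The right-hand side of the Gronwall bound is of the order of `log N`: the growth factor is at most
`exp (C₁ α / c)`, and the errors of all steps together are `O((log N)³ / √N)`. -/
lemma eventually_gronwall_le {α c C₁ C₂ l A' : ℝ} (hα : 0 < α) (hc : 0 < c) (hC₁ : 0 ≤ C₁)
    (hC₂ : 0 ≤ C₂) (hl : 0 ≤ l) (hA' : 1 ≤ A') :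
    ∀ᶠ N : ℕ in atTop, (1 + C₁ / (c * N)) ^ ⌊α * N⌋₊ * (3 * Real.log (N + 1) + ⌊α * N⌋₊ *
        (A' * Real.log N * (C₂ * ((A' * Real.log N + 2 * (A' * Real.log N) ^ 2 + 4) /
            (c * N * √(c * N))))
          + (A' * Real.log N + l) * ((N + 1) / (N + 1) ^ 3))) ≤
      7 * Real.exp (C₁ * α / c) * Real.log N := by
  have hlim : Tendsto (fun N : ℕ => (α * C₂ * 7 * A' ^ 3 / (c * √c) + α * (A' + l)) *
      (Real.log N ^ 3 / √(N : ℝ))) atTop (𝓝 0) := by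
    simpa using tendsto_log_pow_three_div_sqrt.const_mul
      (α * C₂ * 7 * A' ^ 3 / (c * √c) + α * (A' + l))
  filter_upwards [hlim.eventually_le_const one_pos, eventually_ge_atTop 3] with N hN hN3
  have hN3' : (3 : ℝ) ≤ N := by exact_mod_cast hN3
  have hL : 1 ≤ Real.log N := by
    rw [Real.le_log_iff_exp_le (by linarith)]
    linarith [Real.exp_one_lt_d9]
  have hfl := Nat.floor_le (by positivity : 0 ≤ α * N)
  have hsc := Real.sqrt_pos.2 hc
  have hsN : 1 ≤ √(N : ℝ) := Real.one_le_sqrt.2 (by linarith)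
  have hsN2 : √(N : ℝ) ^ 2 = N := Real.sq_sqrt (by linarith)
  have h1 : (1 + C₁ / (c * N)) ^ ⌊α * N⌋₊ ≤ Real.exp (C₁ * α / c) := by
    have h0 : 1 + C₁ / (c * N) ≤ Real.exp (C₁ / (c * N)) := by
      rw [add_comm]
      exact Real.add_one_le_exp _
    refine (pow_le_pow_left₀ (by positivity) h0 _).trans ?_
    rw [← Real.exp_nat_mul]
    refine Real.exp_le_exp.2 ?_
    calc (⌊α * N⌋₊ : ℝ) * (C₁ / (c * N)) ≤ α * N * (C₁ / (c * N)) := by gcongr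
      _ = C₁ * α / c := by field_simp
  have h2 : 3 * Real.log ((N : ℝ) + 1) ≤ 6 * Real.log N := by
    have : Real.log ((N : ℝ) + 1) ≤ Real.log ((N : ℝ) ^ 2) :=
      Real.log_le_log (by positivity) (by nlinarith)
    rw [Real.log_pow] at this
    push_cast at this
    linarith
  generalize Real.log (N : ℝ) = L at *
  have hA1 : 1 ≤ A' * L := one_le_mul_of_one_le_of_one_le hA' hL
  have h3 : A' * L * (C₂ * ((A' * L + 2 * (A' * L) ^ 2 + 4) / (c * N * √(c * N)))) ≤
      C₂ * 7 * A' ^ 3 / (c * √c) * (L ^ 3 / √(N : ℝ)) / N := by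
    have e1 : C₂ * 7 * A' ^ 3 / (c * √c) * (L ^ 3 / √(N : ℝ)) / N =
        A' * L * (C₂ * ((7 * (A' * L) ^ 2) / (c * N * √(c * N)))) := by
      rw [Real.sqrt_mul hc.le]
      field_simp
    rw [e1]
    gcongr
    nlinarith
  have h4 : (A' * L + l) * (((N : ℝ) + 1) / (N + 1) ^ 3) ≤ (A' + l) * (L ^ 3 / √(N : ℝ)) / N := by
    have e1 : ((N : ℝ) + 1) / (N + 1) ^ 3 ≤ 1 / √(N : ℝ) / N := by
      rw [div_div, div_le_div_iff₀ (by positivity) (by positivity)]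
      have : √(N : ℝ) * N ≤ N * N := by
        gcongr
        nlinarith
      nlinarith
    have e2 : A' * L + l ≤ (A' + l) * L ^ 3 := by
      have : L ≤ L ^ 3 := le_self_pow₀ hL (by norm_num)
      have h5 : 1 ≤ L ^ 3 := one_le_pow₀ hL
      nlinarith
    calc _ ≤ (A' + l) * L ^ 3 * (1 / √(N : ℝ) / N) := by gcongr
      _ = _ := by ring
  have h5 : (⌊α * N⌋₊ : ℝ) * (A' * L * (C₂ * ((A' * L + 2 * (A' * L) ^ 2 + 4) /
            (c * N * √(c * N)))) + (A' * L + l) * (((N : ℝ) + 1) / (N + 1) ^ 3)) ≤ 1 := by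
    refine le_trans ?_ hN
    calc _ ≤ α * N * (C₂ * 7 * A' ^ 3 / (c * √c) * (L ^ 3 / √(N : ℝ)) / N +
          (A' + l) * (L ^ 3 / √(N : ℝ)) / N) := by gcongr
      _ = _ := by
        have : (N : ℝ) ≠ 0 := by positivity
        field_simp
  calc _ ≤ Real.exp (C₁ * α / c) * (6 * L + L) := by
        have h6 : 0 ≤ Real.log ((N : ℝ) + 1) := Real.log_nonneg (by linarith)
        exact mul_le_mul h1 (by linarith) (by positivity) (Real.exp_pos _).le
    _ = _ := by ring

section FixedDimension

variable {Ω : Type*} [MeasurableSpace Ω] {P : Measure Ω} [IsProbabilityMeasure P] {N : ℕ}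
  {Y : ℕ → Ω → EuclideanSpace ℝ (Fin N)}

lemma log_density_survivors {κ : ℝ} (hκ : 0 < κ) {t : ℕ} {D : Finset (Cube N)}
    (hD : D.Nonempty) :
    Real.log (density κ t D) =
      Real.log D.card - (N * Real.log 2 + t * Real.log (p κ)) := by
  have hp := p_pos hκ
  have h1 : (D.card : ℝ) ≠ 0 := (Nat.cast_pos.2 hD.card_pos).ne'
  rw [density, Real.log_div h1 (by positivity), Real.log_mul (by positivity) (by positivity),
    Real.log_pow]
  simp

lemma measurable_solutions (hN : 0 < N) (hY : ∀ t, Measurable (Y t)) (κ : ℝ) (t : ℕ)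
    (q : Set (Cube N) → Prop) : MeasurableSet {ω | q (solutions κ t fun i => Y i ω)} := by
  have hsm : Measurable fun ω => survivors κ (cubeVec (N := N)) (fun s => Y s ω) t :=
    (measurable_survivors κ cubeVec t).comp (measurable_pi_lambda _ hY)
  simp_rw [← coe_survivors hN]
  exact hsm (DiscreteMeasurableSpace.forall_measurableSet
    {D : Finset (Cube N) | q (D : Set (Cube N))})

lemma measureReal_solutions_nonempty_le (hN : 0 < N) (hY : ∀ t, Measurable (Y t))
    (hlaw : ∀ t, P.map (Y t) = stdGaussian (EuclideanSpace ℝ (Fin N)))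
    (hindep : iIndepFun Y P) (κ : ℝ) (t : ℕ) :
    P.real {ω | (solutions κ t fun i => Y i ω).Nonempty} ≤ 2 ^ N * p κ ^ t := by
  have h := measureReal_le_card_survivors_mul_le hN hY hlaw hindep κ t 1
  rw [one_mul] at h
  refine (measureReal_mono fun ω hω => ?_).trans h
  rw [Set.mem_ofPred_eq] at hω ⊢
  rw [← coe_survivors hN, Finset.coe_nonempty] at hω
  exact_mod_cast hω.card_pos

/-- The number of solutions is controlled by its logarithmic defect from below and by its mean
from above. -/
lemma measureReal_log_card_le (hN : 3 ≤ N) (hY : ∀ t, Measurable (Y t))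
    (hlaw : ∀ t, P.map (Y t) = stdGaussian (EuclideanSpace ℝ (Fin N)))
    (hindep : iIndepFun Y P) {κ α A' K ε : ℝ} (hκ : 0 < κ) (hα : 0 ≤ α) (hA' : 0 ≤ A')
    (hK : 1 ≤ K)
    (hbad : P.real {ω | survivors κ (cubeVec (N := N)) (fun s => Y s ω) ⌊α * N⌋₊ = ∅ ∨
        A' * Real.log N < logDefect κ ((N + 1) ^ 3) ⌊α * N⌋₊
          (survivors κ (cubeVec (N := N)) (fun s => Y s ω) ⌊α * N⌋₊)} ≤ ε) :
    P.real {ω | solutions κ ⌊α * N⌋₊ (fun i => Y i ω) = ∅ ∨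
        (A' + Real.log K - Real.log (p κ)) * (Real.log N / N) <
          |Real.log (solutions κ ⌊α * N⌋₊ (fun i => Y i ω)).ncard / N
            - (Real.log 2 + α * Real.log (p κ))|} ≤ ε + K⁻¹ := by
  have hp := p_pos hκ
  have hlp := log_p_neg hκ
  have hN0 : 0 < N := by omega
  have hN3 : (3 : ℝ) ≤ N := by exact_mod_cast hN
  have hL : 1 ≤ Real.log N := by
    rw [Real.le_log_iff_exp_le (by linarith)]
    linarith [Real.exp_one_lt_d9]
  set T := ⌊α * N⌋₊ with hT
  set m : ℝ := 2 ^ N * p κ ^ T with hm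
  have hm0 : 0 < m := by positivity
  have hlogm : Real.log m = N * Real.log 2 + T * Real.log (p κ) := by
    rw [hm, Real.log_mul (by positivity) (by positivity), Real.log_pow, Real.log_pow]
  have hfl := abs_le.1 (abs_floor_mul_log_sub_le hκ hα N)
  rw [← hT] at hfl
  have hupper : P.real {ω | K * m ≤
      ((survivors κ (cubeVec (N := N)) (fun s => Y s ω) T).card : ℝ)} ≤ K⁻¹ := by
    have h := measureReal_le_card_survivors_mul_le hN0 hY hlaw hindep κ T (K * m)
    rw [← hm] at h
    rw [← one_div, le_div_iff₀ (by linarith)]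
    refine le_of_mul_le_mul_right ?_ hm0
    linarith
  refine le_trans ?_ (add_le_add hbad hupper)
  refine le_trans (measureReal_mono fun ω hω => ?_) (measureReal_union_le _ _)
  by_contra hω'
  rw [Set.mem_union, Set.mem_ofPred_eq, Set.mem_ofPred_eq] at hω'
  rw [Set.mem_ofPred_eq] at hω
  push Not at hω'
  obtain ⟨⟨hne, hdef⟩, hcard⟩ := hω'
  rw [← coe_survivors hN0, Set.ncard_coe_finset, Finset.coe_eq_empty] at hω
  rcases hω with hω | hω
  · exact hne.ne_empty hω
  · refine absurd hω (not_lt.2 ?_)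
    rw [logDefect, log_density_survivors hκ hne] at hdef
    have hB : 0 ≤ Real.log (((N : ℝ) + 1) ^ 3) :=
      Real.log_nonneg (one_le_pow₀ (by linarith))
    have hc0 : (0 : ℝ) < (survivors κ (cubeVec (N := N)) (fun s => Y s ω) T).card :=
      Nat.cast_pos.2 hne.card_pos
    have h1 := Real.log_le_log hc0 hcard.le
    rw [Real.log_mul (by linarith) hm0.ne', hlogm] at h1
    generalize ((survivors κ (cubeVec (N := N)) (fun s => Y s ω) T).card : ℝ) = n at *
    have hlK := Real.log_nonneg hK
    have hN' : (0 : ℝ) < N := by linarith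
    have e : Real.log n / N - (Real.log 2 + α * Real.log (p κ)) =
        (Real.log n - N * (Real.log 2 + α * Real.log (p κ))) / N := by field_simp
    rw [e, abs_div, abs_of_pos hN', ← mul_div_assoc]
    refine div_le_div_of_nonneg_right ?_ hN'.le
    have hA'L := mul_nonneg hA' (by linarith : 0 ≤ Real.log N)
    have h2 := mul_le_mul_of_nonneg_left hL (by linarith : 0 ≤ Real.log K - Real.log (p κ))
    rw [abs_le]
    constructor <;> nlinarith

end FixedDimension

end SymmetricPerceptron

open SymmetricPerceptron

/-- For every `N`, on some probability space, `X N 0, X N 1, …` are i.i.d. standard Gaussian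
vectors of `ℝ^N`, and `S_α(N)` is the solution space with the first `⌊αN⌋` of them.

* Below `α_c`, under the assumption on `F_α`:
  `(1/N) log |S_α(N)| = log 2 + α log p(κ) + O_ℙ(log N / N)`, where an empty `S_α(N)`
  (`log 0 = -∞`) counts as a violation of every bound, and `S_α(N)` is nonempty with
  probability `1 - o(1)`.
* Above `α_c`: `S_α(N)` is empty with probability `1 - o(1)`. -/
theorem theorem1p2 (κ : ℝ) (hκ : 0 < κ)
    {Ω : ℕ → Type*} [∀ N, MeasurableSpace (Ω N)]
    (P : ∀ N, Measure (Ω N)) [∀ N, IsProbabilityMeasure (P N)]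
    (X : ∀ N, ℕ → Ω N → EuclideanSpace ℝ (Fin N))
    (hlaw : ∀ N i, HasLaw (X N i) (stdGaussian (EuclideanSpace ℝ (Fin N))) (P N))
    (hindep : ∀ N, iIndepFun (X N) (P N)) :
    (∀ α : ℝ, 0 < α → α < SymmetricPerceptron.alphaC κ →
      SymmetricPerceptron.CriticalPointAssumption κ α →
        (∀ ε : ℝ, 0 < ε → ∃ M : ℝ, ∀ᶠ N : ℕ in atTop,
          (P N).real {ω |
            SymmetricPerceptron.solutions κ ⌊α * N⌋₊ (fun i => X N i ω) = ∅ ∨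
            M * (Real.log N / N) <
              |Real.log (SymmetricPerceptron.solutions κ ⌊α * N⌋₊ (fun i => X N i ω)).ncard / N
                - (Real.log 2 + α * Real.log (SymmetricPerceptron.p κ))|} ≤ ε) ∧
        Tendsto (fun N : ℕ => (P N).real {ω |
            (SymmetricPerceptron.solutions κ ⌊α * N⌋₊ (fun i => X N i ω)).Nonempty})
          atTop (𝓝 1)) ∧
    (∀ α : ℝ, SymmetricPerceptron.alphaC κ < α →
      Tendsto (fun N : ℕ => (P N).real {ω |
          SymmetricPerceptron.solutions κ ⌊α * N⌋₊ (fun i => X N i ω) = ∅})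
        atTop (𝓝 1)) := by
  have hp := p_pos hκ
  have hlp := log_p_neg hκ
  -- replace the a.e.-measurable constraint vectors by measurable versions
  choose Y hY hXY using fun N i => (hlaw N i).aemeasurable
  have hYlaw (N i) : (P N).map (Y N i) = stdGaussian (EuclideanSpace ℝ (Fin N)) := by
    rw [← Measure.map_congr (hXY N i), (hlaw N i).map_eq]
  have hYindep (N) : iIndepFun (Y N) (P N) := (hindep N).congr fun i => hXY N i
  have htransfer (N) (Φ : (ℕ → EuclideanSpace ℝ (Fin N)) → Prop) :
      (P N).real {ω | Φ fun i => X N i ω} = (P N).real {ω | Φ fun i => Y N i ω} := by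
    refine measureReal_congr ?_
    filter_upwards [ae_all_iff.2 (hXY N)] with ω hω
    have e : (fun i => X N i ω) = fun i => Y N i ω := funext hω
    change (Φ fun i => X N i ω) = (Φ fun i => Y N i ω)
    rw [e]
  have hcompl (α : ℝ) {N : ℕ} (hN : 0 < N) :
      (P N).real {ω | (solutions κ ⌊α * N⌋₊ (fun i => X N i ω)).Nonempty} =
        1 - (P N).real {ω | solutions κ ⌊α * N⌋₊ (fun i => X N i ω) = ∅} := by
    rw [htransfer N fun x => (solutions κ ⌊α * N⌋₊ x).Nonempty,
      htransfer N fun x => solutions κ ⌊α * N⌋₊ x = ∅,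
      ← probReal_compl_eq_one_sub (measurable_solutions hN (hY N) κ _ fun S => S = ∅)]
    congr 1
    ext ω
    simp [Set.nonempty_iff_ne_empty]
  refine ⟨fun α hα hαc hcrit => ?_, fun α hαc => ?_⟩
  · obtain ⟨c, hc, hgap⟩ := exists_quadratic_gap hκ hα hαc hcrit
    obtain ⟨s, hs⟩ := exists_bump hκ
    have hc₀ : 0 < min (p κ) (gaussAvg s / 2 - Real.exp (-(s ^ 2 * κ ^ 2) / 2)) :=
      lt_min hp (by linarith)
    set c₀ := min (p κ) (gaussAvg s / 2 - Real.exp (-(s ^ 2 * κ ^ 2) / 2)) with hc₀def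
    have main : ∀ ε : ℝ, 0 < ε → ∃ M : ℝ, ∀ᶠ N : ℕ in atTop,
          (P N).real {ω | solutions κ ⌊α * N⌋₊ (fun i => X N i ω) = ∅ ∨
            M * (Real.log N / N) <
              |Real.log (solutions κ ⌊α * N⌋₊ (fun i => X N i ω)).ncard / N
                - (Real.log 2 + α * Real.log (p κ))|} ≤ ε := by
      intro ε hε
      set C₁ := 2 * ((2 * κ ^ 2 + 4) / (c₀ * p κ)) with hC₁
      -- `14 exp (C₁ α / c) / ε` brings the Gronwall bound below `ε / 2` after division by the cap, and
      -- `6` makes the cap exceed the initial potential `3 log (N + 1) ≤ 6 log N`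
      set A' := 6 + 14 * Real.exp (C₁ * α / c) / ε with hA'
      have hA'1 : 6 ≤ A' := by
        have : 0 ≤ 14 * Real.exp (C₁ * α / c) / ε := by positivity
        linarith
      have hm := gaussAvg_pos s
      have h6 : 0 ≤ ∫ η, η ^ 6 ∂(gaussianReal 0 1) := integral_nonneg fun η => by positivity
      refine ⟨A' + Real.log (1 + 2 / ε) - Real.log (p κ), ?_⟩
      filter_upwards [eventually_gronwall_le (C₁ := C₁) (C₂ := 14256 * s ^ 6 *
          (∫ η, η ^ 6 ∂(gaussianReal 0 1)) / (gaussAvg s / 2) ^ 4) (l := -2 * Real.log (p κ))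
          (A' := A') hα hc (by positivity) (by positivity) (by linarith) (by linarith),
        eventually_ge_atTop 3] with N hN hN3
      have hN3' : (3 : ℝ) ≤ N := by exact_mod_cast hN3
      have hL : 1 ≤ Real.log N := by
        rw [Real.le_log_iff_exp_le (by linarith)]
        linarith [Real.exp_one_lt_d9]
      have hlog : 3 * Real.log ((N : ℝ) + 1) ≤ A' * Real.log N := by
        have : Real.log ((N : ℝ) + 1) ≤ Real.log ((N : ℝ) ^ 2) :=
          Real.log_le_log (by positivity) (by nlinarith)
        rw [Real.log_pow] at this
        push_cast at this
        nlinarith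
      have hbad := measureReal_sparse_cube_mul_le (by omega : 0 < N) (hY N) (hYlaw N) (hYindep N) hκ
        hα.le hc hgap hc₀ (min_le_left _ _) (min_le_right _ _) hlog
      have e : A' * Real.log N + -2 * Real.log (p κ) = A' * Real.log N - 2 * Real.log (p κ) := by
        ring
      rw [e] at hN
      have hbad2 := hbad.trans hN
      have hbad3 : (P N).real {ω |
          survivors κ (cubeVec (N := N)) (fun s => Y N s ω) ⌊α * N⌋₊ = ∅ ∨
          A' * Real.log N < logDefect κ ((N + 1) ^ 3) ⌊α * N⌋₊
            (survivors κ (cubeVec (N := N)) (fun s => Y N s ω) ⌊α * N⌋₊)} ≤ ε / 2 := by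
        refine le_of_mul_le_mul_right (hbad2.trans ?_) (by nlinarith : 0 < A' * Real.log N)
        rw [← mul_assoc]
        refine mul_le_mul_of_nonneg_right ?_ (by linarith)
        have : ε / 2 * A' = 3 * ε + 7 * Real.exp (C₁ * α / c) := by
          rw [hA']
          field_simp
          ring
        linarith
      have hfin := measureReal_log_card_le hN3 (hY N) (hYlaw N) (hYindep N) (K := 1 + 2 / ε) hκ
        hα.le (by linarith : 0 ≤ A') (by
          have : 0 ≤ 2 / ε := by positivity
          linarith) hbad3
      refine ((htransfer N fun x => solutions κ ⌊α * N⌋₊ x = ∅ ∨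
          (A' + Real.log (1 + 2 / ε) - Real.log (p κ)) * (Real.log N / N) <
            |Real.log (solutions κ ⌊α * N⌋₊ x).ncard / N
              - (Real.log 2 + α * Real.log (p κ))|).le.trans hfin).trans ?_
      have hK : (1 + 2 / ε)⁻¹ ≤ ε / 2 := by
        rw [inv_le_comm₀ (by positivity) (by positivity), inv_div]
        linarith
      linarith
    refine ⟨main, ?_⟩
    have hempty : Tendsto (fun N : ℕ => (P N).real {ω |
        solutions κ ⌊α * N⌋₊ (fun i => X N i ω) = ∅}) atTop (𝓝 0) := by
      refine tendsto_order.2 ⟨fun a ha => Eventually.of_forall fun N =>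
        ha.trans_le measureReal_nonneg, fun a ha => ?_⟩
      obtain ⟨M, hM⟩ := main (a / 2) (half_pos ha)
      filter_upwards [hM] with N hN
      exact ((measureReal_mono fun ω hω => Or.inl hω).trans hN).trans_lt (half_lt_self ha)
    have h := hempty.const_sub 1
    rw [sub_zero] at h
    refine h.congr' ?_
    filter_upwards [eventually_gt_atTop 0] with N hN
    exact (hcompl α hN).symm
  · have hα : 0 ≤ α := by
      have : 0 < alphaC κ := div_pos_of_neg_of_neg (by simpa using Real.log_pos one_lt_two) hlp
      linarith
    have hneg := log_two_add_mul_log_p_neg hκ hαc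
    have hbound : Tendsto (fun N : ℕ => Real.exp (-Real.log (p κ)) *
        Real.exp ((N : ℝ) * (Real.log 2 + α * Real.log (p κ)))) atTop (𝓝 0) := by
      have h := Real.tendsto_exp_atBot.comp
        (tendsto_natCast_atTop_atTop.atTop_mul_const_of_neg hneg)
      simpa using h.const_mul (Real.exp (-Real.log (p κ)))
    have hnon : Tendsto (fun N : ℕ => (P N).real {ω |
        (solutions κ ⌊α * N⌋₊ (fun i => X N i ω)).Nonempty}) atTop (𝓝 0) := by
      refine squeeze_zero' (Eventually.of_forall fun N => measureReal_nonneg) ?_ hbound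
      filter_upwards [eventually_gt_atTop 0] with N hN
      rw [htransfer N fun x => (solutions κ ⌊α * N⌋₊ x).Nonempty]
      refine (measureReal_solutions_nonempty_le hN (hY N) (hYlaw N) (hYindep N) κ _).trans ?_
      have h2N : (2 : ℝ) ^ N = Real.exp (N * Real.log 2) := by
        rw [Real.exp_nat_mul, Real.exp_log two_pos]
      have hpT : p κ ^ ⌊α * N⌋₊ = Real.exp (⌊α * N⌋₊ * Real.log (p κ)) := by
        rw [Real.exp_nat_mul, Real.exp_log hp]
      rw [h2N, hpT, ← Real.exp_add, ← Real.exp_add]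
      refine Real.exp_le_exp.2 ?_
      have := abs_le.1 (abs_floor_mul_log_sub_le hκ hα N)
      linarith
    have h := hnon.const_sub 1
    rw [sub_zero] at h
    refine h.congr' ?_
    filter_upwards [eventually_gt_atTop 0] with N hN
    rw [hcompl α hN]
    ring
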